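/- **Notation.** Let $d\ge 0$ be an integer and let $\mathfrak X(\mathbb R^d)$ be the set of $C^\infty$ vector fields on $\mathbb R^d$. For a measure $\mu$ on $\mathbb R^d$, $L^2_\mu$ denotes the square-integrable vector fields, and $H(\mu)=\int \log\frac{d\mu}{dx}\,d\mu$. For a vector field $g$ let $(\nabla g)_{ij}=\partial_i g^j$. For $n\ge1$ and smooth vector fields $g_1,\dots,g_n$ let $$\Lambda_n(g_1,\dots,g_n)=\frac{(-1)^n}{n}\sum_{\sigma\in\mathfrak S_n}\operatorname{tr}\big((\nabla g_{\sigma(1)})\cdots(\nabla g_{\sigma(n)})\big).$$ Write $\Lambda^{(n,\mu)}_{i_1\dots i_n}\Phi_1^{i_1}\cdots\Phi_n^{i_n}:=\int\Lambda_n(\Phi_1,\dots,\Phi_n)\,d\mu$, and let $\Lambda^{(n,\mu)}_{i_1\dots i_n}\Phi_1^{i_1}\cdots\Phi_{n-1}^{i_{n-1}}$ denote the vector field $\Psi\in L^2_\mu\cap\mathfrak X(\mathbb R^d)$ (with index $i_n$) such that $\int\xi^\top\Psi\,d\mu=\int\Lambda_n(\Phi_1,\dots,\Phi_{n-1},\xi)\,d\mu$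 for all $\xi\in L^2_\mu\cap\mathfrak X(\mathbb R^d)$ for which $\Lambda_n(\Phi_1,\dots,\Phi_{n-1},\xi)$ is $\mu$-integrable. Call a probability measure $\mu$ *regular* if it has a density $e^U$ with $U\in C^\infty(\mathbb R^d)$ and $\int\|\nabla^kU\|^p\,d\mu<\infty$ for all $k\ge1$ and all $p\in[0,\infty)$. **Value of a tree.** Let $T$ be a finite tree with at least one edge. Label its edges, and read each node with edges $i_1,\dots,i_k$ as the symbol $\Lambda^{(k,\mu)}_{i_1\dots i_k}$. Consider the product of all these symbols (repeated indices are contracted). A parenthesization of the product is compatible if each inner bracket contracts a symbol $\Lambda^{(k,\mu)}$ along all but one of its indices (giving a vector field). The outermost operation is then either the full contraction of the symbol of one node with the $k$ vector fields of the branches at this node, or the pairing $\int\Phi^\top\Psi\,d\mu$ of the two vector fields that face each other across one edge. **Forests.** $F^0$ is a single node. $F^{n+1}$ is the disjoint union, over all nodes $X$ of $F^n$, of a copy of the component of $F^n$ containing $X$ with one leaf added at $X$. **Proposition.** 1. Let $\mu$ be a regular probability measure on $\mathbb R^d$ and $T$ a finite tree with at least one edge. Then for every compatible parenthesization all the contractions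 exist and are unique and the outermost integral converges, and all compatible parenthesizations have the same value. This common value is denoted $\mathrm{val}_\mu(T)$, and for a forest $F$ whose components are such trees, $\mathrm{val}_\mu(F)$ denotes the sum of the values of its components (with multiplicity). 2. Let $I\subseteq\mathbb R$ be an open interval and $(\mu_t)_{t\in I}$ a curve of probability measures on $\mathbb R^d$ with finite second moments that solves the heat equation $\partial_t\mu_t=\Delta\mu_t$ weakly, i.e. $\frac{d}{dt}\int\varphi\,d\mu_t=\int\Delta\varphi\,d\mu_t$ for all $\varphi\in C_c^\infty(\mathbb R^d)$ and $t\in I$. Then each $\mu_t$ is regular, $\log\frac{d\mu_t}{dx}$ is $\mu_t$-integrable, $t\mapsto H(\mu_t)$ is $C^\infty$ on $I$, and for all $n\ge1$ and $t\in I$ $$(-1)^n\frac{d^n}{dt^n}H(\mu_t)=\mathrm{val}_{\mu_t}(F^n).$$ -/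

import Mathlib

open MeasureTheory Set
open scoped ContDiff BigOperators

namespace EntropyFlow

/-- The space `ℝ^d` with its Euclidean norm. -/
abbrev Euc (d : ℕ) : Type := EuclideanSpace ℝ (Fin d)

/-! ### Entropy and the operators `Λ_n` -/

/-- The (negative) differential entropy `H(μ) = ∫ log (dμ/dx) dμ`. -/
noncomputable def entropy {d : ℕ} (μ : Measure (Euc d)) : ℝ :=
  ∫ x, Real.log (μ.rnDeriv volume x).toReal ∂μ

/-- The matrix `(∇ g)_{ij} = ∂_i g^j` of a vector field `g` at the point `x`. -/
noncomputable def nablaMatrix {d : ℕ} (g : Euc d → Euc d) (x : Euc d) :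
    Matrix (Fin d) (Fin d) ℝ :=
  Matrix.of fun i j => (fderiv ℝ g x (EuclideanSpace.single i 1)) j

open Classical in
/-- The symmetric `n`-linear operator
`Λ_n(g_1, …, g_n) = (-1)^n (1/n) ∑_σ trace ((∇ g_{σ(1)}) ⋯ (∇ g_{σ(n)}))`,
mapping vector fields to scalar fields. The `n` arguments are indexed by an arbitrary finite
type `ι` with `n` elements, and `σ` runs over the `n!` enumerations of `ι`
(the permutations of `{1, …, n}` if `ι = Fin n`). -/
noncomputable def Lam {d : ℕ} {ι : Type*} [Fintype ι] (g : ι → Euc d → Euc d) (x : Euc d) : ℝ :=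
  (-1) ^ Fintype.card ι * (1 / (Fintype.card ι : ℝ)) *
    ∑ σ : Fin (Fintype.card ι) ≃ ι,
      ((List.ofFn fun k => nablaMatrix (g (σ k)) x).prod).trace

/-! ### The tensors `Λ^{(n, μ)}` and their contractions -/

/-- `g` belongs to `L²_μ ∩ 𝔛(ℝ^d)`: a smooth vector field, square integrable for `μ`. -/
def IsL2Field {d : ℕ} (μ : Measure (Euc d)) (g : Euc d → Euc d) : Prop :=
  ContDiff ℝ ∞ g ∧ MemLp g 2 μ

/-- The vector field `Ψ` is the contraction
`Λ^{(n, μ)}_{i_1 … i_n} Φ_{(1)}^{i_1} ⋯ Φ_{(n-1)}^{i_{n-1}}` (with free index `i_n`):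
`Ψ ∈ L²_μ ∩ 𝔛(ℝ^d)` and `∫ ξ ⬝ Ψ dμ = ∫ Λ_n(Φ_{(1)}, …, Φ_{(n-1)}, ξ) dμ` for all
`ξ ∈ L²_μ ∩ 𝔛(ℝ^d)` for which the right-hand side is a convergent integral.
Here `ι` is an index type with `n - 1` elements and `Option ι` has one more, for `ξ`. -/
def IsContraction {d : ℕ} (μ : Measure (Euc d)) {ι : Type*} [Fintype ι]
    (Φ : ι → Euc d → Euc d) (Ψ : Euc d → Euc d) : Prop :=
  IsL2Field μ Ψ ∧
    ∀ ξ : Euc d → Euc d, IsL2Field μ ξ →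
      Integrable (Lam fun o : Option ι => o.elim ξ Φ) μ →
        ∫ x, inner ℝ (ξ x) (Ψ x) ∂μ = ∫ x, Lam (fun o : Option ι => o.elim ξ Φ) x ∂μ

/-! ### The scalar associated to a tree -/

open Classical in
/-- `IsBranchVal μ G u v Ψ`, for an edge `u v` of the tree `G`: the vector field `Ψ` is obtained
from the branch of `G` that hangs at `u` after cutting the edge `u v`, whose free index is the
index of that edge. Every node of degree `k` is read as `Λ^{(k, μ)}`: the symbol at `u` is
contracted with the vector fields of the branches at all neighbours `w ≠ v` of `u`. -/
inductive IsBranchVal {d : ℕ} (μ : Measure (Euc d)) {V : Type} [Fintype V] (G : SimpleGraph V) :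
    V → V → (Euc d → Euc d) → Prop
  | mk (u v : V) (huv : G.Adj u v) (Φ : {w : V // G.Adj u w ∧ w ≠ v} → Euc d → Euc d)
      (hΦ : ∀ w, IsBranchVal μ G w.1 u (Φ w)) (Ψ : Euc d → Euc d)
      (hΨ : IsContraction μ Φ Ψ) : IsBranchVal μ G u v Ψ

/-- The compatible parenthesizations of the product of the symbols `Λ^{(k, μ)}` over the nodes of
a tree. A parenthesization is compatible if each inner bracket is a symbol contracted along all of
its indices but one, that is, a vector field, so that the bracket is given by its one free edge;
the outermost operation is then either the full contraction of the symbol of a node with the vector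
fields of all branches at this node, or the pairing in `L²_μ` of the two vector fields
that face each other across an edge. -/
inductive Parenthesization {V : Type} (G : SimpleGraph V) : Type
  | node (v : V) : Parenthesization G
  | edge (u v : V) (huv : G.Adj u v) : Parenthesization G

open Classical in
/-- The parenthesization `p` of the product attached to the tree `G` makes sense (all contractions
exist, and the outermost integral converges), and its value is `c`. -/
def HasVal {d : ℕ} (μ : Measure (Euc d)) {V : Type} [Fintype V] (G : SimpleGraph V) :
    Parenthesization G → ℝ → Prop
  | .node v, c => ∃ Φ : {w : V // G.Adj v w} → Euc d → Euc d,
      (∀ w, IsBranchVal μ G w.1 v (Φ w)) ∧ Integrable (Lam Φ) μ ∧ c = ∫ x, Lam Φ x ∂μ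
  | .edge u v _, c => ∃ Φ Ψ : Euc d → Euc d,
      IsBranchVal μ G u v Φ ∧ IsBranchVal μ G v u Ψ ∧
        Integrable (fun x => inner ℝ (Φ x) (Ψ x)) μ ∧ c = ∫ x, inner ℝ (Φ x) (Ψ x) ∂μ

/-- The scalar `val_μ(G)` associated to a tree `G`: the common value of all compatible
parenthesizations. -/
noncomputable def treeVal {d : ℕ} (μ : Measure (Euc d)) {V : Type} [Fintype V]
    (G : SimpleGraph V) : ℝ :=
  Classical.epsilon fun c => ∀ p : Parenthesization G, HasVal μ G p c

/-! ### The forests `F^n` -/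

/-- A forest, as the finite family (with repetitions) of its components. -/
abbrev Forest : Type := Multiset (Σ m : ℕ, SimpleGraph (Fin m))

/-- The graph `T` with one new node (the last one), joined to the node `x` of `T` only. -/
def addLeaf {m : ℕ} (T : SimpleGraph (Fin m)) (x : Fin m) : SimpleGraph (Fin (m + 1)) :=
  T.map Fin.castSuccEmb ⊔ SimpleGraph.edge x.castSucc (Fin.last m)

/-- `F^0` is a single node; `F^{n+1}` contains, for each node `X` of `F^n`, a copy of the
component of `X` in `F^n` with a leaf added to `X`. -/
def gradForest : ℕ → Forest
  | 0 => {⟨1, ⊥⟩}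
  | n + 1 => (gradForest n).bind fun T =>
      (Finset.univ : Finset (Fin T.1)).val.map fun x => ⟨T.1 + 1, addLeaf T.2 x⟩

/-- The sum `val_μ(F)` of the scalars associated to the components of the forest `F`. -/
noncomputable def forestVal {d : ℕ} (μ : Measure (Euc d)) (F : Forest) : ℝ :=
  (F.map fun T => treeVal μ T.2).sum

/-! ### Regular measures and the heat flow -/

/-- `μ` has a smooth positive density `e^U`, and all derivatives of `U = log μ`, of any order
`k ≥ 1`, have finite moments of all orders for `μ`. -/
def IsRegular {d : ℕ} (μ : Measure (Euc d)) : Prop :=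
  ∃ U : Euc d → ℝ, ContDiff ℝ ∞ U ∧
    μ = volume.withDensity (fun x => ENNReal.ofReal (Real.exp (U x))) ∧
    ∀ k : ℕ, 1 ≤ k → ∀ p : NNReal, MemLp (iteratedFDeriv ℝ k U) p μ

/-- `(μ_t)_{t ∈ I}` is a curve of probability measures with finite second moments that solves
`∂_t μ_t = Δ μ_t` for `t ∈ I` in the sense of distributions on `ℝ^d`. -/
structure IsHeatFlow {d : ℕ} (I : Set ℝ) (μ : ℝ → Measure (Euc d)) : Prop where
  prob : ∀ t ∈ I, IsProbabilityMeasure (μ t)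
  moment : ∀ t ∈ I, Integrable (fun x => ‖x‖ ^ 2) (μ t)
  pde : ∀ φ : Euc d → ℝ, ContDiff ℝ ∞ φ → HasCompactSupport φ → ∀ t ∈ I,
    HasDerivAt (fun s => ∫ x, φ x ∂(μ s)) (∫ x, Laplacian.laplacian φ x ∂(μ t)) t

end EntropyFlow

/-! Let ρ be a smooth positive density of μ and let s = ∇ log ρ. Integrating by parts against ρ
solves the identity that defines a contraction: if M is the symmetrized product of the matrices ∇Φ_w
of the n contracted fields, the contraction is (-1)^n times the divergence of M with respect to ρ,
with components Σ_j (∂_j M_ij + M_ij s_j) (`IsJet.isContraction`). A leaf thus stands for s itself,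
and every branch is a polynomial in the ratios ∂^α ρ / ρ. Such polynomials form `JetRing`, on which
∂_i and ∂_t are derivations given on generators; integrability reduces to moments of the ratios.
Tested on the field of the opposite branch, the identity says that the full contraction at a node
equals the pairing across each of its edges. As the tree is connected, all parenthesizations agree
(`IsJet.edgeVal_eq`).

The heat equation transports μ_t with velocity -s, so d/dt ∫ f dμ_t = ∫ Df dμ_t with D = ∂_t - s·∇
(`hasDerivAt_integral_ev`). Put H = ∇s. Then D∇ = ∇D + H∇, and D maps the divergence of M to the
divergence of DM + MH. On a symmetrized product, D therefore differentiates each argument and also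
inserts H before every factor and after the last one: these are exactly the positions of one
additional argument s. Hence D of a contraction is the sum of the contractions with one argument
differentiated, minus the contraction with the additional argument s (`mat_contr`). By induction D
adds, up to sign, a leaf at every node of a branch (`mat_branch`), and each node lies in exactly one
of the two branches at an edge (`mat_edgeSymbol`). So val(F^n) has derivative -val(F^{n+1}) for n ≥
1; de Bruijn's identity starts the hierarchy at the entropy (`hasDerivAt_entropy`).

The analytic input is that a weak flow is the Gaussian convolution of any of its earlier measures:
testing with cut-off cosines and sines determines the characteristic functions
(`IsHeatFlow.eq_heatMeasure`). A ratio ∂^α ρ / ρ is then a conditional expectation of a polynomial.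
Jensen's inequality bounds its powers by another such expectation, and multiplying by ρ leaves
Gaussian convolutions. Finite second moments give these an integrable bound with weight 1 + |x|²,
locally uniform in time (`dominatedMoments_heatRatio`), and the weight absorbs log ρ, which grows at
most quadratically. -/

namespace EntropyFlow

/-! ### Sums of products over all enumerations of a finite type -/

section Enumerations

variable {ι κ : Type*} [Fintype ι] [Fintype κ] {R : Type*} [Ring R]

open Classical in
/-- The sum over all enumerations `σ` of `ι` of the products `A (σ 0) ⋯ A (σ (n - 1))`. -/
noncomputable def enumSum (n : ℕ) (A : ι → R) : R :=
  ∑ σ : Fin n ≃ ι, (List.ofFn fun k => A (σ k)).prod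

/-- The sum of all products obtained by inserting `B` into the list of factors. -/
def insertSum (B : R) : List R → R
  | [] => B
  | a :: l => B * (a * l.prod) + a * insertSum B l

theorem enumSum_comp_equiv (n : ℕ) (e : κ ≃ ι) (A : ι → R) :
    enumSum n (fun k => A (e k)) = enumSum n A := by
  classical
  unfold enumSum
  refine Fintype.sum_equiv ((Equiv.refl (Fin n)).equivCongr e) _ _ fun σ => ?_
  simp [Equiv.equivCongr]

/-- The bijection `finSuccEquiv' k` sends slot k to `none` and keeps the order of the others, so the
k-th summand has `B` in slot k. Peeling off the first factor matches the recursion of `insertSum`.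
-/
theorem sum_prod_ofFn_elim_finSuccEquiv' (B : R) : ∀ (n : ℕ) (f : Fin n → R),
    ∑ k : Fin (n + 1), (List.ofFn fun j => (finSuccEquiv' k j).elim B f).prod =
      insertSum B (List.ofFn f)
  | 0, f => by simp [insertSum]
  | n + 1, f => by
    rw [Fin.sum_univ_succ, List.ofFn_succ (f := f), insertSum,
      ← sum_prod_ofFn_elim_finSuccEquiv' B n (fun i => f i.succ), Finset.mul_sum]
    congr 1
    · have h : ∀ j : Fin (n + 1), finSuccEquiv' 0 j.succ = some j := fun j => by simp
      rw [List.ofFn_succ]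
      simp only [h, finSuccEquiv'_at, Option.elim, List.prod_cons]
      rw [List.ofFn_succ (f := f), List.prod_cons]
    · refine Finset.sum_congr rfl fun k _ => ?_
      rw [List.ofFn_succ, List.prod_cons]
      have h0 : finSuccEquiv' k.succ (0 : Fin (n + 2)) = some 0 := by simp
      rw [h0]
      congr 3
      ext j
      rcases Fin.eq_self_or_eq_succAbove k j with rfl | ⟨j, rfl⟩
      · simp
      · have h1 : (k.succAbove j).succ = k.succ.succAbove j.succ := by simp
        rw [h1, finSuccEquiv'_succAbove, finSuccEquiv'_succAbove]
        rfl

open Classical in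
/-- Enumerations of `Option ι` are enumerations of `ι` with a position for `none`. -/
noncomputable def enumOptionEquiv (n : ℕ) :
    (Fin n ≃ ι) × Fin (n + 1) ≃ (Fin (n + 1) ≃ Option ι) :=
  Equiv.ofBijective (fun p => (finSuccEquiv' p.2).trans (Equiv.optionCongr p.1)) <| by
    constructor
    · rintro ⟨σ, k⟩ ⟨τ, l⟩ h
      have hk : k = l := by
        have h1 := congrArg (fun e : Fin (n + 1) ≃ Option ι => e k) h
        simp only [Equiv.trans_apply, finSuccEquiv'_at, Equiv.optionCongr_apply,
          Option.map_none] at h1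
        have h2 : finSuccEquiv' l k = none := by
          cases h3 : finSuccEquiv' l k with
          | none => rfl
          | some a => simp [h3] at h1
        have := (finSuccEquiv' l).injective (h2.trans (finSuccEquiv'_at l).symm)
        exact this
      subst hk
      have h' : (Equiv.optionCongr σ : Option (Fin n) ≃ Option ι) = Equiv.optionCongr τ := by
        ext1 x
        have h1 := congrArg (fun e : Fin (n + 1) ≃ Option ι => e ((finSuccEquiv' k).symm x)) h
        simpa using h1
      rw [Equiv.optionCongr_injective h']
    · intro e
      -- The slot is where `none` sits; deleting it leaves an enumeration of `ι`.
      refine ⟨⟨Equiv.removeNone ((finSuccEquiv' (e.symm none)).symm.trans e), e.symm none⟩, ?_⟩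
      have h : ((finSuccEquiv' (e.symm none)).symm.trans e) none = none := by simp
      ext1 x
      rcases Fin.eq_self_or_eq_succAbove (e.symm none) x with rfl | ⟨j, rfl⟩
      · simp
      · simp only [Equiv.trans_apply, finSuccEquiv'_succAbove, Equiv.optionCongr_apply,
          Option.map_some]
        rw [Equiv.removeNone_some]
        · simp
        · rw [← Option.ne_none_iff_exists']
          intro h'
          have := (Equiv.injective _ (h'.trans h.symm))
          simp at this

open Classical in
theorem enumSum_option (n : ℕ) (B : R) (A : ι → R) :
    enumSum (n + 1) (fun o : Option ι => o.elim B A) =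
      ∑ σ : Fin n ≃ ι, insertSum B (List.ofFn fun k => A (σ k)) := by
  unfold enumSum
  refine (Finset.sum_congr (by ext; simp) fun _ _ => rfl).trans <|
    (Fintype.sum_equiv (enumOptionEquiv n)
    (fun p => (List.ofFn fun j => (enumOptionEquiv n p j).elim B A).prod)
    (fun e => (List.ofFn fun j => (e j).elim B A).prod) fun _ => rfl).symm.trans ?_
  rw [Fintype.sum_prod_type]
  refine Fintype.sum_congr _ _ fun σ => ?_
  rw [← sum_prod_ofFn_elim_finSuccEquiv']
  refine Fintype.sum_congr _ _ fun k => ?_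
  congr 3
  ext j
  have h : enumOptionEquiv n (σ, k) j = (finSuccEquiv' k j).map σ := rfl
  rw [h]
  cases finSuccEquiv' k j <;> rfl

/-- Differentiating the k-th factor yields `A' k` in its place and also `B` inserted just before it.
The only insertion position missed in this way is the one after the last factor, which the second
term on the left supplies. -/
theorem leibniz_prod_ofFn (D : R →+ R) (hD : ∀ a b, D (a * b) = D a * b + a * D b) (B : R) :
    ∀ (n : ℕ) (A A' : Fin n → R), (∀ k, D (A k) = A' k + B * A k) →
      D (List.ofFn A).prod + (List.ofFn A).prod * B =
        ∑ k, (List.ofFn (Function.update A k (A' k))).prod + insertSum B (List.ofFn A)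
  | 0, A, A', h => by
    have : D 1 = 0 := by simpa using hD 1 1
    simp [insertSum, this]
  | n + 1, A, A', h => by
    have ih := leibniz_prod_ofFn D hD B n (fun k => A k.succ) (fun k => A' k.succ)
      (fun k => h k.succ)
    rw [List.ofFn_succ, List.prod_cons, hD, Fin.sum_univ_succ, insertSum, mul_assoc, add_assoc,
      ← mul_add, ih, h 0, mul_add, Finset.mul_sum]
    have h0 : (List.ofFn (Function.update A 0 (A' 0))).prod =
        A' 0 * (List.ofFn fun k => A k.succ).prod := by
      rw [List.ofFn_succ]; simp
    have h1 : ∀ k : Fin n, (List.ofFn (Function.update A k.succ (A' k.succ))).prod =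
        A 0 * (List.ofFn (Function.update (fun k => A k.succ) k (A' k.succ))).prod := by
      intro k
      rw [List.ofFn_succ, List.prod_cons, Function.update_of_ne (Fin.succ_ne_zero k).symm]
      congr 3
      ext j
      by_cases hj : j = k
      · subst hj; simp
      · rw [Function.update_of_ne hj, Function.update_of_ne (by simpa using hj)]
    rw [h0]
    simp only [h1]
    noncomm_ring

open Classical in
theorem sum_update_enum (n : ℕ) (A A' : ι → R) :
    ∑ σ : Fin n ≃ ι, ∑ k, (List.ofFn (Function.update (fun k => A (σ k)) k (A' (σ k)))).prod =
      ∑ w, enumSum n (Function.update A w (A' w)) := by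
  unfold enumSum
  rw [Finset.sum_comm (s := (Finset.univ : Finset ι))]
  refine Fintype.sum_congr _ _ fun σ => ?_
  rw [← σ.sum_comp]
  refine Fintype.sum_congr _ _ fun k => ?_
  congr 2
  ext j
  by_cases hj : j = k
  · subst hj; simp
  · rw [Function.update_of_ne hj, Function.update_of_ne (by simpa using hj)]

open Classical in
/-- Leibniz rule for symmetrized products, for a derivation of the form `D A = A' + B A`. -/
theorem leibniz_enumSum (D : R →+ R) (hD : ∀ a b, D (a * b) = D a * b + a * D b) (B : R) (n : ℕ)
    (A A' : ι → R) (h : ∀ w, D (A w) = A' w + B * A w) :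
    D (enumSum n A) + enumSum n A * B =
      ∑ w, enumSum n (Function.update A w (A' w)) +
        enumSum (n + 1) (fun o : Option ι => o.elim B A) := by
  rw [enumSum_option, ← sum_update_enum, enumSum, map_sum, Finset.sum_mul,
    ← Finset.sum_add_distrib, ← Finset.sum_add_distrib]
  exact Fintype.sum_congr _ _ fun σ => leibniz_prod_ofFn D hD B n _ _ fun k => h (σ k)

end Enumerations

/-! ### Cyclic invariance -/

section Trace

variable {ι : Type*} [Fintype ι] {m : Type*} [Fintype m] [DecidableEq m] {K : Type*} [CommRing K]

theorem insertSum_eq_sum_insertIdx {R : Type*} [Ring R] (B : R) (l : List R) :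
    insertSum B l = ∑ k ∈ Finset.range (l.length + 1), (l.insertIdx k B).prod := by
  induction l with
  | nil => simp [insertSum]
  | cons a l ih =>
    rw [List.length_cons, Finset.sum_range_succ', insertSum, ih, Finset.mul_sum, add_comm]
    simp

theorem insertIdx_append_of_le {α : Type*} (b : α) (l' : List α) : ∀ (l : List α) (k : ℕ),
    k ≤ l.length → (l ++ l').insertIdx k b = l.insertIdx k b ++ l'
  | _, 0, _ => by simp
  | [], k + 1, h => by simp at h
  | a :: l, k + 1, h => by
    simp [insertIdx_append_of_le b l' l k (by simpa using h)]

-- Rotating the enumeration by one step and using cyclicity of the trace moves `B` by one position.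
-- Rotation permutes the enumerations, so the sum does not depend on the position.
open Classical in
theorem sum_trace_insertIdx (B : Matrix m m K) (n : ℕ) (A : ι → Matrix m m K) (k : ℕ)
    (hk : k ≤ n) :
    ∑ σ : Fin n ≃ ι, (((List.ofFn fun j => A (σ j)).insertIdx k B).prod).trace =
      ∑ σ : Fin n ≃ ι, ((List.ofFn fun j => A (σ j)).prod * B).trace := by
  induction k with
  | zero => simp [Matrix.trace_mul_comm B]
  | succ k ih =>
    rw [← ih (by omega)]
    obtain ⟨n, rfl⟩ : ∃ m, n = m + 1 := ⟨n - 1, by omega⟩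
    refine Fintype.sum_equiv ((finRotate (n + 1)).symm.equivCongr (Equiv.refl ι)) _ _ fun σ => ?_
    have h1 : (List.ofFn fun j => A ((((finRotate (n + 1)).symm.equivCongr (Equiv.refl ι)) σ) j)) =
        (List.ofFn fun j : Fin n => A (σ j.succ)) ++ [A (σ 0)] := by
      rw [List.ofFn_succ', List.concat_eq_append]
      congr 2
      · simp [Equiv.equivCongr]
      · simp [Equiv.equivCongr]
    rw [h1, insertIdx_append_of_le _ _ _ _ (by simp; omega), List.ofFn_succ,
      List.insertIdx_succ_cons, List.prod_cons, List.prod_append, Matrix.trace_mul_comm]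
    simp

open Classical in
/-- The trace of the symmetrized product with one factor singled out. -/
theorem trace_enumSum_option (B : Matrix m m K) (n : ℕ) (A : ι → Matrix m m K) :
    (enumSum (n + 1) fun o : Option ι => o.elim B A).trace =
      (n + 1) * (enumSum n A * B).trace := by
  rw [enumSum_option]
  simp only [insertSum_eq_sum_insertIdx, List.length_ofFn, Matrix.trace_sum]
  rw [Finset.sum_comm, Finset.sum_congr rfl fun k hk => sum_trace_insertIdx B n A k
    (by simpa [Nat.lt_succ_iff] using hk)]
  simp [enumSum, Finset.sum_mul, Matrix.trace_sum]

end Trace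
/-! ### The differential ring of the jets of a density -/

/-- Polynomials in the normalized derivatives `X_s = ∂^s ρ / ρ` of a density `ρ`. -/
abbrev JetRing (d : ℕ) : Type := MvPolynomial (Multiset (Fin d)) ℝ

namespace JetRing

open MvPolynomial

variable {d : ℕ}

/-- The partial derivative `∂_i` on `JetRing d`. -/
noncomputable def del (i : Fin d) : Derivation ℝ (JetRing d) (JetRing d) :=
  -- The quotient rule for ∂^s ρ / ρ. The generator with empty index stays a free variable; its
  -- value 1 is never needed.
  mkDerivation ℝ fun s => X (i ::ₘ s) - X s * X {i}

/-- The symbol `Δ ρ / ρ`. -/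
noncomputable def lapX : JetRing d := ∑ k : Fin d, X {k, k}

/-- The time derivative along the heat flow on `JetRing d`. -/
noncomputable def delT : Derivation ℝ (JetRing d) (JetRing d) :=
  -- The quotient rule again, with ∂_t ρ = Δρ.
  mkDerivation ℝ fun s => ∑ k : Fin d, X (k ::ₘ k ::ₘ s) - X s * lapX

/-- The symbol of `∂_i log ρ`. -/
noncomputable def score (i : Fin d) : JetRing d := X {i}

theorem del_X (i : Fin d) (s : Multiset (Fin d)) :
    del i (X s) = X (i ::ₘ s) - X s * X {i} := mkDerivation_X _ _ _

theorem delT_X (s : Multiset (Fin d)) :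
    delT (X s : JetRing d) = ∑ k : Fin d, X (k ::ₘ k ::ₘ s) - X s * lapX := mkDerivation_X _ _ _

/-- A commutator of derivations is a derivation, so generators suffice; there it vanishes because
multisets forget the order of differentiation. -/
theorem del_comm (i j : Fin d) (f : JetRing d) : del i (del j f) = del j (del i f) := by
  suffices h : ⁅del i, del j⁆ = 0 by
    have := DFunLike.congr_fun h f
    rwa [Derivation.commutator_apply, Derivation.zero_apply, sub_eq_zero] at this
  refine derivation_ext fun s => ?_
  rw [Derivation.commutator_apply, Derivation.zero_apply]
  simp only [del_X, map_sub, Derivation.leibniz, smul_eq_mul]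
  rw [Multiset.cons_swap i j s, ← Multiset.cons_zero i, ← Multiset.cons_zero j,
    Multiset.cons_swap i j 0]
  ring

theorem del_lapX (i : Fin d) :
    del i (lapX : JetRing d) = ∑ k : Fin d, X {i, k, k} - lapX * X {i} := by
  simp only [lapX, map_sum, del_X, Finset.sum_sub_distrib, Finset.sum_mul]
  rfl

theorem delT_del (i : Fin d) (f : JetRing d) : delT (del i f) = del i (delT f) := by
  suffices h : ⁅delT, del i⁆ = 0 by
    have := DFunLike.congr_fun h f
    rwa [Derivation.commutator_apply, Derivation.zero_apply, sub_eq_zero] at this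
  refine derivation_ext fun s => ?_
  rw [Derivation.commutator_apply, Derivation.zero_apply]
  simp only [del_X, delT_X, map_sub, Derivation.leibniz, smul_eq_mul, del_lapX, map_sum,
    Finset.sum_sub_distrib, ← Finset.sum_mul]
  have h1 : ∀ t : Multiset (Fin d), ∑ k : Fin d, (X (k ::ₘ k ::ₘ i ::ₘ t) : JetRing d) =
      ∑ k, X (i ::ₘ k ::ₘ k ::ₘ t) := fun t => by
    refine Finset.sum_congr rfl fun k _ => ?_
    rw [Multiset.cons_swap k i t, Multiset.cons_swap k i]
  have h2 : ∑ k : Fin d, (X (k ::ₘ k ::ₘ {i}) : JetRing d) = ∑ k, X {i, k, k} := h1 0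
  rw [h1, h2]
  ring

/-- The Hessian of `log ρ`. -/
noncomputable def hess (i j : Fin d) : JetRing d := del i (score j)

theorem hess_symm (i j : Fin d) : (hess i j : JetRing d) = hess j i := by
  simp only [hess, score, del_X]
  rw [← Multiset.cons_zero i, ← Multiset.cons_zero j, Multiset.cons_swap i j 0]
  ring

theorem del_hess (i j k : Fin d) : del i (hess j k : JetRing d) = del j (hess i k) :=
  del_comm _ _ _

theorem lapX_eq : (lapX : JetRing d) = ∑ k, (hess k k + score k * score k) := by
  simp [lapX, hess, score, del_X]

theorem delT_score (i : Fin d) : delT (score i : JetRing d) = del i lapX := by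
  rw [score, delT_X, del_lapX, mul_comm]
  congr 1
  refine Finset.sum_congr rfl fun k _ => ?_
  rw [← Multiset.cons_zero i, Multiset.cons_swap k i, Multiset.cons_swap k i]
  rfl

/-- The material derivative along the velocity `- ∇ log ρ`. -/
noncomputable def mat : Derivation ℝ (JetRing d) (JetRing d) :=
  delT - ∑ k : Fin d, (score k : JetRing d) • del k

theorem mat_apply (f : JetRing d) : mat f = delT f - ∑ k, score k * del k f := by
  rw [mat, Derivation.sub_apply]
  congr 1
  have : ∀ s : Finset (Fin d), (∑ k ∈ s, (score k : JetRing d) • del k) f =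
      ∑ k ∈ s, score k * del k f := by
    intro s
    classical
    induction s using Finset.induction_on with
    | empty => simp
    | insert a s ha ih => rw [Finset.sum_insert ha, Finset.sum_insert ha, Derivation.add_apply, ih]; rfl
  exact this _

/-- Moving ∂_i past the transport term costs the gradient of the velocity, which is minus the
Hessian of log ρ. -/
theorem mat_del (i : Fin d) (f : JetRing d) :
    mat (del i f) = del i (mat f) + ∑ k, hess i k * del k f := by
  simp only [mat_apply, map_sub, map_sum, Derivation.leibniz, smul_eq_mul, delT_del,
    Finset.sum_add_distrib]
  simp only [del_comm _ i f, hess, mul_comm (del _ f)]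
  ring

/-- Here ∂_t ∂_i log ρ = ∂_i (Δρ / ρ), and the transport term cancels half of ∂_i |∇ log ρ|². What
remains is the divergence `mdiv (nabla score)`, so a leaf already obeys the rule that `mat` attaches
a leaf with a minus sign. -/
theorem mat_score (i : Fin d) :
    mat (score i : JetRing d) = ∑ k, (del k (hess i k) + hess i k * score k) := by
  rw [mat_apply, delT_score, lapX_eq]
  simp only [map_sum, map_add, Derivation.leibniz, smul_eq_mul, ← Finset.sum_sub_distrib]
  refine Finset.sum_congr rfl fun k _ => ?_
  rw [del_hess k i k, ← hess_symm k i]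
  have : del i (score k) = (hess k i : JetRing d) := hess_symm i k
  rw [this]
  change _ - score k * hess k i = _
  ring

/-! ### Matrix calculus on symbols and the material derivative of a contraction. -/

/-- The matrix `∂_i φ^j`. -/
noncomputable def nabla (φ : Fin d → JetRing d) : Matrix (Fin d) (Fin d) (JetRing d) :=
  Matrix.of fun i j => del i (φ j)

/-- The divergence of a matrix with respect to the density. -/
noncomputable def mdiv (M : Matrix (Fin d) (Fin d) (JetRing d)) (i : Fin d) : JetRing d :=
  ∑ j, (del j (M i j) + M i j * score j)

theorem mdiv_add (M N : Matrix (Fin d) (Fin d) (JetRing d)) : mdiv (M + N) = mdiv M + mdiv N := by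
  ext1 i
  simp only [mdiv, Pi.add_apply, Matrix.add_apply, map_add, ← Finset.sum_add_distrib]
  exact Finset.sum_congr rfl fun _ _ => by ring

theorem mdiv_sum {α : Type*} (s : Finset α) (M : α → Matrix (Fin d) (Fin d) (JetRing d)) :
    mdiv (∑ a ∈ s, M a) = ∑ a ∈ s, mdiv (M a) := by
  classical
  induction s using Finset.induction_on with
  | empty => ext1 i; simp [mdiv]
  | insert a s ha ih => rw [Finset.sum_insert ha, Finset.sum_insert ha, mdiv_add, ih]

/-- The entrywise material derivative of a matrix. -/
noncomputable def matM : Matrix (Fin d) (Fin d) (JetRing d) →+ Matrix (Fin d) (Fin d) (JetRing d) :=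
  (mat : Derivation ℝ (JetRing d) (JetRing d)).toLinearMap.toAddMonoidHom.mapMatrix

theorem matM_apply (M : Matrix (Fin d) (Fin d) (JetRing d)) (i j : Fin d) :
    matM M i j = mat (M i j) := rfl

theorem matM_mul (M N : Matrix (Fin d) (Fin d) (JetRing d)) :
    matM (M * N) = matM M * N + M * matM N := by
  ext1 i j
  simp only [matM_apply, Matrix.mul_apply, Matrix.add_apply, map_sum, Derivation.leibniz,
    smul_eq_mul, ← Finset.sum_add_distrib]
  exact Finset.sum_congr rfl fun _ _ => by ring

theorem matM_nabla (φ : Fin d → JetRing d) :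
    matM (nabla φ) = nabla (fun j => mat (φ j)) + nabla score * nabla φ := by
  ext1 i j
  simp [matM_apply, nabla, Matrix.mul_apply, mat_del, hess]

/-- Two corrections arise, the commutator of `mat` with ∂_j and the derivative of the score inside
the divergence. By the product rule they add up to the divergence of `M * nabla score`. -/
theorem mat_mdiv (M : Matrix (Fin d) (Fin d) (JetRing d)) (i : Fin d) :
    mat (mdiv M i) = mdiv (matM M + M * nabla score) i := by
  rw [mdiv_add]
  simp only [mdiv, Pi.add_apply, matM_apply, map_sum, map_add, Derivation.leibniz, smul_eq_mul,
    mat_del, mat_score, Matrix.mul_apply, nabla, Matrix.of_apply, Finset.sum_add_distrib,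
    Finset.mul_sum, Finset.sum_mul, mul_add]
  change _ + ∑ j, ∑ k, hess j k * del k (M i j) +
    (∑ j, ∑ k, M i j * del k (hess j k) + ∑ j, ∑ k, M i j * (hess j k * score k) + _) =
    _ + (∑ j, ∑ k, M i k * del j (hess k j) + ∑ j, ∑ k, hess k j * del j (M i k) +
      ∑ j, ∑ k, M i k * hess k j * score j)
  rw [Finset.sum_comm (f := fun j k => M i k * del j (hess k j)),
    Finset.sum_comm (f := fun j k => hess k j * del j (M i k)),
    Finset.sum_comm (f := fun j k => M i k * hess k j * score j)]
  simp only [mul_assoc, mul_comm (score _)]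
  ring

/-- The contraction `Λ^{(n)}` with all but one index contracted, on the level of symbols. -/
noncomputable def contr {ι : Type*} [Fintype ι] (φ : ι → Fin d → JetRing d) (i : Fin d) : JetRing d :=
  (-1) ^ Fintype.card ι * mdiv (enumSum (Fintype.card ι) fun w => nabla (φ w)) i

theorem contr_comp_equiv {ι κ : Type*} {_ : Fintype ι} {_ : Fintype κ} (e : κ ≃ ι)
    (φ : ι → Fin d → JetRing d) : contr (fun k => φ (e k)) = contr φ := by
  ext1 i
  unfold contr
  rw [Fintype.card_congr e, enumSum_comp_equiv _ e (fun w => nabla (φ w))]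

/-- The empty product is the identity matrix, whose divergence with respect to ρ is ∇ log ρ. This is
the value of a leaf. -/
theorem contr_isEmpty {ι : Type*} {_ : Fintype ι} [IsEmpty ι] (φ : ι → Fin d → JetRing d) :
    contr φ = score := by
  ext1 i
  have : enumSum 0 (fun w => nabla (φ w)) = 1 := by
    unfold enumSum
    simp only [List.ofFn_zero, List.prod_nil, Finset.sum_const, Finset.card_univ, nsmul_one]
    have h : ∀ inst : Fintype (Fin 0 ≃ ι), @Fintype.card _ inst = 1 := fun inst =>
      Fintype.card_eq_one_iff.2 ⟨Equiv.equivOfIsEmpty _ _, fun _ => Subsingleton.elim _ _⟩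
    rw [h, Nat.cast_one]
  rw [contr, Fintype.card_eq_zero, this]
  simp [mdiv, Matrix.one_apply, apply_ite]

theorem enumSum_update_add {ι R : Type*} [Fintype ι] [DecidableEq ι] [Ring R] (n : ℕ) (A : ι → R) (w : ι) (a b : R) :
    enumSum n (Function.update A w (a + b)) =
      enumSum n (Function.update A w a) + enumSum n (Function.update A w b) := by
  unfold enumSum
  rw [← Finset.sum_add_distrib]
  refine Finset.sum_congr rfl fun σ _ => ?_
  have h : ∀ c : R, (fun k => Function.update A w c (σ k)) =
      Function.update (fun k => A (σ k)) (σ.symm w) c := fun c => Function.update_comp_equiv A σ w c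
  rw [h, h, h]
  simpa only [MultilinearMap.mkPiAlgebraFin_apply] using
    (MultilinearMap.mkPiAlgebraFin ℤ n R).map_update_add (fun k => A (σ k)) (σ.symm w) a b

theorem contr_update_add {ι : Type*} [Fintype ι] [DecidableEq ι] (φ : ι → Fin d → JetRing d) (w : ι)
    (a b : Fin d → JetRing d) :
    contr (Function.update φ w (a + b)) =
      contr (Function.update φ w a) + contr (Function.update φ w b) := by
  have h : ∀ c : Fin d → JetRing d, (fun w' => nabla (Function.update φ w c w')) =
      Function.update (fun w' => nabla (φ w')) w (nabla c) := by
    intro c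
    ext1 w'
    by_cases hw : w' = w
    · subst hw; simp
    · simp [hw]
  have hn : nabla (a + b) = nabla a + nabla b := by ext1 i j; simp [nabla]
  ext1 i
  simp only [contr, h, hn, enumSum_update_add, mdiv_add, Pi.add_apply, mul_add]

/-- A contraction as an additive function of one of its arguments. -/
noncomputable def contrSlot {ι : Type*} [Fintype ι] [DecidableEq ι] (φ : ι → Fin d → JetRing d) (w : ι) :
    (Fin d → JetRing d) →+ (Fin d → JetRing d) :=
  AddMonoidHom.mk' (fun a => contr (Function.update φ w a)) (contr_update_add φ w)

/-- The material derivative of a contraction. -/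
theorem mat_contr {ι : Type*} [Fintype ι] [hdec : DecidableEq ι] (φ : ι → Fin d → JetRing d) (i : Fin d) :
    mat (contr φ i) = ∑ w, contr (Function.update φ w fun j => mat (φ w j)) i -
      contr (fun o : Option ι => o.elim score φ) i := by
  obtain rfl : hdec = fun a b => Classical.propDecidable (a = b) := Subsingleton.elim _ _
  classical
  -- The factor `nabla score` comes before each differentiated factor by `matM_nabla` and after the
  -- whole product by `mat_mdiv`; together these give all insertions. The sign (-1)^(n+1) of the
  -- longer contraction accounts for the minus.
  have h := leibniz_enumSum (matM (d := d)) matM_mul (nabla score) (Fintype.card ι)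
    (fun w => nabla (φ w)) (fun w => nabla fun j => mat (φ w j)) fun w => matM_nabla _
  have h2 : ∀ w, (Function.update (fun w => nabla (φ w)) w (nabla fun j => mat (φ w j))) =
      fun w' => nabla (Function.update φ w (fun j => mat (φ w j)) w') := by
    intro w
    ext1 w'
    by_cases hw : w' = w
    · subst hw; simp
    · simp [hw]
  have h3 : (fun o : Option ι => o.elim (nabla score) fun w => nabla (φ w)) =
      fun o : Option ι => nabla (o.elim (score (d := d)) φ) := by
    ext1 o; cases o <;> rfl
  have hs : mat ((-1 : JetRing d) ^ Fintype.card ι) = 0 := by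
    rcases neg_one_pow_eq_or (JetRing d) (Fintype.card ι) with h | h <;> simp [h]
  rw [contr, Derivation.leibniz, hs, smul_zero, add_zero, smul_eq_mul, mat_mdiv, h, mdiv_add,
    mdiv_sum]
  simp only [contr, Pi.add_apply, Finset.sum_apply, Fintype.card_option, h2, h3, pow_succ,
    Finset.mul_sum, mul_add]
  ring

end JetRing

/-! ### Branches of trees -/

section Branches

open Classical in
/-- The nodes of the branch at `u` of a tree after cutting the edge `u v`. -/
noncomputable def branchSet {V : Type} [Fintype V] (G : SimpleGraph V) (u v : V) : Finset V :=
  Finset.univ.filter fun x => G.dist x u < G.dist x v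

variable {V : Type} [Fintype V] {G : SimpleGraph V}

theorem mem_branchSet {u v x : V} : x ∈ branchSet G u v ↔ G.dist x u < G.dist x v := by
  simp [branchSet]

-- A shortest path from a closer neighbour to x avoids u, so prefixing the edge gives a path from u
-- to x. Paths in a tree are unique, hence so is their second node.
omit [Fintype V] in
theorem closer_neighbor_unique (hG : G.IsTree) {x u w w' : V} (hw : G.Adj u w) (hw' : G.Adj u w')
    (h : G.dist x w < G.dist x u) (h' : G.dist x w' < G.dist x u) : w = w' := by
  classical
  have key : ∀ w, G.Adj u w → G.dist x w < G.dist x u → ∃ p : G.Walk u x, p.IsPath ∧ p.snd = w := by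
    intro w hw h
    obtain ⟨q, hq, hql⟩ := hG.connected.exists_path_of_dist w x
    refine ⟨SimpleGraph.Walk.cons hw q, ?_, by simp⟩
    rw [SimpleGraph.Walk.cons_isPath_iff]
    refine ⟨hq, fun hu => ?_⟩
    have h1 := SimpleGraph.dist_le (q.dropUntil u hu)
    have h2 := q.length_dropUntil_le_length hu
    rw [G.dist_comm (u := x) (v := u), G.dist_comm (u := x) (v := w)] at h
    omega
  obtain ⟨p, hp, rfl⟩ := key w hw h
  obtain ⟨p', hp', rfl⟩ := key w' hw' h'
  rw [(hG.existsUnique_path u x).unique hp hp']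

omit [Fintype V] in
theorem exists_closer_neighbor (hG : G.IsTree) {x u : V} (hx : x ≠ u) :
    ∃ w, G.Adj u w ∧ G.dist x w < G.dist x u := by
  obtain ⟨p, hp⟩ := hG.connected.exists_walk_length_eq_dist u x
  cases p with
  | nil => exact absurd rfl hx
  | @cons _ w _ h q =>
    refine ⟨w, h, ?_⟩
    have h1 := SimpleGraph.dist_le q
    rw [SimpleGraph.Walk.length_cons] at hp
    rw [G.dist_comm (u := x) (v := u), G.dist_comm (u := x) (v := w)]
    omega

theorem self_mem_branchSet (hG : G.IsTree) {u v : V} (huv : G.Adj u v) : u ∈ branchSet G u v := by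
  rw [mem_branchSet, SimpleGraph.dist_self]
  exact hG.connected.pos_dist_of_ne huv.ne

theorem notMem_branchSet {u v : V} : v ∉ branchSet G u v := by
  simp [mem_branchSet]

theorem notMem_branchSet_iff (hG : G.IsTree) {u v x : V} (huv : G.Adj u v) :
    x ∉ branchSet G u v ↔ x ∈ branchSet G v u := by
  have := hG.dist_ne_of_adj x huv
  simp only [mem_branchSet]
  omega

/-- The recursive decomposition of a branch into its root and the branches behind it; it drives all
inductions on trees below. -/
theorem mem_branchSet_iff (hG : G.IsTree) {u v x : V} (huv : G.Adj u v) :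
    x ∈ branchSet G u v ↔ x = u ∨ ∃ w, (G.Adj u w ∧ w ≠ v) ∧ x ∈ branchSet G w u := by
  constructor
  · intro h
    by_cases hx : x = u
    · exact Or.inl hx
    obtain ⟨w, hw, hlt⟩ := exists_closer_neighbor hG hx
    refine Or.inr ⟨w, ⟨hw, ?_⟩, mem_branchSet.2 hlt⟩
    rintro rfl
    rw [mem_branchSet] at h
    omega
  · rintro (rfl | ⟨w, ⟨hw, hwv⟩, h⟩)
    · exact self_mem_branchSet hG huv
    -- Otherwise both w and v would be neighbours of u closer to x, which forces w = v.
    · by_contra h'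
      rw [notMem_branchSet_iff hG huv] at h'
      exact hwv (closer_neighbor_unique hG hw huv (mem_branchSet.1 h) (mem_branchSet.1 h'))

/-- The number of nodes is the measure for recursion and induction along branches. -/
theorem branchSet_card_lt (hG : G.IsTree) {u v w : V} (huv : G.Adj u v) (huw : G.Adj u w)
    (hw : w ≠ v) : (branchSet G w u).card < (branchSet G u v).card :=
  Finset.card_lt_card ⟨fun _ hx => (mem_branchSet_iff hG huv).2 (Or.inr ⟨w, ⟨huw, hw⟩, hx⟩),
    fun h => notMem_branchSet (h (self_mem_branchSet hG huv))⟩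

end Branches

/-! ### The symbols of branches and of trees -/

namespace JetRing

variable {d : ℕ}

open Classical in
/-- The symbol of the vector field of a branch, computed down to depth `n`. -/
noncomputable def branchAux (d : ℕ) {V : Type} [Fintype V] (G : SimpleGraph V) :
    ℕ → V → V → Fin d → JetRing d
  -- A default value, not reached from an edge of a tree when the depth is at least the number of
  -- nodes of the branch.
  | 0, _, _ => 0
  | n + 1, u, v => contr fun w : {w : V // G.Adj u w ∧ w ≠ v} => branchAux d G n w.1 u

/-- The symbol of the vector field of the branch at `u` after cutting the edge `u v`. -/
noncomputable def branch (d : ℕ) {V : Type} [Fintype V] (G : SimpleGraph V) (u v : V) :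
    Fin d → JetRing d :=
  branchAux d G (Fintype.card V) u v

section

variable {V : Type} [Fintype V] {G : SimpleGraph V}

/-- The recursion passes to strictly smaller branches, so depth beyond the size of the branch has no
effect. Since `Fintype.card V` is always enough, `branch` satisfies its own recursion. -/
theorem branchAux_succ (hG : G.IsTree) (n : ℕ) : ∀ {u v : V}, G.Adj u v →
    (branchSet G u v).card ≤ n → branchAux d G (n + 1) u v = branchAux d G n u v := by
  induction n with
  | zero =>
    intro u v huv h
    have := Finset.card_pos.2 ⟨u, self_mem_branchSet hG huv⟩
    omega
  | succ n ih =>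
    intro u v huv h
    rw [branchAux, branchAux]
    congr 1
    ext1 w
    exact ih w.2.1.symm (by have := branchSet_card_lt hG huv w.2.1 w.2.2; omega)

theorem branch_eq (hG : G.IsTree) {u v : V} (huv : G.Adj u v)
    [hf : Fintype {w : V // G.Adj u w ∧ w ≠ v}] :
    branch d G u v = contr fun w : {w : V // G.Adj u w ∧ w ≠ v} => branch d G w.1 u := by
  rw [branch, ← branchAux_succ hG _ huv (Finset.card_le_univ _), branchAux]
  -- The identity equivalence replaces the classical `Fintype` instance of `branchAux` by the given
  -- one.
  exact contr_comp_equiv (Equiv.refl _) fun w : {w : V // G.Adj u w ∧ w ≠ v} => branch d G w.1 u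

end

/-! ### Adding a leaf to a tree, and its effect on branches. -/

theorem addLeaf_adj {m : ℕ} {T : SimpleGraph (Fin m)} {x u v : Fin m} :
    (addLeaf T x).Adj u.castSucc v.castSucc ↔ T.Adj u v := by
  have h1 := Fin.castSucc_ne_last u
  have h2 := Fin.castSucc_ne_last v
  have h3 : (T.map Fin.castSuccEmb).Adj u.castSucc v.castSucc ↔ T.Adj u v :=
    SimpleGraph.map_adj_apply (f := Fin.castSuccEmb)
  rw [addLeaf, SimpleGraph.sup_adj, h3, SimpleGraph.edge_adj]
  simp [h1, h2]

theorem addLeaf_adj_last {m : ℕ} {T : SimpleGraph (Fin m)} {x u : Fin m} :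
    (addLeaf T x).Adj u.castSucc (Fin.last m) ↔ u = x := by
  have h1 := fun u : Fin m => Fin.castSucc_ne_last u
  have h2 : ¬ (T.map Fin.castSuccEmb).Adj u.castSucc (Fin.last m) := by
    rw [SimpleGraph.map_adj]
    rintro ⟨a, b, -, -, h⟩
    exact h1 b h
  rw [addLeaf, SimpleGraph.sup_adj, SimpleGraph.edge_adj, or_iff_right h2]
  simp [h1]

end JetRing

open JetRing

theorem addLeaf_connected {m : ℕ} {T : SimpleGraph (Fin m)} (hT : T.Connected) (x : Fin m) :
    (addLeaf T x).Connected := by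
  have : ∀ u, (addLeaf T x).Reachable u x.castSucc := by
    intro u
    induction u using Fin.lastCases with
    | last => exact (addLeaf_adj_last.2 rfl).symm.reachable
    | cast u =>
      exact (hT u x).map ⟨Fin.castSucc, fun h => addLeaf_adj.2 h⟩
  exact ⟨fun u v => (this u).trans (this v).symm⟩

/-- A connected graph is a tree when it has one edge fewer than nodes; one node and one edge are
added. -/
theorem addLeaf_isTree {m : ℕ} {T : SimpleGraph (Fin m)} (hT : T.IsTree) (x : Fin m) :
    (addLeaf T x).IsTree := by
  rw [SimpleGraph.isTree_iff_connected_and_card] at hT ⊢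
  refine ⟨addLeaf_connected hT.1 x, ?_⟩
  have h : (addLeaf T x).edgeSet = insert s(x.castSucc, Fin.last m) (Sym2.map Fin.castSucc '' T.edgeSet) := by
    rw [addLeaf, SimpleGraph.edgeSet_sup, SimpleGraph.edgeSet_map, SimpleGraph.edgeSet_edge_of_ne (Fin.castSucc_ne_last x), Set.union_comm]
    rfl
  rw [h, Nat.card_coe_set_eq, Set.ncard_insert_of_notMem, Set.ncard_image_of_injective,
    ← Nat.card_coe_set_eq, hT.2]
  · simp
  · exact Sym2.map.injective (Fin.castSucc_injective m)
  · rintro ⟨e, -, he⟩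
    induction e with | _ a b =>
    have := congrArg (fun s => Fin.last m ∈ s) he
    have h1 := fun u : Fin m => (Fin.castSucc_ne_last u).symm
    simp [h1] at this

namespace JetRing

variable {d m : ℕ} {T : SimpleGraph (Fin m)}

/-- Away from the new leaf, the neighbours in `addLeaf T x` are those in `T`. -/
noncomputable def addLeafNeighborEquiv {x u : Fin m} (hux : u ≠ x) (v : Fin m) :
    {w : Fin m // T.Adj u w ∧ w ≠ v} ≃
      {w : Fin (m + 1) // (addLeaf T x).Adj u.castSucc w ∧ w ≠ v.castSucc} :=
  Equiv.ofBijective (fun w => ⟨w.1.castSucc, addLeaf_adj.2 w.2.1,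
    fun h => w.2.2 (Fin.castSucc_injective m h)⟩) <| by
    constructor
    · intro a b h
      exact Subtype.ext (Fin.castSucc_injective m (congrArg Subtype.val h))
    · rintro ⟨w, hw, hv⟩
      induction w using Fin.lastCases with
      | last => exact absurd (addLeaf_adj_last.1 hw) hux
      | cast w => exact ⟨⟨w, addLeaf_adj.1 hw, fun h => hv (by rw [h])⟩, rfl⟩

/-- At the node to which a leaf is added there is one more neighbour. -/
noncomputable def addLeafNeighborOptionEquiv (u v : Fin m) :
    Option {w : Fin m // T.Adj u w ∧ w ≠ v} ≃
      {w : Fin (m + 1) // (addLeaf T u).Adj u.castSucc w ∧ w ≠ v.castSucc} :=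
  Equiv.ofBijective (fun o => o.elim
    ⟨Fin.last m, addLeaf_adj_last.2 rfl, (Fin.castSucc_ne_last v).symm⟩
    fun w => ⟨w.1.castSucc, addLeaf_adj.2 w.2.1,
      fun h => w.2.2 (Fin.castSucc_injective m h)⟩) <| by
    constructor
    · intro a b h
      have h := congrArg Subtype.val h
      cases a <;> cases b
      · rfl
      · exact absurd h.symm (Fin.castSucc_ne_last _)
      · exact absurd h (Fin.castSucc_ne_last _)
      · exact congrArg some (Subtype.ext (Fin.castSucc_injective m h))
    · rintro ⟨w, hw, hv⟩
      induction w using Fin.lastCases with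
      | last => exact ⟨none, rfl⟩
      | cast w => exact ⟨some ⟨w, addLeaf_adj.1 hw, fun h => hv (by rw [h])⟩, rfl⟩

theorem branch_addLeaf (hT : T.IsTree) {x u v : Fin m} (huv : T.Adj u v) (hux : u ≠ x)
    [Fintype {w : Fin m // T.Adj u w ∧ w ≠ v}] :
    branch d (addLeaf T x) u.castSucc v.castSucc =
      contr fun w : {w : Fin m // T.Adj u w ∧ w ≠ v} =>
        branch d (addLeaf T x) w.1.castSucc u.castSucc := by
  classical
  rw [branch_eq (addLeaf_isTree hT x) (addLeaf_adj.2 huv)]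
  exact (contr_comp_equiv (addLeafNeighborEquiv hux v)
    fun w => branch d (addLeaf T x) w.1 u.castSucc).symm

theorem branch_addLeaf_last (hT : T.IsTree) (u : Fin m) :
    branch d (addLeaf T u) (Fin.last m) u.castSucc = score := by
  classical
  rw [branch_eq (addLeaf_isTree hT u) (addLeaf_adj_last.2 rfl).symm]
  have : IsEmpty {w // (addLeaf T u).Adj (Fin.last m) w ∧ w ≠ u.castSucc} := by
    refine ⟨fun ⟨w, hw, hwu⟩ => ?_⟩
    induction w using Fin.lastCases with
    | last => exact hw.ne rfl
    | cast w => exact hwu (by rw [addLeaf_adj_last.1 hw.symm])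
  exact contr_isEmpty _

theorem branch_addLeaf_self (hT : T.IsTree) {u v : Fin m} (huv : T.Adj u v)
    [Fintype {w : Fin m // T.Adj u w ∧ w ≠ v}] :
    branch d (addLeaf T u) u.castSucc v.castSucc =
      contr fun o : Option {w : Fin m // T.Adj u w ∧ w ≠ v} =>
        o.elim score fun w => branch d (addLeaf T u) w.1.castSucc u.castSucc := by
  classical
  rw [branch_eq (addLeaf_isTree hT u) (addLeaf_adj.2 huv)]
  rw [← contr_comp_equiv (ι := {w // (addLeaf T u).Adj u.castSucc w ∧ w ≠ v.castSucc})
    (κ := Option {w : Fin m // T.Adj u w ∧ w ≠ v}) (addLeafNeighborOptionEquiv u v)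
    fun w => branch d (addLeaf T u) w.1 u.castSucc]
  congr 1
  ext1 o
  cases o with
  | none => exact branch_addLeaf_last hT u
  | some w => rfl

/-- A branch does not change when a leaf is added outside of it. -/
theorem branch_addLeaf_of_notMem (hT : T.IsTree) {x : Fin m} : ∀ {u v : Fin m}, T.Adj u v →
    x ∉ branchSet T u v →
      branch d (addLeaf T x) u.castSucc v.castSucc = branch d T u v := by
  classical
  suffices h : ∀ n, ∀ {u v : Fin m}, T.Adj u v → (branchSet T u v).card ≤ n →
      x ∉ branchSet T u v →
        branch d (addLeaf T x) u.castSucc v.castSucc = branch d T u v from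
    fun {u v} huv => h _ huv le_rfl
  intro n
  induction n with
  | zero =>
    intro u v huv h
    have := Finset.card_pos.2 ⟨u, self_mem_branchSet hT huv⟩
    omega
  | succ n ih =>
    intro u v huv h hx
    rw [mem_branchSet_iff hT huv] at hx
    push Not at hx
    rw [branch_addLeaf hT huv (Ne.symm hx.1), branch_eq hT huv]
    congr 1
    ext1 w
    exact ih w.2.1.symm (by have := branchSet_card_lt hT huv w.2.1 w.2.2; omega) (hx.2 w.1 w.2)

/-- The material derivative of a branch adds leaves at all of its nodes. -/
theorem mat_branch (hT : T.IsTree) : ∀ {u v : Fin m}, T.Adj u v → ∀ i,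
    mat (branch d T u v i) =
      - ∑ x ∈ branchSet T u v, branch d (addLeaf T x) u.castSucc v.castSucc i := by
  classical
  suffices h : ∀ n, ∀ {u v : Fin m}, T.Adj u v → (branchSet T u v).card ≤ n → ∀ i,
      mat (branch d T u v i) =
        - ∑ x ∈ branchSet T u v, branch d (addLeaf T x) u.castSucc v.castSucc i from
    fun {u v} huv => h _ huv le_rfl
  intro n
  induction n with
  | zero =>
    intro u v huv h
    have := Finset.card_pos.2 ⟨u, self_mem_branchSet hT huv⟩
    omega
  | succ n ih =>
    intro u v huv h i
    -- The branch is the disjoint union of its root u and the smaller branches. The root will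
    -- account for the new argument in `mat_contr`, the smaller branches for the differentiated
    -- ones.
    have hunion : branchSet T u v = insert u (Finset.univ.biUnion
        fun w : {w : Fin m // T.Adj u w ∧ w ≠ v} => branchSet T w.1 u) := by
      ext x
      rw [mem_branchSet_iff hT huv]
      simp
    have hdisj : ∀ w ∈ (Finset.univ : Finset {w : Fin m // T.Adj u w ∧ w ≠ v}),
        ∀ w' ∈ (Finset.univ : Finset {w : Fin m // T.Adj u w ∧ w ≠ v}), w ≠ w' →
          Disjoint (branchSet T w.1 u) (branchSet T w'.1 u) := by
      intro w _ w' _ hww'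
      rw [Finset.disjoint_left]
      intro x hx hx'
      exact hww' (Subtype.ext (closer_neighbor_unique hT w.2.1 w'.2.1 (mem_branchSet.1 hx)
        (mem_branchSet.1 hx')))
    have hu : u ∉ Finset.univ.biUnion
        fun w : {w : Fin m // T.Adj u w ∧ w ≠ v} => branchSet T w.1 u := by
      simp [notMem_branchSet]
    rw [hunion, Finset.sum_insert hu, Finset.sum_biUnion hdisj, branch_eq hT huv, mat_contr]
    -- A leaf at u lies outside the smaller branches, so these may be read in the enlarged tree; the
    -- term with the additional `score` is then the branch with a leaf at u.
    have hleaf : (fun o : Option {w : Fin m // T.Adj u w ∧ w ≠ v} =>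
        o.elim (score (d := d)) fun w => branch d T w.1 u) =
        fun o => o.elim score fun w => branch d (addLeaf T u) w.1.castSucc u.castSucc := by
      ext1 o
      cases o with
      | none => rfl
      | some w => exact (branch_addLeaf_of_notMem hT w.2.1.symm notMem_branchSet).symm
    rw [hleaf, ← branch_addLeaf_self hT huv, neg_add, sub_eq_neg_add, ← Finset.sum_neg_distrib]
    congr 1
    refine Finset.sum_congr rfl fun w _ => ?_
    have hih : (fun j => mat (branch d T w.1 u j)) =
        - ∑ x ∈ branchSet T w.1 u, branch d (addLeaf T x) w.1.castSucc u.castSucc := by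
      ext1 j
      rw [ih w.2.1.symm (by have := branchSet_card_lt hT huv w.2.1 w.2.2; omega) j]
      simp
    rw [hih]
    -- Additivity of a contraction in the slot w pulls the sum over the new leaves out.
    change contrSlot (fun w : {w : Fin m // T.Adj u w ∧ w ≠ v} => branch d T w.1 u) w _ i = _
    rw [map_neg, map_sum, Pi.neg_apply, Finset.sum_apply]
    congr 1
    refine Finset.sum_congr rfl fun x hx => ?_
    have hux : u ≠ x := by
      rintro rfl
      exact notMem_branchSet hx
    rw [branch_addLeaf hT huv hux]
    change contr _ i = _
    congr 1
    ext1 w'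
    -- A leaf in the branch at w leaves the branches at the other neighbours unchanged, since
    -- distinct branches are disjoint.
    by_cases hw : w' = w
    · subst hw; simp
    · rw [Function.update_of_ne hw]
      refine (branch_addLeaf_of_notMem hT w'.2.1.symm fun hx' => hw ?_).symm
      exact Subtype.ext (closer_neighbor_unique hT w'.2.1 w.2.1 (mem_branchSet.1 hx')
        (mem_branchSet.1 hx))

/-- The symbol whose expectation is the pairing of the two branches at the edge `u v`. -/
noncomputable def edgeSymbol (d : ℕ) {V : Type} [Fintype V] (G : SimpleGraph V) (u v : V) :
    JetRing d :=
  ∑ i, branch d G u v i * branch d G v u i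

/-- Each node lies in exactly one of the two branches facing each other across the edge, so the
product rule adds a leaf exactly once at every node. -/
theorem mat_edgeSymbol (hT : T.IsTree) {u v : Fin m} (huv : T.Adj u v) :
    mat (edgeSymbol d T u v) = - ∑ x, edgeSymbol d (addLeaf T x) u.castSucc v.castSucc := by
  classical
  have hcompl : (branchSet T u v)ᶜ = branchSet T v u := by
    ext x
    rw [Finset.mem_compl, notMem_branchSet_iff hT huv]
  rw [← Finset.sum_add_sum_compl (branchSet T u v), hcompl]
  have h1 : ∑ x ∈ branchSet T u v, edgeSymbol d (addLeaf T x) u.castSucc v.castSucc =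
      ∑ i, (∑ x ∈ branchSet T u v, branch d (addLeaf T x) u.castSucc v.castSucc i) *
        branch d T v u i := by
    simp only [Finset.sum_mul]
    rw [Finset.sum_comm]
    refine Finset.sum_congr rfl fun x hx => Finset.sum_congr rfl fun i _ => ?_
    rw [branch_addLeaf_of_notMem hT huv.symm ((notMem_branchSet_iff hT huv.symm).2 hx)]
  have h2 : ∑ x ∈ branchSet T v u, edgeSymbol d (addLeaf T x) u.castSucc v.castSucc =
      ∑ i, branch d T u v i *
        (∑ x ∈ branchSet T v u, branch d (addLeaf T x) v.castSucc u.castSucc i) := by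
    simp only [Finset.mul_sum]
    rw [Finset.sum_comm]
    refine Finset.sum_congr rfl fun x hx => Finset.sum_congr rfl fun i _ => ?_
    rw [branch_addLeaf_of_notMem hT huv ((notMem_branchSet_iff hT huv).2 hx)]
  rw [h1, h2, ← Finset.sum_add_distrib, ← Finset.sum_neg_distrib, edgeSymbol, map_sum]
  refine Finset.sum_congr rfl fun i _ => ?_
  rw [Derivation.leibniz, mat_branch hT huv, mat_branch hT huv.symm, smul_eq_mul, smul_eq_mul]
  ring

end JetRing

/-! ### Partial derivatives and cutoff functions -/

section PartialDerivatives

variable {d : ℕ}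

/-- The partial derivative `∂_i f`. -/
noncomputable def pd (i : Fin d) (f : Euc d → ℝ) (x : Euc d) : ℝ :=
  fderiv ℝ f x (EuclideanSpace.single i 1)

theorem contDiff_pd {f : Euc d → ℝ} (hf : ContDiff ℝ ∞ f) (i : Fin d) :
    ContDiff ℝ ∞ (pd i f) :=
  (hf.fderiv_right (m := ∞) (by simp)).clm_apply contDiff_const

theorem pd_add {f g : Euc d → ℝ} {x : Euc d} (hf : DifferentiableAt ℝ f x)
    (hg : DifferentiableAt ℝ g x) (i : Fin d) :
    pd i (fun y => f y + g y) x = pd i f x + pd i g x := by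
  simp [pd, fderiv_fun_add hf hg]

theorem pd_mul {f g : Euc d → ℝ} {x : Euc d} (hf : DifferentiableAt ℝ f x)
    (hg : DifferentiableAt ℝ g x) (i : Fin d) :
    pd i (fun y => f y * g y) x = pd i f x * g x + f x * pd i g x := by
  simp [pd, fderiv_fun_mul hf hg]
  ring

theorem pd_sum {α : Type*} (s : Finset α) {f : α → Euc d → ℝ} {x : Euc d}
    (hf : ∀ a ∈ s, DifferentiableAt ℝ (f a) x) (i : Fin d) :
    pd i (fun y => ∑ a ∈ s, f a y) x = ∑ a ∈ s, pd i (f a) x := by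
  simp [pd, fderiv_fun_sum hf]

theorem pd_const (c : ℝ) (i : Fin d) (x : Euc d) : pd i (fun _ => c) x = 0 := by
  simp [pd]

theorem pd_comp {f : Euc d → ℝ} {φ : ℝ → ℝ} {x : Euc d} {φ' : ℝ} (hf : DifferentiableAt ℝ f x)
    (hφ : HasDerivAt φ φ' (f x)) (i : Fin d) :
    pd i (fun y => φ (f y)) x = φ' * pd i f x := by
  have := (hφ.comp_hasFDerivAt x hf.hasFDerivAt).fderiv
  rw [pd]
  change fderiv ℝ (φ ∘ f) x _ = _
  rw [this]
  simp [pd]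

theorem pd_smul_arg {f : Euc d → ℝ} (hf : Differentiable ℝ f) (c : ℝ) (i : Fin d) (x : Euc d) :
    pd i (fun y => f (c • y)) x = c * pd i f (c • x) := by
  have h : HasFDerivAt (fun y : Euc d => c • y) (c • ContinuousLinearMap.id ℝ (Euc d)) x :=
    (hasFDerivAt_id x).const_smul c
  have := ((hf (c • x)).hasFDerivAt.comp x h).fderiv
  rw [pd]
  change fderiv ℝ (f ∘ fun y => c • y) x _ = _
  rw [this]
  simp [pd]

theorem hasCompactSupport_pd {f : Euc d → ℝ} (hf : HasCompactSupport f) (i : Fin d) :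
    HasCompactSupport (pd i f) :=
  hf.fderiv_apply (𝕜 := ℝ) _

theorem exists_bound_of_hasCompactSupport {f : Euc d → ℝ} (hf : Continuous f)
    (hc : HasCompactSupport f) : ∃ C, ∀ x, |f x| ≤ C :=
  hf.bounded_above_of_compact_support hc

/-- A sequence of smooth cutoff functions. -/
theorem exists_cutoff (d : ℕ) : ∃ (χ : ℕ → Euc d → ℝ) (C : ℝ), 0 ≤ C ∧
    (∀ n, ContDiff ℝ ∞ (χ n)) ∧ (∀ n, HasCompactSupport (χ n)) ∧ (∀ n x, |χ n x| ≤ 1) ∧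
    (∀ x, ∀ᶠ n in Filter.atTop, χ n x = 1) ∧
    (∀ n i x, |pd i (χ n) x| ≤ C / (n + 1)) ∧
    (∀ n i x, |pd i (pd i (χ n)) x| ≤ C / (n + 1)) := by
  -- The cutoffs are x ↦ f(x / (n + 1)), so each derivative gains a factor 1 / (n + 1). Summing the
  -- bounds over all directions makes the constant independent of i.
  let f : ContDiffBump (0 : Euc d) := ⟨1, 2, one_pos, one_lt_two⟩
  have hfs : ContDiff ℝ ∞ f := f.contDiff
  have hfc : HasCompactSupport f := f.hasCompactSupport
  choose C1 hC1 using fun i => exists_bound_of_hasCompactSupport (contDiff_pd hfs i).continuous (hasCompactSupport_pd hfc i)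
  choose C2 hC2 using fun i =>
    exists_bound_of_hasCompactSupport (contDiff_pd (contDiff_pd hfs i) i).continuous (hasCompactSupport_pd (hasCompactSupport_pd hfc i) i)
  have h1 : ∀ i, 0 ≤ C1 i := fun i => (abs_nonneg _).trans (hC1 i 0)
  have h2 : ∀ i, 0 ≤ C2 i := fun i => (abs_nonneg _).trans (hC2 i 0)
  have hC : ∀ i, C1 i + C2 i ≤ ∑ i, (C1 i + C2 i) := fun i =>
    Finset.single_le_sum (f := fun i => C1 i + C2 i) (fun i _ => add_nonneg (h1 i) (h2 i))
      (Finset.mem_univ i)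
  have hpos : ∀ n : ℕ, (0 : ℝ) < ((n : ℝ) + 1)⁻¹ := fun n => by positivity
  have hle : ∀ n : ℕ, ((n : ℝ) + 1)⁻¹ ≤ 1 := fun n => inv_le_one_of_one_le₀ (by
    have : (0 : ℝ) ≤ n := n.cast_nonneg
    linarith)
  have hpd : ∀ (n : ℕ) i, pd i (fun x => f (((n : ℝ) + 1)⁻¹ • x)) =
      fun x => ((n : ℝ) + 1)⁻¹ * pd i f (((n : ℝ) + 1)⁻¹ • x) := fun n i =>
    funext fun x => pd_smul_arg (hfs.differentiable (by simp)) _ i x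
  refine ⟨fun n x => f (((n : ℝ) + 1)⁻¹ • x), ∑ i, (C1 i + C2 i),
    Finset.sum_nonneg fun i _ => add_nonneg (h1 i) (h2 i), fun n => ?_, fun n => ?_, fun n x => ?_,
    fun x => ?_, fun n i x => ?_, fun n i x => ?_⟩
  · exact hfs.comp (contDiff_const_smul _)
  · exact hfc.comp_smul (hpos n).ne'
  · rw [abs_of_nonneg f.nonneg]
    exact f.le_one
  · obtain ⟨N, hN⟩ := exists_nat_ge ‖x‖
    filter_upwards [Filter.eventually_ge_atTop N] with n hn
    refine f.one_of_mem_closedBall ?_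
    rw [mem_closedBall_zero_iff, norm_smul, Real.norm_of_nonneg (hpos n).le]
    change _ ≤ (1 : ℝ)
    rw [inv_mul_le_iff₀ (by positivity)]
    have : (N : ℝ) ≤ n := by exact_mod_cast hn
    linarith
  · rw [hpd, abs_mul, abs_of_pos (hpos n), div_eq_inv_mul]
    exact mul_le_mul_of_nonneg_left (((hC1 i _).trans (by linarith [h2 i])).trans (hC i)) (hpos n).le
  · have : pd i (fun x => ((n : ℝ) + 1)⁻¹ * pd i f (((n : ℝ) + 1)⁻¹ • x)) x =
        ((n : ℝ) + 1)⁻¹ * (((n : ℝ) + 1)⁻¹ * pd i (pd i f) (((n : ℝ) + 1)⁻¹ • x)) := by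
      have hd : Differentiable ℝ (pd i f) := (contDiff_pd hfs i).differentiable (by simp)
      have hd' : DifferentiableAt ℝ (fun x => pd i f (((n : ℝ) + 1)⁻¹ • x)) x :=
        (hd _).comp x (by fun_prop)
      rw [pd_mul (by fun_prop) hd', pd_const, pd_smul_arg hd]
      ring
    rw [hpd, this, abs_mul, abs_mul, abs_of_pos (hpos n), div_eq_inv_mul]
    refine mul_le_mul_of_nonneg_left ?_ (hpos n).le
    refine (mul_le_of_le_one_left (abs_nonneg _) (hle n)).trans ?_
    exact ((hC2 i _).trans (by linarith [h1 i])).trans (hC i)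

theorem integrable_of_hasCompactSupport_mul {f g : Euc d → ℝ} (hf : Continuous f)
    (hc : HasCompactSupport f) (hg : Continuous g) : Integrable (fun x => f x * g x) :=
  (hf.mul hg).integrable_of_hasCompactSupport hc.mul_right

/-- The integral of an integrable divergence of an integrable vector field vanishes. -/
theorem integral_divergence_eq_zero {W : Fin d → Euc d → ℝ} (hW : ∀ i, ContDiff ℝ 1 (W i))
    (hint : ∀ i, Integrable (W i)) (hdiv : Integrable fun x => ∑ i, pd i (W i) x) :
    ∫ x, ∑ i, pd i (W i) x = 0 := by
  obtain ⟨χ, C, hC0, hχs, hχc, hχ1, hχe, hχd, -⟩ := exists_cutoff d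
  have hpdc : ∀ i, Continuous (pd i (W i)) := fun i =>
    ((hW i).continuous_fderiv (by simp)).clm_apply continuous_const
  have h1 : Filter.Tendsto (fun n => ∫ x, χ n x * ∑ i, pd i (W i) x) Filter.atTop
      (nhds (∫ x, ∑ i, pd i (W i) x)) := by
    refine tendsto_integral_of_dominated_convergence (fun x => |∑ i, pd i (W i) x|)
      (fun n => ?_) hdiv.abs (fun n => Filter.Eventually.of_forall fun x => ?_)
      (Filter.Eventually.of_forall fun x => ?_)
    · exact ((hχs n).continuous.mul (continuous_finsetSum _ fun i _ => hpdc i)).aestronglyMeasurable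
    · rw [Real.norm_eq_abs, abs_mul]
      exact mul_le_of_le_one_left (abs_nonneg _) (hχ1 n x)
    · refine tendsto_const_nhds.congr' ?_
      filter_upwards [hχe x] with n hn
      rw [hn, one_mul]
  have h2 : ∀ n, ∫ x, χ n x * ∑ i, pd i (W i) x = - ∑ i, ∫ x, pd i (χ n) x * W i x := by
    intro n
    simp only [Finset.mul_sum]
    rw [integral_finsetSum _ fun i _ => integrable_of_hasCompactSupport_mul (hχs n).continuous
      (hχc n) (hpdc i), ← Finset.sum_neg_distrib]
    refine Finset.sum_congr rfl fun i _ => ?_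
    exact integral_mul_fderiv_eq_neg_fderiv_mul_of_integrable
      (integrable_of_hasCompactSupport_mul (contDiff_pd (hχs n) i).continuous (hasCompactSupport_pd (hχc n) i)
        (hW i).continuous)
      (integrable_of_hasCompactSupport_mul (hχs n).continuous (hχc n) (hpdc i))
      (integrable_of_hasCompactSupport_mul (hχs n).continuous (hχc n) (hW i).continuous)
      (fun x _ => (hχs n).differentiable (by simp) x) fun x _ => (hW i).differentiable (by simp) x
  -- By `h2` the derivative falls on the cutoff, where it is at most C / (n + 1), and each `W i` is
  -- integrable. With `h1` the same integrals have two limits.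
  have h3 : Filter.Tendsto (fun n => ∫ x, χ n x * ∑ i, pd i (W i) x) Filter.atTop (nhds 0) := by
    have h4 : Filter.Tendsto (fun n : ℕ => C / ((n : ℝ) + 1) * ∑ i, ∫ x, |W i x|) Filter.atTop
        (nhds 0) := by
      have := (tendsto_const_div_atTop_nhds_zero_nat C).comp (Filter.tendsto_add_atTop_nat 1)
      have := this.mul_const (∑ i, ∫ x, |W i x|)
      simpa using this
    refine squeeze_zero_norm (fun n => ?_) h4
    rw [h2, norm_neg, Finset.mul_sum]
    refine (norm_sum_le _ _).trans (Finset.sum_le_sum fun i _ => ?_)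
    refine (norm_integral_le_integral_norm _).trans ?_
    rw [← integral_const_mul]
    refine integral_mono_of_nonneg (Filter.Eventually.of_forall fun x => norm_nonneg _)
      ((hint i).abs.const_mul _) (Filter.Eventually.of_forall fun x => ?_)
    change |pd i (χ n) x * W i x| ≤ C / ((n : ℝ) + 1) * |W i x|
    rw [abs_mul]
    exact mul_le_mul_of_nonneg_right (hχd n i x) (abs_nonneg _)
  exact tendsto_nhds_unique h1 h3

end PartialDerivatives

/-! ### Smooth positive densities -/

section Density

variable {d : ℕ}

/-- `μ` has the smooth positive density `ρ`. -/
structure HasSmoothDensity (μ : Measure (Euc d)) (ρ : Euc d → ℝ) : Prop where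
  smooth : ContDiff ℝ ∞ ρ
  pos : ∀ x, 0 < ρ x
  eq : μ = volume.withDensity fun x => ENNReal.ofReal (ρ x)

variable {μ : Measure (Euc d)} {ρ : Euc d → ℝ}

theorem HasSmoothDensity.integrable_iff (h : HasSmoothDensity μ ρ) {f : Euc d → ℝ} :
    Integrable f μ ↔ Integrable fun x => ρ x * f x := by
  rw [h.eq]
  have := integrable_withDensity_iff_integrable_smul' (μ := volume) (f := fun x => ENNReal.ofReal (ρ x))
    (g := f) h.smooth.continuous.measurable.ennreal_ofReal (by simp)
  simpa [ENNReal.toReal_ofReal (h.pos _).le] using this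

theorem HasSmoothDensity.integral_eq (h : HasSmoothDensity μ ρ) (f : Euc d → ℝ) :
    ∫ x, f x ∂μ = ∫ x, ρ x * f x := by
  rw [h.eq, integral_withDensity_eq_integral_toReal_smul
    h.smooth.continuous.measurable.ennreal_ofReal (by simp)]
  simp [ENNReal.toReal_ofReal (h.pos _).le]

theorem HasSmoothDensity.absolutelyContinuous (h : HasSmoothDensity μ ρ) : volume ≪ μ := by
  rw [h.eq]
  refine withDensity_absolutelyContinuous' h.smooth.continuous.measurable.ennreal_ofReal.aemeasurable ?_
  exact Filter.Eventually.of_forall fun x => by simp [h.pos x]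

/-- Integration by parts with respect to a smooth density. -/
theorem HasSmoothDensity.integral_divergence_eq_zero (h : HasSmoothDensity μ ρ)
    {L : Fin d → Euc d → ℝ} (hL : ∀ i x, pd i ρ x = L i x * ρ x)
    {V : Fin d → Euc d → ℝ} (hV : ∀ i, ContDiff ℝ 1 (V i)) (hint : ∀ i, Integrable (V i) μ)
    (hdiv : Integrable (fun x => ∑ i, (pd i (V i) x + V i x * L i x)) μ) :
    ∫ x, ∑ i, (pd i (V i) x + V i x * L i x) ∂μ = 0 := by
  have hρ1 : ContDiff ℝ 1 ρ := h.smooth.of_le (by simp)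
  -- Times ρ, the integrand is the Lebesgue divergence of ρV.
  have key : ∀ x, ρ x * ∑ i, (pd i (V i) x + V i x * L i x) =
      ∑ i, pd i (fun y => ρ y * V i y) x := by
    intro x
    rw [Finset.mul_sum]
    refine Finset.sum_congr rfl fun i _ => ?_
    rw [pd_mul (hρ1.differentiable (by simp) x) ((hV i).differentiable (by simp) x), hL]
    ring
  rw [h.integral_eq]
  rw [h.integrable_iff] at hdiv
  simp only [key] at hdiv ⊢
  exact EntropyFlow.integral_divergence_eq_zero (fun i => hρ1.mul (hV i))
    (fun i => h.integrable_iff.1 (hint i)) hdiv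

end Density

/-! ### Moments, uniformly over a family of measures -/

section Moments

variable {d : ℕ} {τ : Type*} {S : Set τ} {μ : τ → Measure (Euc d)}

/-- The functions `f t` are continuous with moments of all orders, bounded for `t ∈ S`. -/
def UniformMoments (S : Set τ) (μ : τ → Measure (Euc d)) (f : τ → Euc d → ℝ) : Prop :=
  (∀ t ∈ S, Continuous (f t)) ∧
    ∀ p : ℕ, ∃ C, ∀ t ∈ S, Integrable (fun x => |f t x| ^ p) (μ t) ∧ ∫ x, |f t x| ^ p ∂μ t ≤ C

theorem uniformMoments_const (hμ : ∀ t ∈ S, IsProbabilityMeasure (μ t)) (c : ℝ) :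
    UniformMoments S μ fun _ _ => c :=
  ⟨fun _ _ => continuous_const, fun p => ⟨|c| ^ p, fun t ht => by
    have := hμ t ht
    simp⟩⟩

theorem exists_bound_of_le {F : τ → Euc d → ℝ} {G H : τ → Euc d → ℝ} {c : ℝ}
    (hF : ∀ t ∈ S, Continuous (F t)) (hF0 : ∀ t x, 0 ≤ F t x)
    (hle : ∀ t x, F t x ≤ c * (G t x + H t x)) (hc : 0 ≤ c)
    (hG : ∃ C, ∀ t ∈ S, Integrable (G t) (μ t) ∧ ∫ x, G t x ∂μ t ≤ C)
    (hH : ∃ C, ∀ t ∈ S, Integrable (H t) (μ t) ∧ ∫ x, H t x ∂μ t ≤ C) :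
    ∃ C, ∀ t ∈ S, Integrable (F t) (μ t) ∧ ∫ x, F t x ∂μ t ≤ C := by
  obtain ⟨C1, h1⟩ := hG
  obtain ⟨C2, h2⟩ := hH
  refine ⟨c * (C1 + C2), fun t ht => ?_⟩
  have hint : Integrable (fun x => c * (G t x + H t x)) (μ t) :=
    ((h1 t ht).1.add (h2 t ht).1).const_mul c
  refine ⟨hint.mono' (hF t ht).aestronglyMeasurable (Filter.Eventually.of_forall fun x => ?_), ?_⟩
  · rw [Real.norm_of_nonneg (hF0 t x)]
    exact hle t x
  · refine (integral_mono_of_nonneg (Filter.Eventually.of_forall (hF0 t)) hint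
      (Filter.Eventually.of_forall (hle t))).trans ?_
    rw [integral_const_mul, integral_add (h1 t ht).1 (h2 t ht).1]
    exact mul_le_mul_of_nonneg_left (add_le_add (h1 t ht).2 (h2 t ht).2) hc

theorem UniformMoments.add {f g : τ → Euc d → ℝ} (hf : UniformMoments S μ f)
    (hg : UniformMoments S μ g) : UniformMoments S μ fun t x => f t x + g t x := by
  refine ⟨fun t ht => (hf.1 t ht).add (hg.1 t ht), fun p => ?_⟩
  refine exists_bound_of_le (c := 2 ^ (p - 1)) (fun t ht => (((hf.1 t ht).add (hg.1 t ht)).abs.pow p))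
    (fun t x => by positivity) (fun t x => ?_) (by positivity) (hf.2 p) (hg.2 p)
  exact (pow_le_pow_left₀ (abs_nonneg _) (abs_add_le _ _) p).trans
    (add_pow_le (abs_nonneg _) (abs_nonneg _) p)

theorem UniformMoments.mul {f g : τ → Euc d → ℝ} (hf : UniformMoments S μ f)
    (hg : UniformMoments S μ g) : UniformMoments S μ fun t x => f t x * g t x := by
  refine ⟨fun t ht => (hf.1 t ht).mul (hg.1 t ht), fun p => ?_⟩
  refine exists_bound_of_le (c := 1) (fun t ht => (((hf.1 t ht).mul (hg.1 t ht)).abs.pow p))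
    (fun t x => by positivity) (fun t x => ?_) (by positivity) (hf.2 (2 * p)) (hg.2 (2 * p))
  rw [abs_mul, mul_pow, pow_mul', pow_mul', one_mul]
  -- The inequality |f|^p |g|^p ≤ |f|^(2p) + |g|^(2p): asking for all moments at once makes the
  -- class closed under products.
  nlinarith [sq_nonneg (|f t x| ^ p - |g t x| ^ p), sq_nonneg (|f t x| ^ p),
    sq_nonneg (|g t x| ^ p)]

end Moments

/-! ### Evaluation of jets -/

section Jets

open MvPolynomial

variable {d : ℕ}

/-- Evaluation of a symbol at the normalized derivatives `r`. -/
noncomputable def ev (r : Multiset (Fin d) → Euc d → ℝ) (f : JetRing d) (x : Euc d) : ℝ :=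
  aeval (fun s => r s x) f

/-- Evaluation at a point as a ring homomorphism. -/
noncomputable def evHom (r : Multiset (Fin d) → Euc d → ℝ) (x : Euc d) : JetRing d →+* ℝ :=
  (aeval fun s => r s x : JetRing d →ₐ[ℝ] ℝ)

theorem evHom_apply (r : Multiset (Fin d) → Euc d → ℝ) (x : Euc d) (f : JetRing d) :
    evHom r x f = ev r f x := rfl

section

variable {r : Multiset (Fin d) → Euc d → ℝ}

theorem ev_add (f g : JetRing d) (x : Euc d) : ev r (f + g) x = ev r f x + ev r g x :=
  map_add (evHom r x) f g

theorem ev_mul (f g : JetRing d) (x : Euc d) : ev r (f * g) x = ev r f x * ev r g x :=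
  map_mul (evHom r x) f g

theorem ev_sub (f g : JetRing d) (x : Euc d) : ev r (f - g) x = ev r f x - ev r g x :=
  map_sub (evHom r x) f g

theorem ev_neg (f : JetRing d) (x : Euc d) : ev r (-f) x = - ev r f x :=
  map_neg (evHom r x) f

theorem ev_sum {α : Type*} (s : Finset α) (f : α → JetRing d) (x : Euc d) :
    ev r (∑ a ∈ s, f a) x = ∑ a ∈ s, ev r (f a) x :=
  map_sum (evHom r x) f s

theorem ev_X (s : Multiset (Fin d)) (x : Euc d) : ev r (X s) x = r s x := by
  simp [ev]

theorem ev_C (c : ℝ) (x : Euc d) : ev r (C c) x = c := by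
  simp [ev]

theorem ev_C_eq (c : ℝ) : ev r (C c) = fun _ => c := by
  ext x; simp [ev]

theorem ev_mul_X_eq (f : JetRing d) (s : Multiset (Fin d)) :
    ev r (f * X s) = fun x => ev r f x * r s x := by
  ext x; rw [ev_mul, ev_X]

theorem ev_add_eq (f g : JetRing d) : ev r (f + g) = fun x => ev r f x + ev r g x := by
  ext x; rw [ev_add]

theorem contDiff_ev (hr : ∀ s, ContDiff ℝ ∞ (r s)) (f : JetRing d) : ContDiff ℝ ∞ (ev r f) := by
  induction f using MvPolynomial.induction_on with
  | C c =>
    rw [ev_C_eq]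
    exact contDiff_const
  | add f g hf hg =>
    rw [ev_add_eq]
    exact hf.add hg
  | mul_X f s hf =>
    rw [ev_mul_X_eq]
    exact hf.mul (hr s)

theorem pd_ev (hr : ∀ s, ContDiff ℝ ∞ (r s))
    (hpd : ∀ i s x, pd i (r s) x = r (i ::ₘ s) x - r s x * r {i} x) (i : Fin d) (f : JetRing d)
    (x : Euc d) : pd i (ev r f) x = ev r (del i f) x := by
  have hd : ∀ f, DifferentiableAt ℝ (ev r f) x := fun f =>
    (contDiff_ev hr f).differentiable (by simp) x
  induction f using MvPolynomial.induction_on with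
  | C c =>
    have h2 : del i (C c : JetRing d) = 0 := by
      rw [← MvPolynomial.algebraMap_eq, Derivation.map_algebraMap]
    rw [ev_C_eq, pd_const, h2]
    simp [ev]
  | add f g hf hg =>
    rw [ev_add_eq, pd_add (hd f) (hd g), hf, hg, map_add, ev_add]
  | mul_X f s hf =>
    rw [ev_mul_X_eq, pd_mul (hd f) ((hr s).differentiable (by simp) x), hf, hpd, Derivation.leibniz, del_X]
    simp only [ev_add, ev_mul, ev_sub, ev_X, smul_eq_mul]
    ring

end

theorem uniformMoments_ev {τ : Type*} {S : Set τ} {μ : τ → Measure (Euc d)}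
    {r : τ → Multiset (Fin d) → Euc d → ℝ} (hμ : ∀ t ∈ S, IsProbabilityMeasure (μ t))
    (hr : ∀ s, UniformMoments S μ fun t => r t s) (f : JetRing d) :
    UniformMoments S μ fun t => ev (r t) f := by
  induction f using MvPolynomial.induction_on with
  | C c =>
    have : (fun t => ev (r t) (C c)) = fun _ _ => c := by ext t x; exact ev_C c x
    rw [this]
    exact uniformMoments_const hμ c
  | add f g hf hg =>
    have : (fun t => ev (r t) (f + g)) = fun t x => ev (r t) f x + ev (r t) g x := by
      ext t x; exact ev_add f g x
    rw [this]
    exact hf.add hg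
  | mul_X f s hf =>
    have : (fun t => ev (r t) (f * X s)) = fun t x => ev (r t) f x * r t s x := by
      ext t x; rw [ev_mul, ev_X]
    rw [this]
    exact hf.mul (hr s)

/-- `r` consists of the normalized derivatives of a smooth positive density of `μ`, which have
moments of all orders. -/
structure IsJet (μ : Measure (Euc d)) (r : Multiset (Fin d) → Euc d → ℝ) : Prop where
  exists_density : ∃ ρ, HasSmoothDensity μ ρ ∧ ∀ i x, pd i ρ x = r {i} x * ρ x
  smooth : ∀ s, ContDiff ℝ ∞ (r s)
  pd_eq : ∀ i s x, pd i (r s) x = r (i ::ₘ s) x - r s x * r {i} x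
  moments : ∀ s (p : ℕ), Integrable (fun x => |r s x| ^ p) μ

/-- The vector field with a given symbol. -/
noncomputable def evField (r : Multiset (Fin d) → Euc d → ℝ) (φ : Fin d → JetRing d) (x : Euc d) :
    Euc d :=
  WithLp.toLp 2 fun i => ev r (φ i) x

variable {μ : Measure (Euc d)} {r : Multiset (Fin d) → Euc d → ℝ}

theorem IsJet.integrable_ev_pow [IsProbabilityMeasure μ] (h : IsJet μ r) (f : JetRing d) (p : ℕ) :
    Integrable (fun x => |ev r f x| ^ p) μ := by
  have := uniformMoments_ev (S := Set.univ) (τ := Unit) (μ := fun _ => μ) (r := fun _ => r)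
    (fun _ _ => inferInstance) (fun s => ⟨fun _ _ => (h.smooth s).continuous, fun p =>
      ⟨∫ x, |r s x| ^ p ∂μ, fun _ _ => ⟨h.moments s p, le_rfl⟩⟩⟩) f
  obtain ⟨C, hC⟩ := this.2 p
  exact (hC () trivial).1

theorem IsJet.integrable_ev [IsProbabilityMeasure μ] (h : IsJet μ r) (f : JetRing d) :
    Integrable (ev r f) μ := by
  have := h.integrable_ev_pow f 1
  simp only [pow_one] at this
  exact (integrable_norm_iff (contDiff_ev h.smooth f).continuous.aestronglyMeasurable).1 this

theorem IsJet.memLp_ev [IsProbabilityMeasure μ] (h : IsJet μ r) (f : JetRing d) :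
    MemLp (ev r f) 2 μ := by
  rw [memLp_two_iff_integrable_sq (contDiff_ev h.smooth f).continuous.aestronglyMeasurable]
  simpa using h.integrable_ev_pow f 2

theorem IsJet.isL2Field [IsProbabilityMeasure μ] (h : IsJet μ r) (φ : Fin d → JetRing d) :
    IsL2Field μ (evField r φ) :=
  ⟨contDiff_euclidean.2 fun i => contDiff_ev h.smooth (φ i),
    MemLp.of_eval_piLp fun i => h.memLp_ev (φ i)⟩

/-! ### Contractions -/

theorem nablaMatrix_apply {g : Euc d → Euc d} {x : Euc d} (hg : DifferentiableAt ℝ g x)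
    (i j : Fin d) : nablaMatrix g x i j = pd i (fun y => g y j) x := by
  have := ((EuclideanSpace.proj j : Euc d →L[ℝ] ℝ).hasFDerivAt.comp x hg.hasFDerivAt).fderiv
  rw [pd]
  change _ = fderiv ℝ ((EuclideanSpace.proj j : Euc d →L[ℝ] ℝ) ∘ g) x _
  rw [this]
  rfl

theorem nablaMatrix_evField (h : IsJet μ r) (φ : Fin d → JetRing d) (x : Euc d) :
    nablaMatrix (evField r φ) x = (evHom r x).mapMatrix (nabla φ) := by
  have hd : DifferentiableAt ℝ (evField r φ) x :=
    (contDiff_euclidean.2 fun i => contDiff_ev h.smooth (φ i) : ContDiff ℝ ∞ _).differentiable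
      (by simp) x
  ext1 i j
  rw [nablaMatrix_apply hd]
  exact pd_ev h.smooth h.pd_eq i (φ j) x

theorem map_enumSum {ι : Type*} [Fintype ι] {R S : Type*} [Ring R] [Ring S] (f : R →+* S) (n : ℕ)
    (A : ι → R) : f (enumSum n A) = enumSum n fun w => f (A w) := by
  simp only [enumSum, map_sum, map_list_prod, List.map_ofFn]
  rfl

theorem Lam_eq {ι : Type*} [Fintype ι] (g : ι → Euc d → Euc d) (x : Euc d) :
    Lam g x = (-1) ^ Fintype.card ι * (1 / (Fintype.card ι : ℝ)) *
      (enumSum (Fintype.card ι) fun w => nablaMatrix (g w) x).trace := by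
  rw [Lam, enumSum, Matrix.trace_sum]

theorem Lam_comp_equiv {ι κ : Type*} {_ : Fintype ι} {_ : Fintype κ} (e : κ ≃ ι)
    (g : ι → Euc d → Euc d) (x : Euc d) : Lam (fun k => g (e k)) x = Lam g x := by
  rw [Lam_eq, Lam_eq, Fintype.card_congr e, enumSum_comp_equiv _ e fun w => nablaMatrix (g w) x]

/-- By cyclicity of the trace, ξ may be moved to the end from every position; the equal
contributions of the positions cancel the factor 1/(n + 1) in the (n + 1)-ary operator. -/
theorem Lam_option {ι : Type*} [Fintype ι] (ξ : Euc d → Euc d) (Φ : ι → Euc d → Euc d)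
    (x : Euc d) :
    Lam (fun o : Option ι => o.elim ξ Φ) x = (-1) ^ (Fintype.card ι + 1) *
      ((enumSum (Fintype.card ι) fun w => nablaMatrix (Φ w) x) * nablaMatrix ξ x).trace := by
  have h : (fun o : Option ι => nablaMatrix (o.elim ξ Φ) x) =
      fun o => o.elim (nablaMatrix ξ x) fun w => nablaMatrix (Φ w) x := by
    ext1 o; cases o <;> rfl
  rw [Lam_eq, Fintype.card_option, h, trace_enumSum_option]
  have : ((Fintype.card ι : ℝ) + 1) ≠ 0 := by positivity
  push_cast
  field_simp

theorem inner_eq_sum (x y : Euc d) : inner ℝ x y = ∑ i, x i * y i := by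
  rw [PiLp.inner_apply]
  simp [mul_comm]

theorem integrable_inner {f g : Euc d → Euc d} (hf : MemLp f 2 μ) (hg : MemLp g 2 μ) :
    Integrable (fun x => inner ℝ (f x) (g x)) μ := by
  simp only [inner_eq_sum]
  exact integrable_finsetSum _ fun i _ => (hf.eval_piLp i).integrable_mul (hg.eval_piLp i)

/-- The symbolic contraction computes the contraction. -/
theorem IsJet.isContraction [IsProbabilityMeasure μ] (h : IsJet μ r) {ι : Type*} [Fintype ι]
    (φ : ι → Fin d → JetRing d) :
    IsContraction μ (fun w => evField r (φ w)) (evField r (contr φ)) := by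
  refine ⟨h.isL2Field _, fun ξ hξ hint => ?_⟩
  obtain ⟨ρ, hρ, hL⟩ := h.exists_density
  set n := Fintype.card ι with hn
  set M := enumSum n fun w => nabla (φ w) with hM
  have hξd : ∀ i, ContDiff ℝ ∞ fun x => ξ x i := contDiff_euclidean.1 hξ.1
  have hinner := integrable_inner hξ.2 (h.isL2Field (contr φ)).2
  -- The divergence with respect to μ of the field with components Σ_i ξ^i M_ij. The part where ∂_j
  -- hits ξ is the trace of M ∇ξ, hence Λ up to sign; the rest pairs ξ with the divergence of M. Its
  -- integral vanishes, which is the claimed identity.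
  have hsum : ∀ x, ∑ j, (pd j (fun y => ∑ i, ξ y i * ev r (M i j) y) x +
      (∑ i, ξ x i * ev r (M i j) x) * r {j} x) =
      (-1) ^ (n + 1) * Lam (fun o : Option ι => o.elim ξ fun w => evField r (φ w)) x +
        (-1) ^ n * inner ℝ (ξ x) (evField r (contr φ) x) := by
    intro x
    have h1 : ∀ j, pd j (fun y => ∑ i, ξ y i * ev r (M i j) y) x =
        ∑ i, (pd j (fun y => ξ y i) x * ev r (M i j) x + ξ x i * ev r (del j (M i j)) x) := by
      intro j
      have hd1 : ∀ i, DifferentiableAt ℝ (fun y => ξ y i) x := fun i =>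
        (hξd i).differentiable (by simp) x
      have hd2 : ∀ f, DifferentiableAt ℝ (ev r f) x := fun f =>
        (contDiff_ev h.smooth f).differentiable (by simp) x
      rw [pd_sum Finset.univ (f := fun i y => ξ y i * ev r (M i j) y)
        fun i _ => (hd1 i).mul (hd2 _)]
      refine Finset.sum_congr rfl fun i _ => ?_
      rw [pd_mul (hd1 i) (hd2 _), pd_ev h.smooth h.pd_eq]
    have h2 : (enumSum n fun w => nablaMatrix (evField r (φ w)) x) = (evHom r x).mapMatrix M := by
      simp only [nablaMatrix_evField h, hM, map_enumSum]
    have hsq : ((-1 : ℝ) ^ n) * (-1) ^ n = 1 := by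
      rw [← mul_pow]; simp
    have hξx : DifferentiableAt ℝ ξ x := hξ.1.differentiable (by simp) x
    rw [Lam_option, ← hn, h2, ← mul_assoc, ← pow_add, ← two_mul, pow_mul, neg_one_sq, one_pow, one_mul,
      inner_eq_sum, Finset.mul_sum]
    have h3 : ∀ i, (-1 : ℝ) ^ n * (ξ x i * evField r (contr φ) x i) =
        ξ x i * ∑ j, (ev r (del j (M i j)) x + ev r (M i j) x * r {j} x) := by
      intro i
      have : evField r (contr φ) x i =
          (-1) ^ n * ∑ j, (ev r (del j (M i j)) x + ev r (M i j) x * r {j} x) := by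
        change ev r (contr φ i) x = _
        rw [contr, ← hn, ← hM, mdiv, ← evHom_apply]
        simp only [map_mul, map_pow, map_neg, map_one, map_sum, map_add]
        simp only [evHom_apply, score, ev_X]
      rw [this]
      linear_combination (ξ x i * ∑ j, (ev r (del j (M i j)) x + ev r (M i j) x * r {j} x)) * hsq
    simp only [h1, h3, Matrix.trace, Matrix.diag, Matrix.mul_apply, nablaMatrix_apply hξx,
      RingHom.mapMatrix_apply, Matrix.map_apply, evHom_apply, Finset.sum_mul, Finset.mul_sum,
      Finset.sum_add_distrib, mul_add]
    rw [Finset.sum_comm (f := fun j i => pd j (fun y => ξ y i) x * ev r (M i j) x),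
      Finset.sum_comm (f := fun j i => ξ x i * ev r (del j (M i j)) x),
      Finset.sum_comm (f := fun j i => ξ x i * ev r (M i j) x * r {j} x)]
    simp only [mul_comm (pd _ _ _), mul_assoc]
    ring
  have hdiv := hρ.integral_divergence_eq_zero (L := fun i => r {i}) hL
    (V := fun j y => ∑ i, ξ y i * ev r (M i j) y)
    (fun j => ContDiff.sum fun i _ => ((hξd i).mul (contDiff_ev h.smooth _)).of_le (by simp))
    (fun j => integrable_finsetSum _ fun i _ =>
      (hξ.2.eval_piLp i).integrable_mul (h.memLp_ev _))
    (by simp only [hsum]; exact (hint.const_mul _).add (hinner.const_mul _))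
  simp only [hsum] at hdiv
  rw [integral_add (hint.const_mul _) (hinner.const_mul _), integral_const_mul,
    integral_const_mul, pow_succ] at hdiv
  rcases neg_one_pow_eq_or ℝ n with hs | hs <;> rw [hs] at hdiv <;> linarith

/-- Contractions are unique. -/
theorem isContraction_unique [IsProbabilityMeasure μ] {ρ : Euc d → ℝ} (hρ : HasSmoothDensity μ ρ)
    {ι : Type*} [Fintype ι] {Φ : ι → Euc d → Euc d} (hΦ : ∀ w, ContDiff ℝ ∞ (Φ w))
    {Ψ Ψ' : Euc d → Euc d} (h : IsContraction μ Φ Ψ) (h' : IsContraction μ Φ Ψ') : Ψ = Ψ' := by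
  obtain ⟨χ, C, hC0, hχs, hχc, hχ1, hχe, -, -⟩ := exists_cutoff d
  have hnabla : ∀ {g : Euc d → Euc d}, ContDiff ℝ ∞ g → Continuous (nablaMatrix g) := by
    intro g hg
    refine continuous_matrix fun i j => ?_
    have := ((hg.continuous_fderiv (by simp)).clm_apply
      (continuous_const (y := EuclideanSpace.single i (1 : ℝ))))
    exact (EuclideanSpace.proj j : Euc d →L[ℝ] ℝ).continuous.comp this
  have key : ∀ n x, χ n x * ‖Ψ x - Ψ' x‖ ^ 2 = 0 := by
    intro n
    -- This test field has compact support, so integrability of Λ is automatic. It makes χ² |Ψ -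
    -- Ψ'|² have integral 0; positivity of the density and continuity then give vanishing
    -- everywhere.
    set ξ : Euc d → Euc d := fun x => χ n x ^ 2 • (Ψ x - Ψ' x) with hξ
    have hξs : ContDiff ℝ ∞ ξ := ((hχs n).pow 2).smul (h.1.1.sub h'.1.1)
    have hξc : HasCompactSupport ξ := by
      have : HasCompactSupport fun x => χ n x ^ 2 := by
        simp only [pow_two]
        exact (hχc n).mul_right
      exact this.smul_right
    have hL2 : IsL2Field μ ξ := ⟨hξs, hξs.continuous.memLp_of_hasCompactSupport hξc⟩
    have hLam : Integrable (Lam fun o : Option ι => o.elim ξ Φ) μ := by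
      have heq : (Lam fun o : Option ι => o.elim ξ Φ) = fun x => (-1) ^ (Fintype.card ι + 1) *
          ((enumSum (Fintype.card ι) fun w => nablaMatrix (Φ w) x) * nablaMatrix ξ x).trace :=
        funext fun x => Lam_option ξ Φ x
      rw [heq]
      refine Continuous.integrable_of_hasCompactSupport ?_ ?_
      · have hM : Continuous fun x => enumSum (Fintype.card ι) fun w => nablaMatrix (Φ w) x := by
          unfold enumSum
          refine continuous_finsetSum _ fun σ _ => ?_
          simp only [List.ofFn_eq_map]
          exact continuous_list_prod _ fun k _ => hnabla (hΦ _)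
        exact continuous_const.mul (hM.matrix_mul (hnabla hξs)).matrix_trace
      · refine HasCompactSupport.intro hξc fun x hx => ?_
        have : fderiv ℝ ξ x = 0 := by
          by_contra hne
          exact hx (support_fderiv_subset ℝ hne)
        have : nablaMatrix ξ x = 0 := by
          ext1 i j
          simp [nablaMatrix, this]
        simp [this]
    have h1 := (h.2 ξ hL2 hLam).trans (h'.2 ξ hL2 hLam).symm
    have i1 := integrable_inner hL2.2 h.1.2
    have i2 := integrable_inner hL2.2 h'.1.2
    rw [← sub_eq_zero, ← integral_sub i1 i2] at h1
    have heq : ∀ x, inner ℝ (ξ x) (Ψ x) - inner ℝ (ξ x) (Ψ' x) =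
        χ n x ^ 2 * ‖Ψ x - Ψ' x‖ ^ 2 := by
      intro x
      rw [← inner_sub_right, hξ]
      simp only [inner_smul_left, real_inner_self_eq_norm_sq]
      simp
    simp only [heq] at h1
    have i3 : Integrable (fun x => χ n x ^ 2 * ‖Ψ x - Ψ' x‖ ^ 2) μ := by
      simp only [← heq]
      exact i1.sub i2
    rw [integral_eq_zero_iff_of_nonneg (fun x => by positivity) i3] at h1
    have h2 : (fun x => χ n x ^ 2 * ‖Ψ x - Ψ' x‖ ^ 2) =ᵐ[volume] 0 :=
      hρ.absolutelyContinuous.ae_eq h1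
    have hcont : Continuous fun x => χ n x ^ 2 * ‖Ψ x - Ψ' x‖ ^ 2 :=
      ((hχs n).continuous.pow 2).mul ((h.1.1.continuous.sub h'.1.1.continuous).norm.pow 2)
    have h3 := (hcont.ae_eq_iff_eq volume continuous_zero).1 h2
    intro x
    have := congrFun h3 x
    simp only [Pi.zero_apply, mul_eq_zero, pow_eq_zero_iff, ne_eq, OfNat.ofNat_ne_zero,
      not_false_eq_true] at this ⊢
    exact this
  ext1 x
  obtain ⟨n, hn⟩ := (hχe x).exists
  have := key n x
  rw [hn, one_mul, sq_eq_zero_iff, norm_eq_zero, sub_eq_zero] at this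
  exact this

end Jets

/-! ### Values of trees -/

section TreeValues

variable {d : ℕ} {μ : Measure (Euc d)} {r : Multiset (Fin d) → Euc d → ℝ}
variable {V : Type} [Fintype V] {G : SimpleGraph V}

theorem IsJet.isBranchVal [IsProbabilityMeasure μ] (h : IsJet μ r) (hG : G.IsTree) {u v : V}
    (huv : G.Adj u v) : IsBranchVal μ G u v (evField r (branch d G u v)) := by
  classical
  suffices key : ∀ n, ∀ {u v : V}, G.Adj u v → (branchSet G u v).card ≤ n →
      IsBranchVal μ G u v (evField r (branch d G u v)) from key _ huv le_rfl
  intro n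
  induction n with
  | zero =>
    intro u v huv h
    have := Finset.card_pos.2 ⟨u, self_mem_branchSet hG huv⟩
    omega
  | succ n ih =>
    intro u v huv hn
    refine .mk u v huv (fun w => evField r (branch d G w.1 u)) (fun w => ?_) _ ?_
    · exact ih w.2.1.symm (by have := branchSet_card_lt hG huv w.2.1 w.2.2; omega)
    · rw [branch_eq hG huv]
      exact h.isContraction _

/-- Uniqueness of contractions propagates from the leaves inwards. -/
theorem IsJet.eq_of_isBranchVal [IsProbabilityMeasure μ] (h : IsJet μ r) (hG : G.IsTree)
    {u v : V} {Ψ : Euc d → Euc d} (hΨ : IsBranchVal μ G u v Ψ) :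
    Ψ = evField r (branch d G u v) := by
  classical
  obtain ⟨ρ, hρ, -⟩ := h.exists_density
  induction hΨ with
  | mk u v huv Φ hΦ Ψ hΨ ih =>
    have hΦ' : Φ = fun w => evField r (branch d G w.1 u) := funext ih
    subst hΦ'
    refine isContraction_unique hρ (fun w => (h.isL2Field _).1) hΨ ?_
    rw [branch_eq hG huv]
    exact h.isContraction _

/-- The pairing of the branches at an edge. -/
noncomputable def edgeVal (μ : Measure (Euc d)) (r : Multiset (Fin d) → Euc d → ℝ)
    (G : SimpleGraph V) (u v : V) : ℝ :=
  ∫ x, ev r (edgeSymbol d G u v) x ∂μ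

theorem inner_evField (u v : V) (x : Euc d) :
    inner ℝ (evField r (branch d G u v) x) (evField r (branch d G v u) x) =
      ev r (edgeSymbol d G u v) x := by
  rw [inner_eq_sum, edgeSymbol, ev_sum]
  exact Finset.sum_congr rfl fun i _ => (ev_mul _ _ _).symm

theorem edgeVal_comm (u v : V) : edgeVal μ r G u v = edgeVal μ r G v u := by
  simp only [edgeVal, edgeSymbol, mul_comm]

theorem IsJet.hasVal_edge_iff [IsProbabilityMeasure μ] (h : IsJet μ r) (hG : G.IsTree)
    {u v : V} (huv : G.Adj u v) (c : ℝ) :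
    HasVal μ G (.edge u v huv) c ↔ c = edgeVal μ r G u v := by
  constructor
  · rintro ⟨Φ, Ψ, hΦ, hΨ, -, rfl⟩
    rw [h.eq_of_isBranchVal hG hΦ, h.eq_of_isBranchVal hG hΨ]
    simp only [inner_evField]
    rfl
  · rintro rfl
    refine ⟨_, _, h.isBranchVal hG huv, h.isBranchVal hG huv.symm, ?_, ?_⟩
    · simp only [inner_evField]
      exact h.integrable_ev _
    · simp only [inner_evField]
      rfl

/-- The symbol of `Λ_n`. -/
noncomputable def lamSymbol {ι : Type*} [Fintype ι] (φ : ι → Fin d → JetRing d) : JetRing d :=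
  MvPolynomial.C ((-1) ^ Fintype.card ι * (1 / (Fintype.card ι : ℝ))) *
    (enumSum (Fintype.card ι) fun w => nabla (φ w)).trace

theorem IsJet.Lam_evField (h : IsJet μ r) {ι : Type*} [Fintype ι] (φ : ι → Fin d → JetRing d) :
    Lam (fun w => evField r (φ w)) = ev r (lamSymbol φ) := by
  ext1 x
  rw [Lam_eq, lamSymbol, ev_mul, ev_C]
  congr 1
  simp only [nablaMatrix_evField h, ← map_enumSum]
  rw [← evHom_apply, Matrix.trace, Matrix.trace, map_sum]
  rfl

open Classical in
theorem IsJet.hasVal_node_iff [IsProbabilityMeasure μ] (h : IsJet μ r) (hG : G.IsTree) (v : V)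
    (c : ℝ) : HasVal μ G (.node v) c ↔
      c = ∫ x, Lam (fun w : {w : V // G.Adj v w} => evField r (branch d G w.1 v)) x ∂μ := by
  constructor
  · rintro ⟨Φ, hΦ, -, rfl⟩
    have : Φ = fun w => evField r (branch d G w.1 v) :=
      funext fun w => h.eq_of_isBranchVal hG (hΦ w)
    rw [this]
  · rintro rfl
    refine ⟨_, fun w => h.isBranchVal hG w.2.symm, ?_, rfl⟩
    rw [h.Lam_evField]
    exact h.integrable_ev _

open Classical in
/-- The neighbours of a node, with one of them singled out. -/
noncomputable def neighborOptionEquiv {v w : V} (hvw : G.Adj v w) :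
    Option {w' : V // G.Adj v w' ∧ w' ≠ w} ≃ {w' : V // G.Adj v w'} where
  toFun o := o.elim ⟨w, hvw⟩ fun w' => ⟨w'.1, w'.2.1⟩
  invFun w' := if hw : w'.1 = w then none else some ⟨w'.1, w'.2, hw⟩
  left_inv o := by
    cases o with
    | none => simp
    | some w' => simp [w'.2.2]
  right_inv w' := by
    by_cases hw : w'.1 = w
    · simp only [hw, dite_true, Option.elim]
      exact Subtype.ext hw.symm
    · simp [hw]

-- The contraction at v that leaves the index of the edge to w free, tested on the field of the
-- branch at w, is the full contraction at v.
open Classical in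
theorem IsJet.integral_Lam_node [IsProbabilityMeasure μ] (h : IsJet μ r) (hG : G.IsTree) {v w : V}
    (hvw : G.Adj v w) :
    ∫ x, Lam (fun w : {w : V // G.Adj v w} => evField r (branch d G w.1 v)) x ∂μ =
      edgeVal μ r G v w := by
  have hc : IsContraction μ (fun w' : {w' : V // G.Adj v w' ∧ w' ≠ w} =>
      evField r (branch d G w'.1 v)) (evField r (branch d G v w)) := by
    rw [branch_eq hG hvw]
    exact h.isContraction _
  have hLam : (Lam fun o : Option {w' : V // G.Adj v w' ∧ w' ≠ w} =>
      o.elim (evField r (branch d G w v)) fun w' => evField r (branch d G w'.1 v)) =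
      Lam (fun w : {w : V // G.Adj v w} => evField r (branch d G w.1 v)) := by
    ext1 x
    rw [← Lam_comp_equiv (neighborOptionEquiv hvw)
      fun w : {w : V // G.Adj v w} => evField r (branch d G w.1 v)]
    congr 1
    ext1 o
    cases o <;> rfl
  have h1 := hc.2 (evField r (branch d G w v)) (h.isL2Field _) (by
    rw [hLam, h.Lam_evField]
    exact h.integrable_ev _)
  rw [← hLam, ← h1, edgeVal_comm]
  simp only [inner_evField]
  rfl

omit [Fintype V] in
theorem exists_adj [Nontrivial V] (hG : G.IsTree) (v : V) : ∃ w, G.Adj v w := by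
  obtain ⟨w, hw⟩ := exists_ne v
  obtain ⟨p⟩ := hG.connected v w
  cases p with
  | nil => exact absurd rfl hw
  | cons h _ => exact ⟨_, h⟩

/-- All edges at a node carry the value of that node, and the value of an edge does not depend on
its orientation. Hence the value is constant along walks. -/
theorem IsJet.edgeVal_eq [IsProbabilityMeasure μ] (h : IsJet μ r) (hG : G.IsTree) {u v u' v' : V}
    (huv : G.Adj u v) (huv' : G.Adj u' v') : edgeVal μ r G u v = edgeVal μ r G u' v' := by
  classical
  rw [← h.integral_Lam_node hG huv, ← h.integral_Lam_node hG huv']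
  obtain ⟨p⟩ := hG.connected u u'
  clear huv huv'
  induction p with
  | nil => rfl
  | cons hadj _ ih =>
    rw [← ih, h.integral_Lam_node hG hadj, h.integral_Lam_node hG hadj.symm, edgeVal_comm]

theorem IsJet.hasVal_iff [Nontrivial V] [IsProbabilityMeasure μ] (h : IsJet μ r) (hG : G.IsTree) {u v : V}
    (huv : G.Adj u v) (p : Parenthesization G) (c : ℝ) :
    HasVal μ G p c ↔ c = edgeVal μ r G u v := by
  classical
  cases p with
  | node w =>
    obtain ⟨w', hw⟩ := exists_adj hG w
    rw [h.hasVal_node_iff hG, h.integral_Lam_node hG hw, h.edgeVal_eq hG hw huv]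
  | edge a b hab => rw [h.hasVal_edge_iff hG, h.edgeVal_eq hG hab huv]

theorem IsJet.treeVal_eq [Nontrivial V] [IsProbabilityMeasure μ] (h : IsJet μ r) (hG : G.IsTree) {u v : V}
    (huv : G.Adj u v) : treeVal μ G = edgeVal μ r G u v := by
  have := Classical.epsilon_spec (p := fun c => ∀ p : Parenthesization G, HasVal μ G p c)
    ⟨edgeVal μ r G u v, fun p => (h.hasVal_iff hG huv p _).2 rfl⟩
  exact (h.hasVal_iff hG huv (.node u) _).1 (this _)

end TreeValues

/-! ### Regular measures have jets -/

section Tame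

variable {d : ℕ} {μ : Measure (Euc d)}

/-- The derivatives of `f` up to order `n` have moments of all orders. -/
def TameUpTo (μ : Measure (Euc d)) : ℕ → (Euc d → ℝ) → Prop
  | 0, f => UniformMoments (Set.univ : Set Unit) (fun _ => μ) fun _ => f
  | n + 1, f => UniformMoments (Set.univ : Set Unit) (fun _ => μ) (fun _ => f) ∧
      ∀ i, TameUpTo μ n (pd i f)

theorem TameUpTo.pred : ∀ {n : ℕ} {f : Euc d → ℝ}, TameUpTo μ (n + 1) f → TameUpTo μ n f
  | 0, _, h => h.1
  | _ + 1, _, h => ⟨h.1, fun i => (h.2 i).pred⟩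

theorem TameUpTo.add : ∀ {n : ℕ} {f g : Euc d → ℝ}, ContDiff ℝ ∞ f → ContDiff ℝ ∞ g →
    TameUpTo μ n f → TameUpTo μ n g → TameUpTo μ n fun x => f x + g x
  | 0, _, _, _, _, h, h' => UniformMoments.add h h'
  | n + 1, f, g, hf, hg, h, h' => ⟨UniformMoments.add h.1 h'.1, fun i => by
      have : pd i (fun x => f x + g x) = fun x => pd i f x + pd i g x := funext fun x =>
        pd_add (hf.differentiable (by simp) x) (hg.differentiable (by simp) x) i
      rw [this]
      exact (h.2 i).add (contDiff_pd hf i) (contDiff_pd hg i) (h'.2 i)⟩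

theorem TameUpTo.mul : ∀ {n : ℕ} {f g : Euc d → ℝ}, ContDiff ℝ ∞ f → ContDiff ℝ ∞ g →
    TameUpTo μ n f → TameUpTo μ n g → TameUpTo μ n fun x => f x * g x
  | 0, _, _, _, _, h, h' => UniformMoments.mul h h'
  | n + 1, f, g, hf, hg, h, h' => ⟨UniformMoments.mul h.1 h'.1, fun i => by
      have : pd i (fun x => f x * g x) = fun x => pd i f x * g x + f x * pd i g x := funext fun x =>
        pd_mul (hf.differentiable (by simp) x) (hg.differentiable (by simp) x) i
      rw [this]
      exact TameUpTo.add ((contDiff_pd hf i).mul hg) (hf.mul (contDiff_pd hg i))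
        (TameUpTo.mul (contDiff_pd hf i) hg (h.2 i) h'.pred)
        (TameUpTo.mul hf (contDiff_pd hg i) h.pred (h'.2 i))⟩

/-- Smooth functions all of whose derivatives have moments of all orders. -/
def IsTame (μ : Measure (Euc d)) (f : Euc d → ℝ) : Prop :=
  ContDiff ℝ ∞ f ∧ ∀ n, TameUpTo μ n f

theorem IsTame.add {f g : Euc d → ℝ} (hf : IsTame μ f) (hg : IsTame μ g) :
    IsTame μ fun x => f x + g x :=
  ⟨hf.1.add hg.1, fun n => (hf.2 n).add hf.1 hg.1 (hg.2 n)⟩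

theorem IsTame.mul {f g : Euc d → ℝ} (hf : IsTame μ f) (hg : IsTame μ g) :
    IsTame μ fun x => f x * g x :=
  ⟨hf.1.mul hg.1, fun n => (hf.2 n).mul hf.1 hg.1 (hg.2 n)⟩

theorem IsTame.pd {f : Euc d → ℝ} (hf : IsTame μ f) (i : Fin d) : IsTame μ (pd i f) :=
  ⟨contDiff_pd hf.1 i, fun n => (hf.2 (n + 1)).2 i⟩

theorem isTame_const [IsProbabilityMeasure μ] (c : ℝ) : IsTame μ fun _ => c := by
  refine ⟨contDiff_const, fun n => ?_⟩
  induction n generalizing c with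
  | zero => exact uniformMoments_const (fun _ _ => inferInstance) c
  | succ n ih =>
    refine ⟨uniformMoments_const (fun _ _ => inferInstance) c, fun i => ?_⟩
    have : EntropyFlow.pd i (fun _ => c) = fun _ => 0 := funext fun x => pd_const c i x
    rw [this]
    exact ih 0

theorem pd_iteratedFDeriv {U : Euc d → ℝ} (hU : ContDiff ℝ ∞ U) (k : ℕ) (m : Fin k → Euc d)
    (i : Fin d) (x : Euc d) :
    pd i (fun x => iteratedFDeriv ℝ k U x m) x =
      iteratedFDeriv ℝ (k + 1) U x (Fin.cons (EuclideanSpace.single i 1) m) := by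
  have hd : DifferentiableAt ℝ (iteratedFDeriv ℝ k U) x :=
    (hU.differentiable_iteratedFDeriv (by exact_mod_cast WithTop.coe_lt_top _)) x
  rw [iteratedFDeriv_succ_apply_left, Fin.cons_zero, Fin.tail_cons, pd]
  have h := hd.hasFDerivAt.continuousMultilinear_apply_const m
  rw [h.fderiv]
  rfl

theorem isTame_pd_of_regular [IsProbabilityMeasure μ] {U : Euc d → ℝ} (hU : ContDiff ℝ ∞ U)
    (hm : ∀ k : ℕ, 1 ≤ k → ∀ p : NNReal, MemLp (iteratedFDeriv ℝ k U) p μ) (i : Fin d) :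
    IsTame μ (pd i U) := by
  -- Stated for all entries of all derivatives of U, so that the induction closes: a partial
  -- derivative of an entry of order k is an entry of order k + 1.
  have key : ∀ (n k : ℕ), 1 ≤ k → ∀ v : Fin k → Fin d,
      TameUpTo μ n fun x => iteratedFDeriv ℝ k U x fun j => EuclideanSpace.single (v j) 1 := by
    intro n
    have h0 : ∀ k : ℕ, 1 ≤ k → ∀ v : Fin k → Fin d, UniformMoments (Set.univ : Set Unit)
        (fun _ => μ) fun _ x => iteratedFDeriv ℝ k U x fun j => EuclideanSpace.single (v j) 1 := by
      intro k hk v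
      have hc : Continuous fun x => iteratedFDeriv ℝ k U x fun j =>
          (EuclideanSpace.single (v j) 1 : Euc d) := by
        have := hU.continuous_iteratedFDeriv (m := k) (by exact_mod_cast le_top)
        exact (ContinuousMultilinearMap.apply ℝ (fun _ : Fin k => Euc d) ℝ _).continuous.comp this
      refine ⟨fun _ _ => hc, fun p => ⟨∫ x, |iteratedFDeriv ℝ k U x fun j =>
        (EuclideanSpace.single (v j) 1 : Euc d)| ^ p ∂μ, fun _ _ => ⟨?_, le_rfl⟩⟩⟩
      rcases Nat.eq_zero_or_pos p with rfl | hp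
      · simp
      have h1 := (hm k hk p).integrable_norm_pow (p := p) (by omega)
      refine h1.mono' (hc.abs.pow p).aestronglyMeasurable (Filter.Eventually.of_forall fun x => ?_)
      rw [norm_pow, norm_abs_eq_norm]
      refine pow_le_pow_left₀ (norm_nonneg _) ?_ p
      refine (ContinuousMultilinearMap.le_opNorm _ _).trans ?_
      simp
    induction n with
    | zero => exact h0
    | succ n ih =>
      intro k hk v
      refine ⟨h0 k hk v, fun i => ?_⟩
      have : pd i (fun x => iteratedFDeriv ℝ k U x fun j => (EuclideanSpace.single (v j) 1 : Euc d)) =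
          fun x => iteratedFDeriv ℝ (k + 1) U x fun j =>
            (EuclideanSpace.single ((Fin.cons i v : Fin (k + 1) → Fin d) j) 1 : Euc d) := by
        ext1 x
        rw [pd_iteratedFDeriv hU]
        congr 1
        ext1 j
        refine Fin.cases ?_ (fun j => ?_) j <;> simp
      rw [this]
      exact ih (k + 1) (by omega) _
  refine ⟨contDiff_pd hU i, fun n => ?_⟩
  have : pd i U = fun x => iteratedFDeriv ℝ 1 U x fun j =>
      (EuclideanSpace.single ((fun _ => i : Fin 1 → Fin d) j) 1 : Euc d) := by
    ext1 x
    rw [iteratedFDeriv_one_apply]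
    rfl
  rw [this]
  exact key n 1 le_rfl _

theorem pd_pd_eq {f : Euc d → ℝ} (hf : ContDiff ℝ ∞ f) (i j : Fin d) (x : Euc d) :
    pd i (pd j f) x = fderiv ℝ (fderiv ℝ f) x (EuclideanSpace.single i 1)
      (EuclideanSpace.single j 1) := by
  have hd : DifferentiableAt ℝ (fderiv ℝ f) x :=
    (hf.fderiv_right (m := ∞) (by simp)).differentiable (by simp) x
  have h := (hd.hasFDerivAt.clm_apply (hasFDerivAt_const (EuclideanSpace.single j (1 : ℝ)) x)).fderiv
  change fderiv ℝ (fun y => fderiv ℝ f y (EuclideanSpace.single j 1)) x _ = _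
  rw [h]
  simp

theorem pd_comm {f : Euc d → ℝ} (hf : ContDiff ℝ ∞ f) (i j : Fin d) (x : Euc d) :
    pd i (pd j f) x = pd j (pd i f) x := by
  rw [pd_pd_eq hf, pd_pd_eq hf]
  exact (hf.contDiffAt.isSymmSndFDerivAt (by
    simpa using (WithTop.coe_le_coe.2 le_top : ((2 : ℕ∞) : WithTop ℕ∞) ≤ ∞))) _ _

/-- The ratios ∂^s e^U / e^U arise from 1 by the operators f ↦ ∂_i f + f ∂_i U. These commute by
symmetry of second derivatives, so they can be folded over a multiset; folding inside the subtype of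
tame functions carries smoothness and moments along. -/
theorem exists_isJet_of_isRegular [IsProbabilityMeasure μ] (hμ : IsRegular μ) :
    ∃ r, IsJet μ r := by
  obtain ⟨U, hU, hμU, hm⟩ := hμ
  have hL := isTame_pd_of_regular hU hm
  let T : Fin d → {f // IsTame μ f} → {f // IsTame μ f} := fun i f =>
    ⟨fun x => pd i f.1 x + f.1 x * pd i U x, (f.2.pd i).add (f.2.mul (hL i))⟩
  have hT : LeftCommutative T := ⟨fun i j f => by
    have hd : ∀ {g : Euc d → ℝ} (x : Euc d), IsTame μ g → DifferentiableAt ℝ g x :=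
      fun x hg => hg.1.differentiable (by simp) x
    refine Subtype.ext (funext fun x => ?_)
    simp only [T]
    rw [pd_add (hd x (f.2.pd j)) (hd x (f.2.mul (hL j))), pd_mul (hd x f.2) (hd x (hL j)),
      pd_add (hd x (f.2.pd i)) (hd x (f.2.mul (hL i))), pd_mul (hd x f.2) (hd x (hL i)),
      pd_comm f.2.1 i j, pd_comm hU i j]
    ring⟩
  let r : Multiset (Fin d) → Euc d → ℝ := fun s => (s.foldr T ⟨fun _ => 1, isTame_const 1⟩).1
  have hr : ∀ i s x, r (i ::ₘ s) x = pd i (r s) x + r s x * pd i U x := by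
    intro i s x
    simp only [r, Multiset.foldr_cons]
    rfl
  have hr1 : ∀ i x, r {i} x = pd i U x := by
    intro i x
    rw [← Multiset.cons_zero, hr]
    have : r 0 = fun _ => 1 := by simp [r]
    rw [this, pd_const]
    simp
  refine ⟨r, ⟨fun x => Real.exp (U x), ⟨Real.contDiff_exp.comp hU, fun x => Real.exp_pos _, hμU⟩,
    fun i x => ?_⟩, fun s => (s.foldr T ⟨fun _ => 1, isTame_const 1⟩).2.1, fun i s x => ?_,
    fun s p => ?_⟩
  · rw [pd_comp (hU.differentiable (by simp) x) (Real.hasDerivAt_exp _), hr1, mul_comm]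
  · rw [hr, hr1]
    ring
  · obtain ⟨C, hC⟩ := ((s.foldr T ⟨fun _ => 1, isTame_const 1⟩).2.2 0).2 p
    exact (hC () trivial).1

end Tame

/-- All compatible parenthesizations of a tree make sense for a regular measure, and have the same
value. -/
theorem parenthesizations_agree {d : ℕ} {μ : Measure (Euc d)} (hμ : IsProbabilityMeasure μ)
    (hreg : IsRegular μ) {V : Type} [Fintype V] [Nontrivial V] {G : SimpleGraph V}
    (hG : G.IsTree) :
    (∀ u v : V, G.Adj u v → ∃! Ψ : Euc d → Euc d, IsBranchVal μ G u v Ψ) ∧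
      ∃ c : ℝ, ∀ (p : Parenthesization G) (c' : ℝ), HasVal μ G p c' ↔ c' = c := by
  obtain ⟨r, h⟩ := exists_isJet_of_isRegular hreg
  refine ⟨fun u v huv => ⟨_, h.isBranchVal hG huv, fun Ψ hΨ => h.eq_of_isBranchVal hG hΨ⟩, ?_⟩
  obtain ⟨u⟩ := hG.connected.nonempty
  obtain ⟨v, huv⟩ := exists_adj hG u
  exact ⟨_, fun p c' => h.hasVal_iff hG huv p c'⟩

/-! ### Derivatives of the heat kernel -/

section HermitePolynomials

open MvPolynomial

variable {d : ℕ}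

/-- Polynomials in the space variables `z_i` and in `κ = 1 / (2 τ)`. -/
abbrev KernelPoly (d : ℕ) : Type := MvPolynomial (Option (Fin d)) ℝ

/-- The variable `κ = 1 / (2 τ)`. -/
noncomputable def kap : KernelPoly d := X none

/-- The space variable `z_i`. -/
noncomputable def zvar (i : Fin d) : KernelPoly d := X (some i)

/-- The symbol of the space derivative of a polynomial times the heat kernel. -/
noncomputable def eta (i : Fin d) (q : KernelPoly d) : KernelPoly d :=
  pderiv (some i) q - kap * zvar i * q

/-- The time derivative of polynomials. -/
noncomputable def dtau : Derivation ℝ (KernelPoly d) (KernelPoly d) :=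
  -- The derivative of κ = 1/(2τ) is -1/(2τ²) = -2κ².
  mkDerivation ℝ fun o => o.elim (-2 * kap ^ 2) fun _ => 0

/-- The symbol of the time derivative of a polynomial times the heat kernel. -/
noncomputable def etaT (q : KernelPoly d) : KernelPoly d :=
  -- The bracket is the logarithmic time derivative |z|²/(4τ²) - d/(2τ) of the heat kernel.
  dtau q + (kap ^ 2 * ∑ k, zvar k ^ 2 - C (d : ℝ) * kap) * q

theorem pderiv_some_kap (i : Fin d) : pderiv (some i) (kap : KernelPoly d) = 0 :=
  pderiv_X_of_ne (by simp)

theorem pderiv_some_zvar (i j : Fin d) :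
    pderiv (some i) (zvar j : KernelPoly d) = if i = j then 1 else 0 := by
  rw [zvar, pderiv_X]
  by_cases h : i = j
  · subst h; simp
  · simp [h, Ne.symm h]

theorem dtau_kap : dtau (kap : KernelPoly d) = -2 * kap ^ 2 := mkDerivation_X _ _ _

theorem dtau_zvar (i : Fin d) : dtau (zvar i : KernelPoly d) = 0 := mkDerivation_X _ _ _

theorem pderiv_some_comm (i j : Fin d) (q : KernelPoly d) :
    pderiv (some i) (pderiv (some j) q) = pderiv (some j) (pderiv (some i) q) := by
  suffices h : ⁅pderiv (R := ℝ) (some i), pderiv (some j)⁆ = 0 by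
    have := DFunLike.congr_fun h q
    rwa [Derivation.commutator_apply, Derivation.zero_apply, sub_eq_zero] at this
  refine derivation_ext fun o => ?_
  rw [Derivation.commutator_apply, Derivation.zero_apply]
  cases o with
  | none =>
    change pderiv (some i) (pderiv (some j) kap) - pderiv (some j) (pderiv (some i) kap) = 0
    simp [pderiv_some_kap]
  | some k =>
    change pderiv (some i) (pderiv (some j) (zvar k)) -
      pderiv (some j) (pderiv (some i) (zvar k)) = 0
    simp only [pderiv_some_zvar]
    split_ifs <;> simp

theorem dtau_pderiv (i : Fin d) (q : KernelPoly d) :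
    dtau (pderiv (some i) q) = pderiv (some i) (dtau q) := by
  suffices h : ⁅dtau, pderiv (R := ℝ) (some i)⁆ = 0 by
    have := DFunLike.congr_fun h q
    rwa [Derivation.commutator_apply, Derivation.zero_apply, sub_eq_zero] at this
  refine derivation_ext fun o => ?_
  rw [Derivation.commutator_apply, Derivation.zero_apply]
  cases o with
  | none =>
    change dtau (pderiv (some i) kap) - pderiv (some i) (dtau kap) = 0
    rw [dtau_kap, pderiv_some_kap, Derivation.leibniz, Derivation.leibniz_pow, pderiv_some_kap]
    have : pderiv (some i) (-2 : KernelPoly d) = 0 := by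
      have : (-2 : KernelPoly d) = C (-2) := by rw [map_neg, map_ofNat]
      rw [this, pderiv_C]
    simp [this]
  | some k =>
    change dtau (pderiv (some i) (zvar k)) - pderiv (some i) (dtau (zvar k)) = 0
    rw [pderiv_some_zvar, dtau_zvar]
    split_ifs <;> simp

theorem eta_comm (i j : Fin d) (q : KernelPoly d) : eta i (eta j q) = eta j (eta i q) := by
  simp only [eta, map_sub, Derivation.leibniz, smul_eq_mul, pderiv_some_kap, pderiv_some_zvar,
    pderiv_some_comm i j q]
  by_cases h : i = j
  · subst h; ring
  · simp only [h, Ne.symm h, if_false]; ring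

theorem etaT_eta (i : Fin d) (q : KernelPoly d) : etaT (eta i q) = eta i (etaT q) := by
  have hC : pderiv (some i) (C (d : ℝ) : KernelPoly d) = 0 := pderiv_C
  have hsum : pderiv (some i) (∑ k : Fin d, (zvar k : KernelPoly d) ^ 2) = 2 * zvar i := by
    rw [map_sum]
    simp only [Derivation.leibniz_pow, pderiv_some_zvar, smul_eq_mul]
    simp [two_mul]
  simp only [eta, etaT, map_sub, map_add, Derivation.leibniz, Derivation.leibniz_pow, smul_eq_mul,
    pderiv_some_kap, dtau_kap, dtau_zvar, dtau_pderiv, hC, hsum]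
  ring_nf

theorem etaT_one : etaT (1 : KernelPoly d) = ∑ k, eta k (eta k 1) := by
  have : ∀ k : Fin d, eta k (eta k (1 : KernelPoly d)) = kap ^ 2 * zvar k ^ 2 - kap := by
    intro k
    simp only [eta, map_sub, Derivation.leibniz, smul_eq_mul, pderiv_some_kap, pderiv_some_zvar,
      Derivation.map_one_eq_zero]
    simp
    ring
  simp only [this, etaT, Derivation.map_one_eq_zero, Finset.sum_sub_distrib, Finset.mul_sum]
  simp

instance : LeftCommutative (eta : Fin d → KernelPoly d → KernelPoly d) := ⟨eta_comm⟩

/-- The polynomial `h` for which `∂^s` of the heat kernel is `h` times the heat kernel. -/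
noncomputable def hermite (s : Multiset (Fin d)) : KernelPoly d := s.foldr eta 1

theorem hermite_cons (i : Fin d) (s : Multiset (Fin d)) :
    hermite (i ::ₘ s) = eta i (hermite s) := Multiset.foldr_cons _ _ _ _

theorem hermite_zero : hermite (0 : Multiset (Fin d)) = 1 := Multiset.foldr_zero _ _

theorem eta_sum {α : Type*} (s : Finset α) (f : α → KernelPoly d) (i : Fin d) :
    eta i (∑ a ∈ s, f a) = ∑ a ∈ s, eta i (f a) := by
  simp [eta, Finset.mul_sum]

/-- The heat equation for all derivatives of the kernel: `etaT_one` is the equation for the kernel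
itself, and `etaT` commutes with each `eta i`. -/
theorem etaT_hermite (s : Multiset (Fin d)) :
    etaT (hermite s) = ∑ k, hermite (k ::ₘ k ::ₘ s) := by
  induction s using Multiset.induction_on with
  | empty => simp only [hermite_cons, hermite_zero, etaT_one]
  | cons i s ih =>
    rw [hermite_cons, etaT_eta, ih, eta_sum]
    refine Finset.sum_congr rfl fun k _ => ?_
    rw [← hermite_cons, Multiset.cons_swap i k, Multiset.cons_swap i k]

end HermitePolynomials

/-! ### The heat kernel -/

section HeatKernel

open MvPolynomial

variable {d : ℕ}

/-- The heat kernel. -/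
noncomputable def heatKernel (τ : ℝ) (z : Euc d) : ℝ :=
  -- Written as one exponential, the kernel is visibly positive and smooth in z for every real τ.
  Real.exp (-(d / 2 : ℝ) * Real.log (4 * Real.pi * τ) - ‖z‖ ^ 2 / (4 * τ))

/-- Evaluation of the polynomials in front of the heat kernel. -/
noncomputable def polyEval (q : KernelPoly d) (τ : ℝ) (z : Euc d) : ℝ :=
  aeval (fun o : Option (Fin d) => o.elim (1 / (2 * τ)) fun i => z i) q

/-- A polynomial times the heat kernel. -/
noncomputable def kernel (q : KernelPoly d) (τ : ℝ) (z : Euc d) : ℝ :=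
  polyEval q τ z * heatKernel τ z

theorem polyEval_C (c τ : ℝ) (z : Euc d) : polyEval (C c) τ z = c := by simp [polyEval]

theorem polyEval_C_eq (c τ : ℝ) : polyEval (C c) τ = fun _ : Euc d => c := by
  ext z; simp [polyEval]

theorem polyEval_add_eq (p q : KernelPoly d) (τ : ℝ) :
    polyEval (p + q) τ = fun z => polyEval p τ z + polyEval q τ z := by
  ext z; simp [polyEval]

theorem polyEval_mul_eq (p q : KernelPoly d) (τ : ℝ) :
    polyEval (p * q) τ = fun z => polyEval p τ z * polyEval q τ z := by
  ext z; simp [polyEval]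

theorem polyEval_none_eq (τ : ℝ) : polyEval (X none) τ = fun _ : Euc d => 1 / (2 * τ) := by
  ext z; simp [polyEval]

theorem polyEval_some_eq (i : Fin d) (τ : ℝ) : polyEval (X (some i)) τ = fun z => z i := by
  ext z; simp [polyEval]

theorem polyEval_add (p q : KernelPoly d) (τ : ℝ) (z : Euc d) :
    polyEval (p + q) τ z = polyEval p τ z + polyEval q τ z := by simp [polyEval]

theorem polyEval_sub (p q : KernelPoly d) (τ : ℝ) (z : Euc d) :
    polyEval (p - q) τ z = polyEval p τ z - polyEval q τ z := by simp [polyEval]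

theorem polyEval_mul (p q : KernelPoly d) (τ : ℝ) (z : Euc d) :
    polyEval (p * q) τ z = polyEval p τ z * polyEval q τ z := by simp [polyEval]

theorem polyEval_pow (p : KernelPoly d) (n : ℕ) (τ : ℝ) (z : Euc d) :
    polyEval (p ^ n) τ z = polyEval p τ z ^ n := by simp [polyEval]

theorem polyEval_one (τ : ℝ) (z : Euc d) : polyEval 1 τ z = 1 := by simp [polyEval]

theorem polyEval_kap (τ : ℝ) (z : Euc d) : polyEval kap τ z = 1 / (2 * τ) := by
  simp [polyEval, kap]

theorem polyEval_zvar (i : Fin d) (τ : ℝ) (z : Euc d) : polyEval (zvar i) τ z = z i := by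
  simp [polyEval, zvar]

theorem polyEval_sum_sq (τ : ℝ) (z : Euc d) : polyEval (∑ k, zvar k ^ 2) τ z = ‖z‖ ^ 2 := by
  rw [EuclideanSpace.real_norm_sq_eq]
  simp [polyEval, zvar]

theorem contDiff_polyEval (q : KernelPoly d) (τ : ℝ) : ContDiff ℝ ∞ (polyEval q τ) := by
  induction q using MvPolynomial.induction_on with
  | C c =>
    rw [polyEval_C_eq]; exact contDiff_const
  | add p q hp hq =>
    rw [polyEval_add_eq]; exact hp.add hq
  | mul_X p o hp =>
    rw [polyEval_mul_eq]
    refine hp.mul ?_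
    cases o with
    | none =>
      rw [polyEval_none_eq]; exact contDiff_const
    | some i =>
      rw [polyEval_some_eq]; exact (EuclideanSpace.proj i : Euc d →L[ℝ] ℝ).contDiff

theorem pd_coord (i j : Fin d) (z : Euc d) : pd i (fun z => z j) z = if i = j then 1 else 0 := by
  have := (EuclideanSpace.proj j : Euc d →L[ℝ] ℝ).fderiv (x := z)
  rw [pd]
  change fderiv ℝ (EuclideanSpace.proj j : Euc d →L[ℝ] ℝ) z _ = _
  rw [this]
  simp [eq_comm]

theorem pd_polyEval (i : Fin d) (q : KernelPoly d) (τ : ℝ) (z : Euc d) :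
    pd i (polyEval q τ) z = polyEval (pderiv (some i) q) τ z := by
  have hd : ∀ q : KernelPoly d, DifferentiableAt ℝ (polyEval q τ) z := fun q =>
    (contDiff_polyEval q τ).differentiable (by simp) z
  induction q using MvPolynomial.induction_on with
  | C c =>
    rw [polyEval_C_eq, pd_const, pderiv_C]
    simp [polyEval]
  | add p q hp hq =>
    rw [polyEval_add_eq, pd_add (hd p) (hd q), hp, hq, map_add, polyEval_add]
  | mul_X p o hp =>
    rw [polyEval_mul_eq, pd_mul (hd p) (hd _), hp, Derivation.leibniz, polyEval_add, smul_eq_mul, smul_eq_mul,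
      polyEval_mul, polyEval_mul]
    cases o with
    | none =>
      have h2 : pderiv (some i) (X none : KernelPoly d) = 0 := pderiv_some_kap i
      rw [polyEval_none_eq, pd_const, h2, ← map_zero C, polyEval_C]
      ring
    | some j =>
      have h2 : pderiv (some i) (X (some j) : KernelPoly d) = if i = j then 1 else 0 :=
        pderiv_some_zvar i j
      rw [polyEval_some_eq, pd_coord, h2]
      split_ifs
      · rw [polyEval_one]; ring
      · rw [← map_zero C, polyEval_C]; ring

theorem heatKernel_pos (τ : ℝ) (z : Euc d) : 0 < heatKernel τ z := Real.exp_pos _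

theorem contDiff_heatKernel (τ : ℝ) : ContDiff ℝ ∞ (heatKernel τ : Euc d → ℝ) :=
  Real.contDiff_exp.comp (contDiff_const.sub ((contDiff_norm_sq ℝ).div_const _))

theorem pd_norm_sq (i : Fin d) (z : Euc d) : pd i (fun z => ‖z‖ ^ 2) z = 2 * z i := by
  have h : (fun z : Euc d => ‖z‖ ^ 2) = fun z => ∑ k, z k * z k := by
    ext z; rw [EuclideanSpace.real_norm_sq_eq]; simp [pow_two]
  have hd : ∀ k, DifferentiableAt ℝ (fun z : Euc d => z k) z := fun k =>
    (EuclideanSpace.proj k : Euc d →L[ℝ] ℝ).differentiableAt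
  rw [h, pd_sum Finset.univ (f := fun k z => z k * z k) fun k _ => (hd k).mul (hd k)]
  simp only [pd_mul (hd _) (hd _), pd_coord]
  simp [two_mul, Finset.sum_add_distrib]

theorem pd_heatKernel (i : Fin d) (τ : ℝ) (z : Euc d) :
    pd i (heatKernel τ) z = - (1 / (2 * τ) * z i) * heatKernel τ z := by
  have hd : DifferentiableAt ℝ (fun z : Euc d => ‖z‖ ^ 2) z :=
    (contDiff_norm_sq (n := 1) ℝ).differentiable (by simp) z
  have hφ : HasDerivAt (fun s : ℝ => Real.exp (-(d / 2 : ℝ) * Real.log (4 * Real.pi * τ) -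
      s / (4 * τ))) (heatKernel τ z * (0 - 1 / (4 * τ))) (‖z‖ ^ 2) :=
    (((hasDerivAt_const _ _).sub ((hasDerivAt_id _).div_const (4 * τ)))).exp
  have := pd_comp hd hφ i
  rw [pd_norm_sq] at this
  refine this.trans ?_
  by_cases h : τ = 0
  -- At τ = 0 both sides vanish, as division by zero gives 0.
  · subst h; simp
  · field_simp; ring

theorem contDiff_kernel (q : KernelPoly d) (τ : ℝ) : ContDiff ℝ ∞ (kernel q τ) :=
  (contDiff_polyEval q τ).mul (contDiff_heatKernel τ)

theorem pd_kernel (i : Fin d) (q : KernelPoly d) (τ : ℝ) (z : Euc d) :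
    pd i (kernel q τ) z = kernel (eta i q) τ z := by
  have h := pd_mul ((contDiff_polyEval q τ).differentiable (by simp) z)
    ((contDiff_heatKernel τ).differentiable (by simp) z) i
  refine h.trans ?_
  rw [pd_polyEval, pd_heatKernel, kernel, eta, polyEval_sub, polyEval_mul, polyEval_mul,
    polyEval_kap, polyEval_zvar]
  ring

theorem hasDerivAt_polyEval (q : KernelPoly d) {τ : ℝ} (hτ : 0 < τ) (z : Euc d) :
    HasDerivAt (fun τ => polyEval q τ z) (polyEval (dtau q) τ z) τ := by
  induction q using MvPolynomial.induction_on with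
  | C c =>
    simp only [polyEval_C]
    have : dtau (C c : KernelPoly d) = C 0 := by
      rw [← MvPolynomial.algebraMap_eq, Derivation.map_algebraMap]; simp
    rw [this, polyEval_C]
    exact hasDerivAt_const _ _
  | add p q hp hq =>
    simp only [polyEval_add, map_add]
    exact hp.add hq
  | mul_X p o hp =>
    simp only [polyEval_mul]
    rw [Derivation.leibniz, polyEval_add, smul_eq_mul, smul_eq_mul, polyEval_mul, polyEval_mul,
      add_comm, mul_comm (polyEval (X o) τ z)]
    refine hp.mul ?_
    cases o with
    | none =>
      have h2 : dtau (X none : KernelPoly d) = C (-2) * kap * kap := by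
        refine dtau_kap.trans ?_
        rw [map_neg, map_ofNat]; ring
      have h : (fun τ => polyEval (X none) τ z) = fun τ => (2 * τ)⁻¹ := by
        ext τ; exact (polyEval_kap τ z).trans (one_div _)
      rw [h, h2, polyEval_mul, polyEval_mul, polyEval_kap, polyEval_C]
      have := ((hasDerivAt_id τ).const_mul 2).inv (by simpa using hτ.ne')
      convert! this using 1
      simp only [id]
      field_simp
    | some j =>
      have h : (fun τ => polyEval (X (some j)) τ z) = fun τ => z j := by
        ext τ; exact polyEval_zvar j τ z
      have h2 : dtau (X (some j) : KernelPoly d) = C 0 := by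
        rw [map_zero]; exact dtau_zvar j
      rw [h, h2, polyEval_C]
      exact hasDerivAt_const _ _

theorem hasDerivAt_heatKernel {τ : ℝ} (hτ : 0 < τ) (z : Euc d) :
    HasDerivAt (fun τ => heatKernel τ z)
      (((1 / (2 * τ)) ^ 2 * ‖z‖ ^ 2 - d * (1 / (2 * τ))) * heatKernel τ z) τ := by
  have h1 : HasDerivAt (fun τ : ℝ => Real.log (4 * Real.pi * τ)) (4 * Real.pi * 1 / (4 * Real.pi * τ)) τ :=
    ((hasDerivAt_id τ).const_mul (4 * Real.pi)).log (by simpa using hτ.ne')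
  have h2 : HasDerivAt (fun τ : ℝ => ‖z‖ ^ 2 / (4 * τ)) (‖z‖ ^ 2 * (-(4 * 1) / (4 * τ) ^ 2)) τ :=
    (((hasDerivAt_id τ).const_mul 4).inv (by simpa using hτ.ne')).const_mul (‖z‖ ^ 2)
  have := ((h1.const_mul (-(d / 2 : ℝ))).sub h2).exp
  convert! this using 1
  rw [heatKernel, mul_comm]
  congr 1
  have := Real.pi_ne_zero
  field_simp
  ring

theorem hasDerivAt_kernel (q : KernelPoly d) {τ : ℝ} (hτ : 0 < τ) (z : Euc d) :
    HasDerivAt (fun τ => kernel q τ z) (kernel (etaT q) τ z) τ := by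
  have := (hasDerivAt_polyEval q hτ z).mul (hasDerivAt_heatKernel hτ z)
  convert! this using 1
  rw [kernel, etaT, polyEval_add, polyEval_mul, polyEval_sub, polyEval_mul, polyEval_mul,
    polyEval_pow, polyEval_kap, polyEval_sum_sq, polyEval_C]
  ring

theorem exists_polyEval_bound (q : KernelPoly d) {a : ℝ} (ha : 0 < a) :
    ∃ (C : ℝ) (n : ℕ), 0 ≤ C ∧ ∀ τ, a ≤ τ → ∀ z : Euc d, |polyEval q τ z| ≤ C * (1 + ‖z‖) ^ n := by
  induction q using MvPolynomial.induction_on with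
  | C c => exact ⟨|c|, 0, abs_nonneg _, fun τ _ z => by rw [polyEval_C]; simp⟩
  | add p q hp hq =>
    obtain ⟨C1, n1, h1, hb1⟩ := hp
    obtain ⟨C2, n2, h2, hb2⟩ := hq
    refine ⟨C1 + C2, max n1 n2, add_nonneg h1 h2, fun τ hτ z => ?_⟩
    have h1z : 1 ≤ 1 + ‖z‖ := by linarith [norm_nonneg z]
    rw [polyEval_add, add_mul]
    refine (abs_add_le _ _).trans (add_le_add ((hb1 τ hτ z).trans ?_) ((hb2 τ hτ z).trans ?_))
    · exact mul_le_mul_of_nonneg_left (pow_le_pow_right₀ h1z (le_max_left _ _)) h1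
    · exact mul_le_mul_of_nonneg_left (pow_le_pow_right₀ h1z (le_max_right _ _)) h2
  | mul_X p o hp =>
    obtain ⟨C1, n1, h1, hb1⟩ := hp
    obtain ⟨C2, h2, hb2⟩ : ∃ C2 : ℝ, 0 ≤ C2 ∧ ∀ τ, a ≤ τ → ∀ z : Euc d,
        |polyEval (X o) τ z| ≤ C2 * (1 + ‖z‖) := by
      cases o with
      | none =>
        refine ⟨1 / (2 * a), by positivity, fun τ hτ z => ?_⟩
        have hτ0 : 0 < τ := ha.trans_le hτ
        have h3 : |1 / (2 * τ)| = 1 / (2 * τ) := abs_of_pos (by positivity)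
        have h4 : 1 / (2 * τ) ≤ 1 / (2 * a) :=
          one_div_le_one_div_of_le (by positivity) (by linarith)
        have h5 : 0 ≤ 1 / (2 * a) := by positivity
        rw [polyEval_none_eq, h3]
        nlinarith [norm_nonneg z, mul_nonneg h5 (norm_nonneg z)]
      | some i =>
        refine ⟨1, zero_le_one, fun τ hτ z => ?_⟩
        rw [polyEval_some_eq, one_mul]
        have := PiLp.norm_apply_le z i
        rw [Real.norm_eq_abs] at this
        linarith
    refine ⟨C1 * C2, n1 + 1, mul_nonneg h1 h2, fun τ hτ z => ?_⟩
    rw [polyEval_mul, abs_mul]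
    calc |polyEval p τ z| * |polyEval (X o) τ z|
        ≤ (C1 * (1 + ‖z‖) ^ n1) * (C2 * (1 + ‖z‖)) :=
          mul_le_mul (hb1 τ hτ z) (hb2 τ hτ z) (abs_nonneg _) (by positivity)
      _ = C1 * C2 * (1 + ‖z‖) ^ (n1 + 1) := by ring

/-- Polynomials times the heat kernel have Gaussian bounds, locally uniformly in time. -/
theorem exists_kernel_bound (q : KernelPoly d) {a b : ℝ} (ha : 0 < a) (hab : a ≤ b) :
    ∃ C c : ℝ, 0 ≤ C ∧ 0 < c ∧ ∀ τ ∈ Icc a b, ∀ z : Euc d,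
      |kernel q τ z| ≤ C * Real.exp (-c * ‖z‖ ^ 2) := by
  obtain ⟨C, n, hC, hb⟩ := exists_polyEval_bound q ha
  have hb0 : 0 < b := ha.trans_le hab
  -- For τ ≤ b the kernel decays like exp(-|z|²/(4b)). Half of this exponent pays for the
  -- polynomial, through (1 + |z|)^n ≤ n! e^(1+|z|) and |z| ≤ 2b + |z|²/(8b); the other half gives c
  -- = 1/(8b).
  refine ⟨C * (n.factorial * Real.exp (1 + 2 * b)) *
    Real.exp (-(d / 2 : ℝ) * Real.log (4 * Real.pi * a)), 1 / (8 * b), by positivity, by positivity,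
    fun τ hτ z => ?_⟩
  have hτ0 : 0 < τ := ha.trans_le hτ.1
  have hpi := Real.pi_pos
  have h1 : (1 + ‖z‖) ^ n ≤ n.factorial * Real.exp (1 + 2 * b) * Real.exp (1 / (8 * b) * ‖z‖ ^ 2) := by
    have := Real.pow_div_factorial_le_exp (1 + ‖z‖) (by positivity) n
    rw [div_le_iff₀ (by positivity)] at this
    refine this.trans ?_
    rw [mul_comm, mul_assoc, ← Real.exp_add]
    refine mul_le_mul_of_nonneg_left (Real.exp_le_exp.2 ?_) (by positivity)
    have h2 : ‖z‖ ≤ 2 * b + 1 / (8 * b) * ‖z‖ ^ 2 := by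
      have : 2 * b + 1 / (8 * b) * ‖z‖ ^ 2 - ‖z‖ = (1 / (8 * b)) * (‖z‖ - 4 * b) ^ 2 := by
        field_simp; ring
      have h3 : 0 ≤ (1 / (8 * b)) * (‖z‖ - 4 * b) ^ 2 := by positivity
      linarith
    linarith
  have h2 : heatKernel τ z ≤ Real.exp (-(d / 2 : ℝ) * Real.log (4 * Real.pi * a)) *
      Real.exp (-(2 * (1 / (8 * b))) * ‖z‖ ^ 2) := by
    rw [heatKernel, ← Real.exp_add]
    refine Real.exp_le_exp.2 ?_
    have h3 : Real.log (4 * Real.pi * a) ≤ Real.log (4 * Real.pi * τ) :=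
      Real.log_le_log (by positivity) (by nlinarith [hτ.1])
    have h4 : (d / 2 : ℝ) * Real.log (4 * Real.pi * a) ≤ (d / 2 : ℝ) * Real.log (4 * Real.pi * τ) := by
      gcongr
    have h5 : 2 * (1 / (8 * b)) * ‖z‖ ^ 2 ≤ ‖z‖ ^ 2 / (4 * τ) := by
      rw [div_eq_inv_mul (‖z‖ ^ 2)]
      have h6 : 2 * (1 / (8 * b)) = (4 * b)⁻¹ := by field_simp; norm_num
      have h7 : (4 * b)⁻¹ ≤ (4 * τ)⁻¹ := inv_anti₀ (by positivity) (by linarith [hτ.2])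
      exact mul_le_mul_of_nonneg_right (h6.trans_le h7) (sq_nonneg _)
    linarith
  rw [kernel, abs_mul, abs_of_pos (heatKernel_pos τ z)]
  calc |polyEval q τ z| * heatKernel τ z
      ≤ (C * (n.factorial * Real.exp (1 + 2 * b) * Real.exp (1 / (8 * b) * ‖z‖ ^ 2))) *
        (Real.exp (-(d / 2 : ℝ) * Real.log (4 * Real.pi * a)) *
          Real.exp (-(2 * (1 / (8 * b))) * ‖z‖ ^ 2)) :=
        mul_le_mul ((hb τ hτ.1 z).trans (mul_le_mul_of_nonneg_left h1 hC)) h2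
          (heatKernel_pos τ z).le (mul_nonneg hC (by positivity))
    _ = C * (n.factorial * Real.exp (1 + 2 * b)) *
        Real.exp (-(d / 2 : ℝ) * Real.log (4 * Real.pi * a)) *
          (Real.exp (1 / (8 * b) * ‖z‖ ^ 2) * Real.exp (-(2 * (1 / (8 * b))) * ‖z‖ ^ 2)) := by ring
    _ = _ := by
      rw [← Real.exp_add]
      congr 2
      ring

end HeatKernel

/-! ### Convolutions with the heat kernel -/

section HeatConv

open MvPolynomial

variable {d : ℕ} (ν : Measure (Euc d))

/-- The convolution of `ν` with a polynomial times the heat kernel. -/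
noncomputable def heatConv (q : KernelPoly d) (τ : ℝ) (x : Euc d) : ℝ :=
  ∫ y, kernel q τ (x - y) ∂ν

theorem kernel_bounded (q : KernelPoly d) {a b : ℝ} (ha : 0 < a) (hab : a ≤ b) :
    ∃ C, ∀ τ ∈ Icc a b, ∀ z : Euc d, |kernel q τ z| ≤ C := by
  obtain ⟨C, c, hC, hc, h⟩ := exists_kernel_bound (d := d) q ha hab
  refine ⟨C, fun τ hτ z => (h τ hτ z).trans (mul_le_of_le_one_right hC ?_)⟩
  rw [Real.exp_le_one_iff, neg_mul]
  have := mul_nonneg hc.le (sq_nonneg ‖z‖)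
  linarith

theorem continuous_kernel_sub (q : KernelPoly d) (τ : ℝ) (x : Euc d) :
    Continuous fun y => kernel q τ (x - y) :=
  (contDiff_kernel q τ).continuous.comp (continuous_const.sub continuous_id)

theorem hasFDerivAt_kernel (q : KernelPoly d) (τ : ℝ) (z : Euc d) :
    HasFDerivAt (kernel q τ)
      (∑ i, kernel (eta i q) τ z • (EuclideanSpace.proj i : Euc d →L[ℝ] ℝ)) z := by
  have h := ((contDiff_kernel q τ).differentiable (by simp) z).hasFDerivAt
  convert! h using 1
  refine ((EuclideanSpace.basisFun (Fin d) ℝ).toBasis.ext fun i => ?_ :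
    ((∑ i, kernel (eta i q) τ z • (EuclideanSpace.proj i : Euc d →L[ℝ] ℝ) : Euc d →L[ℝ] ℝ) :
      Euc d →ₗ[ℝ] ℝ) = (fderiv ℝ (kernel q τ) z : Euc d →ₗ[ℝ] ℝ)) |>
    ContinuousLinearMap.coe_injective
  have := pd_kernel i q τ z
  rw [pd] at this
  simp [this, Finset.sum_apply]

theorem heatConv_C_mul (c : ℝ) (q : KernelPoly d) (τ : ℝ) (x : Euc d) :
    heatConv ν (C c * q) τ x = c * heatConv ν q τ x := by
  rw [heatConv, heatConv, ← integral_const_mul]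
  simp only [kernel, polyEval_mul, polyEval_C, mul_assoc]

variable [IsProbabilityMeasure ν]

theorem integrable_kernel (q : KernelPoly d) {τ : ℝ} (hτ : 0 < τ) (x : Euc d) :
    Integrable (fun y => kernel q τ (x - y)) ν := by
  obtain ⟨C, hC⟩ := kernel_bounded (d := d) q hτ le_rfl
  exact Integrable.of_bound (continuous_kernel_sub q τ x).aestronglyMeasurable C
    (Filter.Eventually.of_forall fun y => hC τ ⟨le_rfl, le_rfl⟩ _)

theorem heatConv_add (p q : KernelPoly d) {τ : ℝ} (hτ : 0 < τ) (x : Euc d) :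
    heatConv ν (p + q) τ x = heatConv ν p τ x + heatConv ν q τ x := by
  rw [heatConv, heatConv, heatConv,
    ← integral_add (integrable_kernel ν p hτ x) (integrable_kernel ν q hτ x)]
  simp only [kernel, polyEval_add, add_mul]

theorem heatConv_sum {α : Type*} (s : Finset α) (q : α → KernelPoly d) {τ : ℝ} (hτ : 0 < τ)
    (x : Euc d) : heatConv ν (∑ k ∈ s, q k) τ x = ∑ k ∈ s, heatConv ν (q k) τ x := by
  classical
  induction s using Finset.induction_on with
  | empty =>
    have := heatConv_C_mul ν 0 (0 : KernelPoly d) τ x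
    simpa using this
  | insert a s ha ih => rw [Finset.sum_insert ha, Finset.sum_insert ha, heatConv_add ν _ _ hτ, ih]

theorem norm_sum_smul_proj_le {c C : Fin d → ℝ} (h : ∀ i, |c i| ≤ C i) :
    ‖∑ i, c i • (EuclideanSpace.proj i : Euc d →L[ℝ] ℝ)‖ ≤
      ∑ i, C i * ‖(EuclideanSpace.proj i : Euc d →L[ℝ] ℝ)‖ := by
  refine (norm_sum_le _ _).trans (Finset.sum_le_sum fun i _ => ?_)
  rw [norm_smul]
  exact mul_le_mul_of_nonneg_right (h i) (norm_nonneg _)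

theorem hasFDerivAt_heatConv (q : KernelPoly d) {τ : ℝ} (hτ : 0 < τ) (x : Euc d) :
    HasFDerivAt (heatConv ν q τ)
      (∑ i, heatConv ν (eta i q) τ x • (EuclideanSpace.proj i : Euc d →L[ℝ] ℝ)) x := by
  choose C hC using fun i => kernel_bounded (d := d) (eta i q) hτ le_rfl
  have hint : ∀ i, Integrable (fun y => kernel (eta i q) τ (x - y) •
      (EuclideanSpace.proj i : Euc d →L[ℝ] ℝ)) ν := fun i =>
    (integrable_kernel ν (eta i q) hτ x).smul_const _
  have hd : ∀ y x, HasFDerivAt (fun x => kernel q τ (x - y))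
      (∑ i, kernel (eta i q) τ (x - y) • (EuclideanSpace.proj i : Euc d →L[ℝ] ℝ)) x :=
    fun y x => (hasFDerivAt_comp_sub y).2 (hasFDerivAt_kernel q τ (x - y))
  have hb : ∀ y x, ‖∑ i, kernel (eta i q) τ (x - y) • (EuclideanSpace.proj i : Euc d →L[ℝ] ℝ)‖ ≤
      ∑ i, C i * ‖(EuclideanSpace.proj i : Euc d →L[ℝ] ℝ)‖ :=
    fun y x => norm_sum_smul_proj_le fun i => hC i τ ⟨le_rfl, le_rfl⟩ _
  have hm : AEStronglyMeasurable (fun y => ∑ i, kernel (eta i q) τ (x - y) •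
      (EuclideanSpace.proj i : Euc d →L[ℝ] ℝ)) ν :=
    (continuous_finsetSum _ fun i _ =>
      (continuous_kernel_sub (eta i q) τ x).smul continuous_const).aestronglyMeasurable
  have heq : ∫ y, ∑ i, kernel (eta i q) τ (x - y) • (EuclideanSpace.proj i : Euc d →L[ℝ] ℝ) ∂ν =
      ∑ i, heatConv ν (eta i q) τ x • (EuclideanSpace.proj i : Euc d →L[ℝ] ℝ) := by
    rw [integral_finsetSum _ fun i _ => hint i]
    exact Finset.sum_congr rfl fun i _ => integral_smul_const _ _
  rw [← heq]
  exact hasFDerivAt_integral_of_dominated_of_fderiv_le (μ := ν) (𝕜 := ℝ) (s := univ)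
    (bound := fun _ => ∑ i, C i * ‖(EuclideanSpace.proj i : Euc d →L[ℝ] ℝ)‖) Filter.univ_mem
    (Filter.Eventually.of_forall fun x => (continuous_kernel_sub q τ x).aestronglyMeasurable)
    (integrable_kernel ν q hτ x) hm (Filter.Eventually.of_forall fun y x _ => hb y x)
    (integrable_const _) (Filter.Eventually.of_forall fun y x _ => hd y x)

/-- The partial derivatives are again of the form `heatConv`, so induction on the order works with
the polynomial left general. -/
theorem contDiff_heatConv (q : KernelPoly d) {τ : ℝ} (hτ : 0 < τ) :
    ContDiff ℝ ∞ (heatConv ν q τ) := by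
  refine contDiff_infty.2 fun n => ?_
  induction n generalizing q with
  | zero =>
    refine contDiff_zero.2 (continuous_iff_continuousAt.2 fun x => ?_)
    exact (hasFDerivAt_heatConv ν q hτ x).continuousAt
  | succ n ih =>
    exact contDiff_succ_iff_hasFDerivAt.2 ⟨_, ContDiff.sum fun i _ => (ih (eta i q)).smul contDiff_const,
      hasFDerivAt_heatConv ν q hτ⟩

theorem pd_heatConv (i : Fin d) (q : KernelPoly d) {τ : ℝ} (hτ : 0 < τ) (x : Euc d) :
    pd i (heatConv ν q τ) x = heatConv ν (eta i q) τ x := by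
  rw [pd, (hasFDerivAt_heatConv ν q hτ x).fderiv]
  simp

theorem hasDerivAt_heatConv (q : KernelPoly d) {τ : ℝ} (hτ : 0 < τ) (x : Euc d) :
    HasDerivAt (fun τ => heatConv ν q τ x) (heatConv ν (etaT q) τ x) τ := by
  have ha : 0 < τ / 2 := by positivity
  obtain ⟨C, hC⟩ := kernel_bounded (d := d) (etaT q) ha (by linarith : τ / 2 ≤ 2 * τ)
  refine (hasDerivAt_integral_of_dominated_loc_of_deriv_le (μ := ν) (s := Icc (τ / 2) (2 * τ))
    (F := fun τ y => kernel q τ (x - y)) (F' := fun τ y => kernel (etaT q) τ (x - y))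
    (bound := fun _ => C) (Icc_mem_nhds (by linarith) (by linarith))
    (Filter.Eventually.of_forall fun τ => (continuous_kernel_sub q τ x).aestronglyMeasurable)
    (integrable_kernel ν q hτ x) (continuous_kernel_sub _ τ x).aestronglyMeasurable
    (Filter.Eventually.of_forall fun y τ' h' => hC τ' h' _) (integrable_const _)
    (Filter.Eventually.of_forall fun y τ' h' => ?_)).2
  exact hasDerivAt_kernel q (ha.trans_le h'.1) _

theorem kernel_one_pos (τ : ℝ) (z : Euc d) : 0 < kernel 1 τ z := by
  rw [kernel, polyEval_one, one_mul]
  exact heatKernel_pos τ z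

theorem heatConv_one_pos {τ : ℝ} (hτ : 0 < τ) (x : Euc d) : 0 < heatConv ν 1 τ x := by
  refine (integral_pos_iff_support_of_nonneg (fun y => (kernel_one_pos τ _).le)
    (integrable_kernel ν 1 hτ x)).2 ?_
  have : Function.support (fun y => kernel 1 τ (x - y)) = univ :=
    eq_univ_of_forall fun y => (kernel_one_pos τ _).ne'
  rw [this]
  simp

/-- The conditional expectation of a polynomial. -/
noncomputable def heatRatio (q : KernelPoly d) (τ : ℝ) (x : Euc d) : ℝ :=
  heatConv ν q τ x / heatConv ν 1 τ x

/-- Jensen's inequality for the probability measure proportional to `kernel 1 τ (x - y)` dν(y), read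
off from the nonnegative variance of q. -/
theorem heatRatio_sq_le (q : KernelPoly d) {τ : ℝ} (hτ : 0 < τ) (x : Euc d) :
    heatRatio ν q τ x ^ 2 ≤ heatRatio ν (q ^ 2) τ x := by
  have hpos := heatConv_one_pos ν hτ x
  set l := heatRatio ν q τ x with hl
  have h1 : heatConv ν q τ x = l * heatConv ν 1 τ x := by
    rw [hl, heatRatio, div_mul_cancel₀ _ hpos.ne']
  have h0 : 0 ≤ heatConv ν ((q - C l) ^ 2) τ x :=
    integral_nonneg fun y => by
      rw [kernel, polyEval_pow]
      exact mul_nonneg (sq_nonneg _) (heatKernel_pos _ _).le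
  have h2 : (q - C l) ^ 2 = q ^ 2 + (C (-2 * l) * q + C (l ^ 2) * 1) := by
    simp only [map_mul, map_pow, map_neg, map_ofNat]
    ring
  rw [h2, heatConv_add ν _ _ hτ, heatConv_add ν _ _ hτ, heatConv_C_mul, heatConv_C_mul, h1] at h0
  rw [heatRatio, le_div_iff₀ hpos]
  linarith

theorem heatRatio_pow_le (q : KernelPoly d) {τ : ℝ} (hτ : 0 < τ) (x : Euc d) (k : ℕ) :
    heatRatio ν q τ x ^ 2 ^ (k + 1) ≤ heatRatio ν (q ^ 2 ^ (k + 1)) τ x := by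
  induction k with
  | zero => simpa using heatRatio_sq_le ν q hτ x
  | succ k ih =>
    rw [pow_succ 2 (k + 1), pow_mul, pow_mul]
    refine le_trans (pow_le_pow_left₀ ?_ ih 2) (heatRatio_sq_le ν _ hτ x)
    rw [pow_succ 2 k, pow_mul]
    positivity

theorem abs_heatRatio_pow_le (q : KernelPoly d) {τ : ℝ} (hτ : 0 < τ) (x : Euc d) (p : ℕ) :
    |heatRatio ν q τ x| ^ p ≤ 1 + heatRatio ν (q ^ 2 ^ (p + 1)) τ x := by
  -- A power of two, so that squaring can be iterated, even, and at least p.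
  set m := 2 ^ (p + 1) with hm
  have hpm : p ≤ m := (Nat.lt_two_pow_self.le).trans (Nat.pow_le_pow_right (by norm_num) (by omega))
  have hev : |heatRatio ν q τ x| ^ m = heatRatio ν q τ x ^ m := by
    rw [hm, pow_succ, mul_comm, pow_mul, pow_mul, sq_abs]
  have h1 : |heatRatio ν q τ x| ^ p ≤ 1 + |heatRatio ν q τ x| ^ m := by
    rcases le_total |heatRatio ν q τ x| 1 with h | h
    · have := pow_le_one₀ (n := p) (abs_nonneg _) h
      have : 0 ≤ |heatRatio ν q τ x| ^ m := by positivity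
      linarith
    · have := pow_le_pow_right₀ h hpm
      linarith
  rw [hev] at h1
  exact h1.trans (add_le_add le_rfl (heatRatio_pow_le ν q hτ x p))

end HeatConv

/-! ### Moments of the heat flow -/

section DominatedMoments

variable {d : ℕ} {S : Set ℝ} {w : ℝ → Euc d → ℝ}

/-- The powers of `f t`, with weight `w t`, have an integrable bound which does not depend on
`t ∈ S`. -/
def DominatedMoments (S : Set ℝ) (w f : ℝ → Euc d → ℝ) : Prop :=
  ∀ p : ℕ, ∃ D : Euc d → ℝ, Integrable D ∧ ∀ t ∈ S, ∀ x, w t x * |f t x| ^ p ≤ D x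

theorem DominatedMoments.add (hw : ∀ t ∈ S, ∀ x, 0 ≤ w t x) {f g : ℝ → Euc d → ℝ}
    (hf : DominatedMoments S w f) (hg : DominatedMoments S w g) :
    DominatedMoments S w fun t x => f t x + g t x := by
  intro p
  obtain ⟨D1, h1, hb1⟩ := hf p
  obtain ⟨D2, h2, hb2⟩ := hg p
  refine ⟨fun x => 2 ^ (p - 1) * (D1 x + D2 x), (h1.add h2).const_mul _, fun t ht x => ?_⟩
  calc w t x * |f t x + g t x| ^ p
      ≤ w t x * (2 ^ (p - 1) * (|f t x| ^ p + |g t x| ^ p)) :=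
        mul_le_mul_of_nonneg_left ((pow_le_pow_left₀ (abs_nonneg _) (abs_add_le _ _) p).trans
          (add_pow_le (abs_nonneg _) (abs_nonneg _) p)) (hw t ht x)
    _ = 2 ^ (p - 1) * (w t x * |f t x| ^ p + w t x * |g t x| ^ p) := by ring
    _ ≤ _ := mul_le_mul_of_nonneg_left (add_le_add (hb1 t ht x) (hb2 t ht x)) (by positivity)

theorem DominatedMoments.mul (hw : ∀ t ∈ S, ∀ x, 0 ≤ w t x) {f g : ℝ → Euc d → ℝ}
    (hf : DominatedMoments S w f) (hg : DominatedMoments S w g) :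
    DominatedMoments S w fun t x => f t x * g t x := by
  intro p
  obtain ⟨D1, h1, hb1⟩ := hf (2 * p)
  obtain ⟨D2, h2, hb2⟩ := hg (2 * p)
  refine ⟨fun x => D1 x + D2 x, h1.add h2, fun t ht x => ?_⟩
  calc w t x * |f t x * g t x| ^ p
      ≤ w t x * (|f t x| ^ (2 * p) + |g t x| ^ (2 * p)) := by
        refine mul_le_mul_of_nonneg_left ?_ (hw t ht x)
        rw [abs_mul, mul_pow, pow_mul', pow_mul']
        nlinarith [sq_nonneg (|f t x| ^ p - |g t x| ^ p), sq_nonneg (|f t x| ^ p),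
          sq_nonneg (|g t x| ^ p)]
    _ = w t x * |f t x| ^ (2 * p) + w t x * |g t x| ^ (2 * p) := by ring
    _ ≤ _ := add_le_add (hb1 t ht x) (hb2 t ht x)

theorem dominatedMoments_ev (hw : ∀ t ∈ S, ∀ x, 0 ≤ w t x)
    (hD : ∃ D : Euc d → ℝ, Integrable D ∧ ∀ t ∈ S, ∀ x, w t x ≤ D x)
    {r : ℝ → Multiset (Fin d) → Euc d → ℝ} (hr : ∀ s, DominatedMoments S w fun t => r t s)
    (f : JetRing d) : DominatedMoments S w fun t => ev (r t) f := by
  induction f using MvPolynomial.induction_on with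
  | C c =>
    have : (fun t => ev (r t) (MvPolynomial.C c)) = fun _ _ => c := by ext t x; exact ev_C c x
    rw [this]
    obtain ⟨D, hD, hb⟩ := hD
    exact fun p => ⟨fun x => D x * |c| ^ p, hD.mul_const _, fun t ht x =>
      mul_le_mul_of_nonneg_right (hb t ht x) (by positivity)⟩
  | add f g hf hg =>
    have : (fun t => ev (r t) (f + g)) = fun t x => ev (r t) f x + ev (r t) g x := by
      ext t x; exact ev_add f g x
    rw [this]
    exact hf.add hw hg
  | mul_X f s hf =>
    have : (fun t => ev (r t) (f * MvPolynomial.X s)) = fun t x => ev (r t) f x * r t s x := by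
      ext t x; rw [ev_mul, ev_X]
    rw [this]
    exact hf.mul hw (hr s)

end DominatedMoments

/-! ### The heat semigroup: Fourier transform, integrable bounds and jets. -/

section HeatMoments

open MvPolynomial

variable {d : ℕ}

theorem integrable_exp_neg_mul_sq_norm {c : ℝ} (hc : 0 < c) :
    Integrable fun z : Euc d => Real.exp (-c * ‖z‖ ^ 2) := by
  -- A non-integrable function has integral 0 by convention, but the Gaussian integral is positive.
  by_contra h
  have h1 := GaussianFourier.integral_rexp_neg_mul_sq_norm (V := Euc d) hc
  rw [integral_undef h] at h1
  have : 0 < (Real.pi / c) ^ (Module.finrank ℝ (Euc d) / 2 : ℝ) :=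
    Real.rpow_pos_of_pos (div_pos Real.pi_pos hc) _
  exact this.ne h1

/-- At ξ = 0 this gives total mass one; for general ξ it gives the characteristic functions that
identify the flow. -/
theorem integral_heatKernel_mul_cexp {τ : ℝ} (hτ : 0 < τ) (ξ : Euc d) :
    ∫ z : Euc d, (heatKernel τ z : ℂ) * Complex.exp (Complex.I * (inner ℝ ξ z : ℝ)) =
      (Real.exp (-τ * ‖ξ‖ ^ 2) : ℂ) := by
  have hb : 0 < ((1 / (4 * τ) : ℝ) : ℂ).re := by
    rw [Complex.ofReal_re]; positivity
  have h := GaussianFourier.integral_cexp_neg_mul_sq_norm_add (V := Euc d) hb Complex.I ξ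
  have heq : ∀ z : Euc d, (heatKernel τ z : ℂ) * Complex.exp (Complex.I * (inner ℝ ξ z : ℝ)) =
      Complex.exp ((-(d / 2 : ℝ) * Real.log (4 * Real.pi * τ) : ℝ)) *
        Complex.exp (-((1 / (4 * τ) : ℝ) : ℂ) * (‖z‖ : ℂ) ^ 2 + Complex.I * (inner ℝ ξ z : ℝ)) := by
    intro z
    rw [heatKernel, Complex.ofReal_exp, ← Complex.exp_add, ← Complex.exp_add]
    congr 1
    push_cast
    ring
  simp only [heq]
  rw [integral_const_mul, h]
  have hpos : 0 < 4 * Real.pi * τ := by have := Real.pi_pos; positivity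
  have h1 : ((Real.pi : ℂ) / ((1 / (4 * τ) : ℝ) : ℂ)) = ((4 * Real.pi * τ : ℝ) : ℂ) := by
    rw [← Complex.ofReal_div]
    congr 1
    field_simp
  have h2 : (((4 * Real.pi * τ : ℝ) : ℂ)) ^ ((Module.finrank ℝ (Euc d) : ℂ) / 2) =
      Complex.exp (((d / 2 : ℝ) * Real.log (4 * Real.pi * τ) : ℝ)) := by
    rw [Complex.cpow_def_of_ne_zero (by exact_mod_cast hpos.ne'), ← Complex.ofReal_log hpos.le]
    simp only [finrank_euclideanSpace, Fintype.card_fin]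
    congr 1
    push_cast
    ring
  rw [h1, h2, ← mul_assoc, ← Complex.exp_add, Complex.I_sq, Complex.ofReal_exp, ← Complex.exp_add]
  congr 1
  have : (τ : ℂ) ≠ 0 := by exact_mod_cast hτ.ne'
  push_cast
  field_simp
  ring

theorem integral_heatKernel {τ : ℝ} (hτ : 0 < τ) : ∫ z : Euc d, heatKernel τ z = 1 := by
  have h := integral_heatKernel_mul_cexp (d := d) hτ 0
  simp only [inner_zero_left, Complex.ofReal_zero, mul_zero, Complex.exp_zero, mul_one, norm_zero,
    integral_complex_ofReal] at h
  simpa using h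

theorem integrable_heatKernel {τ : ℝ} (hτ : 0 < τ) : Integrable (heatKernel τ : Euc d → ℝ) := by
  by_contra h
  have := integral_heatKernel (d := d) hτ
  rw [integral_undef h] at this
  exact zero_ne_one this

variable (ν : Measure (Euc d)) [IsProbabilityMeasure ν]

theorem kernel_one_eq (τ : ℝ) : kernel 1 τ = (heatKernel τ : Euc d → ℝ) := by
  ext z; rw [kernel, polyEval_one, one_mul]

/-- The weight splits by 1 + |x|² ≤ 2(1 + |y|²)(1 + |x - y|²). The first factor is ν-integrable by
the second moment; the second is absorbed into the polynomial of the kernel. A Gaussian convolved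
with the weighted ν is then a bound valid for all times in the interval. -/
theorem exists_heatConv_bound (hν : Integrable (fun y => ‖y‖ ^ 2) ν) (q : KernelPoly d) {a b : ℝ}
    (ha : 0 < a) (hab : a ≤ b) : ∃ D : Euc d → ℝ, Integrable D ∧ ∀ τ ∈ Icc a b, ∀ x,
      (1 + ‖x‖ ^ 2) * |heatConv ν q τ x| ≤ D x := by
  obtain ⟨C, c, hC, hc, hb⟩ := exists_kernel_bound (d := d) (q * (1 + ∑ k, zvar k ^ 2)) ha hab
  set G : Euc d → ℝ := fun z => C * Real.exp (-c * ‖z‖ ^ 2) with hG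
  set h : Euc d → ℝ := fun y => 2 * (1 + ‖y‖ ^ 2) with hh
  have hGint : Integrable G := (integrable_exp_neg_mul_sq_norm hc).const_mul C
  have hhint : Integrable h ν := ((integrable_const _).add hν).const_mul 2
  have hconv := hhint.convolution_integrand (ContinuousLinearMap.mul ℝ ℝ) hGint
  refine ⟨_, hconv.integral_prod_left, fun τ hτ x => ?_⟩
  have hG0 : ∀ z, 0 ≤ G z := fun z => mul_nonneg hC (Real.exp_pos _).le
  have hGC : ∀ z, G z ≤ C := fun z => by
    refine mul_le_of_le_one_right hC ?_
    rw [Real.exp_le_one_iff, neg_mul]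
    have := mul_nonneg hc.le (sq_nonneg ‖z‖)
    linarith
  have hGc : Continuous G := by
    rw [hG]; fun_prop
  have hint : Integrable (fun y => h y * G (x - y)) ν := by
    refine (hhint.mul_const C).mono'
      (hhint.aestronglyMeasurable.mul (hGc.comp (continuous_const.sub continuous_id)).aestronglyMeasurable)
      (Filter.Eventually.of_forall fun y => ?_)
    have hy : 0 ≤ h y := by positivity
    rw [Real.norm_of_nonneg (mul_nonneg hy (hG0 _))]
    exact mul_le_mul_of_nonneg_left (hGC _) hy
  have hk : ∀ z, (1 + ‖z‖ ^ 2) * |kernel q τ z| ≤ G z := by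
    intro z
    refine le_trans (le_of_eq ?_) (hb τ hτ z)
    rw [kernel, kernel, polyEval_mul, polyEval_add, polyEval_one, polyEval_sum_sq, abs_mul, abs_mul,
      abs_mul, abs_of_nonneg (by positivity : 0 ≤ 1 + ‖z‖ ^ 2)]
    ring
  have h1 : (1 + ‖x‖ ^ 2) * |heatConv ν q τ x| ≤ ∫ y, (1 + ‖x‖ ^ 2) * |kernel q τ (x - y)| ∂ν := by
    rw [integral_const_mul]
    exact mul_le_mul_of_nonneg_left (abs_integral_le_integral_abs) (by positivity)
  refine h1.trans (integral_mono_of_nonneg (Filter.Eventually.of_forall fun y => by positivity) hint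
    (Filter.Eventually.of_forall fun y => ?_))
  have h2 : 1 + ‖x‖ ^ 2 ≤ h y * (1 + ‖x - y‖ ^ 2) := by
    have h3 : ‖x‖ ≤ ‖x - y‖ + ‖y‖ := by simpa using norm_add_le (x - y) y
    have h4 : ‖x‖ ^ 2 ≤ (‖x - y‖ + ‖y‖) ^ 2 := pow_le_pow_left₀ (norm_nonneg _) h3 2
    simp only [hh]
    nlinarith [sq_nonneg (‖x - y‖ - ‖y‖), mul_nonneg (sq_nonneg ‖x - y‖) (sq_nonneg ‖y‖)]
  change (1 + ‖x‖ ^ 2) * |kernel q τ (x - y)| ≤ h y * G (x - y)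
  have hy : 0 ≤ h y := by positivity
  calc (1 + ‖x‖ ^ 2) * |kernel q τ (x - y)|
      ≤ (h y * (1 + ‖x - y‖ ^ 2)) * |kernel q τ (x - y)| :=
        mul_le_mul_of_nonneg_right h2 (abs_nonneg _)
    _ = h y * ((1 + ‖x - y‖ ^ 2) * |kernel q τ (x - y)|) := by ring
    _ ≤ _ := mul_le_mul_of_nonneg_left (hk _) hy

/-- The solution of the heat equation at time `τ` with initial value `ν`. -/
noncomputable def heatMeasure (τ : ℝ) : Measure (Euc d) :=
  volume.withDensity fun x => ENNReal.ofReal (heatConv ν 1 τ x)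

theorem hasSmoothDensity_heatMeasure {τ : ℝ} (hτ : 0 < τ) :
    HasSmoothDensity (heatMeasure ν τ) (heatConv ν 1 τ) :=
  ⟨contDiff_heatConv ν 1 hτ, heatConv_one_pos ν hτ, rfl⟩

theorem integral_heatMeasure_cexp {τ : ℝ} (hτ : 0 < τ) (ξ : Euc d) :
    ∫ x, (heatConv ν 1 τ x : ℂ) * Complex.exp (Complex.I * (inner ℝ ξ x : ℝ)) =
      Real.exp (-τ * ‖ξ‖ ^ 2) * ∫ y, Complex.exp (Complex.I * (inner ℝ ξ y : ℝ)) ∂ν := by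
  have hf : Integrable (fun y => Complex.exp (Complex.I * (inner ℝ ξ y : ℝ))) ν :=
    Integrable.of_bound (by fun_prop) 1 (Filter.Eventually.of_forall fun y => by
      rw [mul_comm, Complex.norm_exp_ofReal_mul_I])
  have hg : Integrable (fun z : Euc d =>
      (heatKernel τ z : ℂ) * Complex.exp (Complex.I * (inner ℝ ξ z : ℝ))) := by
    refine (integrable_heatKernel hτ).mono (by
      have := (contDiff_heatKernel (d := d) τ).continuous
      fun_prop) (Filter.Eventually.of_forall fun z => ?_)
    rw [norm_mul, mul_comm Complex.I, Complex.norm_exp_ofReal_mul_I, Complex.norm_real, mul_one]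
  have h := integral_convolution (ν := ν) (μ := volume) (ContinuousLinearMap.mul ℝ ℂ) hf hg
  rw [integral_heatKernel_mul_cexp hτ] at h
  rw [mul_comm]
  refine Eq.trans (integral_congr_ae (Filter.Eventually.of_forall fun x => ?_)) h
  change (heatConv ν 1 τ x : ℂ) * Complex.exp (Complex.I * (inner ℝ ξ x : ℝ)) =
    ∫ y, Complex.exp (Complex.I * (inner ℝ ξ y : ℝ)) *
      ((heatKernel τ (x - y) : ℂ) * Complex.exp (Complex.I * (inner ℝ ξ (x - y) : ℝ))) ∂ν
  rw [heatConv, kernel_one_eq, ← integral_complex_ofReal, ← integral_mul_const]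
  refine integral_congr_ae (Filter.Eventually.of_forall fun y => ?_)
  change (heatKernel τ (x - y) : ℂ) * Complex.exp (Complex.I * (inner ℝ ξ x : ℝ)) =
    Complex.exp (Complex.I * (inner ℝ ξ y : ℝ)) *
      ((heatKernel τ (x - y) : ℂ) * Complex.exp (Complex.I * (inner ℝ ξ (x - y) : ℝ)))
  rw [mul_left_comm, ← Complex.exp_add, inner_sub_right]
  congr 2
  push_cast
  ring

theorem integral_heatConv_one {τ : ℝ} (hτ : 0 < τ) : ∫ x, heatConv ν 1 τ x = 1 := by
  have h := integral_heatMeasure_cexp ν hτ 0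
  simp only [inner_zero_left, Complex.ofReal_zero, mul_zero, Complex.exp_zero, mul_one, norm_zero,
    integral_complex_ofReal] at h
  simpa using h

theorem isProbabilityMeasure_heatMeasure {τ : ℝ} (hτ : 0 < τ) :
    IsProbabilityMeasure (heatMeasure ν τ) := by
  have hint : Integrable (heatConv ν 1 τ) := by
    by_contra h
    have := integral_heatConv_one ν hτ
    rw [integral_undef h] at this
    exact zero_ne_one this
  constructor
  rw [heatMeasure, withDensity_apply _ MeasurableSet.univ, Measure.restrict_univ,
    ← ofReal_integral_eq_lintegral_ofReal hint
      (Filter.Eventually.of_forall fun x => (heatConv_one_pos ν hτ x).le), integral_heatConv_one ν hτ,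
    ENNReal.ofReal_one]

/-- After Jensen's inequality, multiplication by the density cancels the denominator of the ratio
and leaves two convolutions that `exists_heatConv_bound` dominates. -/
theorem dominatedMoments_heatRatio (hν : Integrable (fun y => ‖y‖ ^ 2) ν) (q : KernelPoly d)
    {a b : ℝ} (ha : 0 < a) (hab : a ≤ b) :
    DominatedMoments (Icc a b) (fun τ x => (1 + ‖x‖ ^ 2) * heatConv ν 1 τ x)
      fun τ => heatRatio ν q τ := by
  intro p
  obtain ⟨D1, h1, hb1⟩ := exists_heatConv_bound ν hν 1 ha hab
  obtain ⟨D2, h2, hb2⟩ := exists_heatConv_bound ν hν (q ^ 2 ^ (p + 1)) ha hab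
  refine ⟨fun x => D1 x + D2 x, h1.add h2, fun τ hτ x => ?_⟩
  have hτ0 := ha.trans_le hτ.1
  have hpos := heatConv_one_pos ν hτ0 x
  have hx : 0 ≤ 1 + ‖x‖ ^ 2 := by positivity
  calc (1 + ‖x‖ ^ 2) * heatConv ν 1 τ x * |heatRatio ν q τ x| ^ p
      ≤ (1 + ‖x‖ ^ 2) * heatConv ν 1 τ x * (1 + heatRatio ν (q ^ 2 ^ (p + 1)) τ x) :=
        mul_le_mul_of_nonneg_left (abs_heatRatio_pow_le ν q hτ0 x p) (mul_nonneg hx hpos.le)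
    _ = (1 + ‖x‖ ^ 2) * heatConv ν 1 τ x + (1 + ‖x‖ ^ 2) * heatConv ν (q ^ 2 ^ (p + 1)) τ x := by
        rw [heatRatio]
        field_simp
    _ ≤ D1 x + D2 x := add_le_add
        ((mul_le_mul_of_nonneg_left (le_abs_self _) hx).trans (hb1 τ hτ x))
        ((mul_le_mul_of_nonneg_left (le_abs_self _) hx).trans (hb2 τ hτ x))

/-- The normalized space derivatives of the solution of the heat equation. -/
noncomputable def heatJet (τ : ℝ) (s : Multiset (Fin d)) (x : Euc d) : ℝ :=
  heatRatio ν (hermite s) τ x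

theorem dominatedMoments_ev_heatJet (hν : Integrable (fun y => ‖y‖ ^ 2) ν) (f : JetRing d)
    {a b : ℝ} (ha : 0 < a) (hab : a ≤ b) :
    DominatedMoments (Icc a b) (fun τ x => (1 + ‖x‖ ^ 2) * heatConv ν 1 τ x)
      fun τ => ev (heatJet ν τ) f := by
  refine dominatedMoments_ev (fun τ hτ x => mul_nonneg (by positivity)
    (heatConv_one_pos ν (ha.trans_le hτ.1) x).le) ?_
    (fun s => dominatedMoments_heatRatio ν hν (hermite s) ha hab) f
  obtain ⟨D, hD, hb⟩ := exists_heatConv_bound ν hν 1 ha hab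
  exact ⟨D, hD, fun τ hτ x => (mul_le_mul_of_nonneg_left (le_abs_self _) (by positivity)).trans
    (hb τ hτ x)⟩

theorem contDiff_heatJet {τ : ℝ} (hτ : 0 < τ) (s : Multiset (Fin d)) :
    ContDiff ℝ ∞ (heatJet ν τ s) :=
  (contDiff_heatConv ν _ hτ).div (contDiff_heatConv ν 1 hτ) fun x => (heatConv_one_pos ν hτ x).ne'

theorem hermite_singleton (i : Fin d) : hermite {i} = eta i 1 := by
  rw [← Multiset.cons_zero, hermite_cons, hermite_zero]

theorem isJet_heatMeasure (hν : Integrable (fun y => ‖y‖ ^ 2) ν) {τ : ℝ} (hτ : 0 < τ) :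
    IsJet (heatMeasure ν τ) (heatJet ν τ) := by
  have hpos := heatConv_one_pos ν hτ
  have hρ := hasSmoothDensity_heatMeasure ν hτ
  refine ⟨⟨_, hρ, fun i x => ?_⟩, contDiff_heatJet ν hτ, fun i s x => ?_, fun s p => ?_⟩
  · rw [pd_heatConv ν i 1 hτ, heatJet, heatRatio, div_mul_cancel₀ _ (hpos x).ne', hermite_singleton]
  · have h1 : ∀ q : KernelPoly d, DifferentiableAt ℝ (heatConv ν q τ) x := fun q =>
      (contDiff_heatConv ν q hτ).differentiable (by simp) x
    have h2 : heatJet ν τ s = fun x => heatConv ν (hermite s) τ x * (heatConv ν 1 τ x)⁻¹ := by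
      ext x; rw [heatJet, heatRatio, div_eq_mul_inv]
    have h3 : DifferentiableAt ℝ (fun x => (heatConv ν 1 τ x)⁻¹) x := (h1 1).inv (hpos x).ne'
    rw [h2, pd_mul (h1 _) h3, pd_comp (h1 1) (hasDerivAt_inv (hpos x).ne'),
      pd_heatConv ν i _ hτ, pd_heatConv ν i _ hτ]
    simp only [heatJet, heatRatio, hermite_cons, hermite_singleton]
    have := (hpos x).ne'
    field_simp
    ring
  · rw [hρ.integrable_iff]
    obtain ⟨D, hD, hb⟩ := dominatedMoments_heatRatio ν hν (hermite s) hτ le_rfl p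
    refine hD.mono' (((contDiff_heatConv ν 1 hτ).continuous.mul
      ((contDiff_heatJet ν hτ s).continuous.abs.pow p)).aestronglyMeasurable)
      (Filter.Eventually.of_forall fun x => ?_)
    have h0 : 0 ≤ heatConv ν 1 τ x * |heatJet ν τ s x| ^ p :=
      mul_nonneg (hpos x).le (by positivity)
    rw [Real.norm_of_nonneg h0]
    refine le_trans ?_ (hb τ ⟨le_rfl, le_rfl⟩ x)
    rw [mul_assoc]
    exact le_mul_of_one_le_left h0 (by nlinarith [sq_nonneg ‖x‖])

end HeatMoments

/-! ### Jets of tame densities are regular -/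

section Regular

variable {d : ℕ} {μ : Measure (Euc d)} {r : Multiset (Fin d) → Euc d → ℝ}

theorem norm_le_sum_basis {k : ℕ} (f : ContinuousMultilinearMap ℝ (fun _ : Fin k => Euc d) ℝ) :
    ‖f‖ ≤ ∑ v : Fin k → Fin d, ‖f fun j => EuclideanSpace.single (v j) 1‖ := by
  refine ContinuousMultilinearMap.opNorm_le_bound (Finset.sum_nonneg fun v _ => norm_nonneg _)
    fun m => ?_
  have hm : m = fun j => ∑ i, m j i • (EuclideanSpace.single i 1 : Euc d) := by
    ext1 j
    have := (EuclideanSpace.basisFun (Fin d) ℝ).sum_repr (m j)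
    simpa using this.symm
  have h : f m = ∑ v : Fin k → Fin d, (∏ j, m j (v j)) * f fun j => EuclideanSpace.single (v j) 1 := by
    conv_lhs => rw [hm]
    rw [f.map_sum]
    exact Finset.sum_congr rfl fun v _ => f.map_smul_univ _ _
  rw [h, Finset.sum_mul]
  refine (norm_sum_le _ _).trans (Finset.sum_le_sum fun v _ => ?_)
  rw [norm_mul, mul_comm, norm_prod]
  exact mul_le_mul_of_nonneg_left (Finset.prod_le_prod (fun j _ => norm_nonneg _)
    fun j _ => PiLp.norm_apply_le _ _) (norm_nonneg _)

/-- From order one on, the entries of the derivatives of log ρ are evaluated symbols, so the moments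
of the jet control them. -/
theorem IsJet.exists_symbol (h : IsJet μ r) {U : Euc d → ℝ} (hU : ContDiff ℝ ∞ U)
    (hpd : ∀ i x, pd i U x = r {i} x) (k : ℕ) : ∀ v : Fin (k + 1) → Fin d, ∃ f : JetRing d,
      (fun x => iteratedFDeriv ℝ (k + 1) U x fun j => EuclideanSpace.single (v j) 1) = ev r f := by
  induction k with
  | zero =>
    refine fun v => ⟨score (v 0), funext fun x => ?_⟩
    rw [score, ev_X, ← hpd, iteratedFDeriv_one_apply, pd]
  | succ k ih =>
    intro v
    obtain ⟨f, hf⟩ := ih (Fin.tail v)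
    refine ⟨del (v 0) f, funext fun x => ?_⟩
    rw [← pd_ev h.smooth h.pd_eq, ← hf, pd_iteratedFDeriv hU]
    congr 1
    ext1 j
    refine Fin.cases ?_ (fun j => ?_) j <;> rfl

theorem IsJet.memLp_ev_nnreal [IsProbabilityMeasure μ] (h : IsJet μ r) (f : JetRing d)
    (p : NNReal) : MemLp (ev r f) p μ := by
  obtain ⟨n, hn⟩ := exists_nat_ge p
  have hc := (contDiff_ev h.smooth f).continuous.aestronglyMeasurable (μ := μ)
  have h1 : MemLp (ev r f) ((n + 1 : ℕ) : ENNReal) μ := by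
    rw [← integrable_norm_rpow_iff hc (by simp) (by simp)]
    simp only [ENNReal.toReal_natCast, Real.rpow_natCast, Real.norm_eq_abs]
    exact h.integrable_ev_pow f (n + 1)
  refine h1.mono_exponent ?_
  have : (p : ENNReal) ≤ ((n : NNReal) : ENNReal) := ENNReal.coe_le_coe.2 hn
  refine this.trans ?_
  simp

/-- Probability measures with a jet are regular. -/
theorem IsJet.isRegular [IsProbabilityMeasure μ] (h : IsJet μ r) : IsRegular μ := by
  obtain ⟨ρ, hρ, hL⟩ := h.exists_density
  have hU : ContDiff ℝ ∞ fun x => Real.log (ρ x) := hρ.smooth.log fun x => (hρ.pos x).ne'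
  have hpd : ∀ i x, pd i (fun x => Real.log (ρ x)) x = r {i} x := by
    intro i x
    rw [pd_comp (hρ.smooth.differentiable (by simp) x) (Real.hasDerivAt_log (hρ.pos x).ne'), hL]
    have := (hρ.pos x).ne'
    field_simp
  refine ⟨_, hU, ?_, fun k hk p => ?_⟩
  · rw [hρ.eq]
    congr 1
    ext1 x
    rw [Real.exp_log (hρ.pos x)]
  · obtain ⟨k, rfl⟩ : ∃ m, k = m + 1 := ⟨k - 1, by omega⟩
    have hc : Continuous (iteratedFDeriv ℝ (k + 1) fun x => Real.log (ρ x)) :=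
      hU.continuous_iteratedFDeriv (by exact_mod_cast le_top)
    have hsum : MemLp (fun x => ∑ v : Fin (k + 1) → Fin d,
        ‖iteratedFDeriv ℝ (k + 1) (fun x => Real.log (ρ x)) x fun j =>
          EuclideanSpace.single (v j) 1‖) p μ := by
      refine memLp_finsetSum _ fun v _ => ?_
      obtain ⟨f, hf⟩ := h.exists_symbol hU hpd k v
      have := (h.memLp_ev_nnreal f p).norm
      rw [← hf] at this
      exact this
    refine hsum.mono hc.aestronglyMeasurable (Filter.Eventually.of_forall fun x => ?_)
    rw [Real.norm_of_nonneg (Finset.sum_nonneg fun v _ => norm_nonneg _)]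
    exact norm_le_sum_basis _

/-- Integration by parts for the second time derivative of the density. -/
theorem IsJet.integral_lapX_mul [IsProbabilityMeasure μ] (h : IsJet μ r) (f : JetRing d) :
    ∫ x, ev r (delT f + lapX * f) x ∂μ = ∫ x, ev r (mat f) x ∂μ := by
  obtain ⟨ρ, hρ, hL⟩ := h.exists_density
  -- The two integrands differ by the divergence with respect to μ of the field f · ∇ log ρ.
  have hs : ∀ x, ∑ i, (pd i (ev r (f * score i)) x + ev r (f * score i) x * r {i} x) =
      ev r (delT f + lapX * f) x - ev r (mat f) x := by
    intro x
    have h1 : ∀ i, pd i (ev r (f * score i)) x + ev r (f * score i) x * r {i} x =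
        ev r (del i (f * score i) + f * score i * score i) x := by
      intro i
      rw [pd_ev h.smooth h.pd_eq, ev_add]
      simp only [score, ev_mul, ev_X]
    simp only [h1]
    rw [← ev_sum, ← ev_sub]
    congr 1
    rw [mat_apply, lapX_eq, add_sub_sub_cancel, add_comm, Finset.sum_mul, ← Finset.sum_add_distrib]
    refine Finset.sum_congr rfl fun i _ => ?_
    rw [Derivation.leibniz, smul_eq_mul, smul_eq_mul, hess]
    ring
  have := hρ.integral_divergence_eq_zero (L := fun i => r {i}) hL
    (V := fun i => ev r (f * score i)) (fun i => (contDiff_ev h.smooth _).of_le (by simp))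
    (fun i => h.integrable_ev _)
    (by simp only [hs]; exact (h.integrable_ev _).sub (h.integrable_ev _))
  simp only [hs] at this
  rw [integral_sub (h.integrable_ev _) (h.integrable_ev _), sub_eq_zero] at this
  exact this

end Regular

/-! ### Time derivatives along the heat flow -/

section TimeDerivative

variable {d : ℕ} (ν : Measure (Euc d)) [IsProbabilityMeasure ν]

theorem heatConv_etaT_hermite {τ : ℝ} (hτ : 0 < τ) (s : Multiset (Fin d)) (x : Euc d) :
    heatConv ν (etaT (hermite s)) τ x =
      heatConv ν 1 τ x * ∑ k, heatJet ν τ (k ::ₘ k ::ₘ s) x := by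
  rw [etaT_hermite, heatConv_sum ν _ _ hτ, Finset.mul_sum]
  refine Finset.sum_congr rfl fun k _ => ?_
  rw [heatJet, heatRatio, mul_div_cancel₀ _ (heatConv_one_pos ν hτ x).ne']

theorem ev_lapX (r : Multiset (Fin d) → Euc d → ℝ) (x : Euc d) :
    ev r lapX x = ∑ k, r {k, k} x := by
  rw [lapX, ev_sum]
  simp only [ev_X]

theorem hasDerivAt_heatConv_one {τ : ℝ} (hτ : 0 < τ) (x : Euc d) :
    HasDerivAt (fun τ => heatConv ν 1 τ x) (heatConv ν 1 τ x * ev (heatJet ν τ) lapX x) τ := by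
  have h := hasDerivAt_heatConv ν 1 hτ x
  have h2 := heatConv_etaT_hermite ν hτ 0 x
  rw [hermite_zero] at h2
  have h3 : ev (heatJet ν τ) lapX x = ∑ k, heatJet ν τ (k ::ₘ k ::ₘ 0) x := ev_lapX _ _
  rwa [h2, ← h3] at h

theorem hasDerivAt_heatJet {τ : ℝ} (hτ : 0 < τ) (s : Multiset (Fin d)) (x : Euc d) :
    HasDerivAt (fun τ => heatJet ν τ s x) (ev (heatJet ν τ) (delT (MvPolynomial.X s)) x) τ := by
  have hpos := (heatConv_one_pos ν hτ x).ne'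
  have h := (hasDerivAt_heatConv ν (hermite s) hτ x).div (hasDerivAt_heatConv_one ν hτ x) hpos
  convert! h using 1
  rw [delT_X, ev_sub, ev_sum, ev_mul, heatConv_etaT_hermite ν hτ]
  simp only [ev_X]
  rw [heatJet, heatRatio]
  field_simp

theorem hasDerivAt_ev_heatJet {τ : ℝ} (hτ : 0 < τ) (f : JetRing d) (x : Euc d) :
    HasDerivAt (fun τ => ev (heatJet ν τ) f x) (ev (heatJet ν τ) (delT f) x) τ := by
  induction f using MvPolynomial.induction_on with
  | C c =>
    have h2 : delT (MvPolynomial.C c : JetRing d) = MvPolynomial.C 0 := by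
      rw [← MvPolynomial.algebraMap_eq, Derivation.map_algebraMap, map_zero]
    simp only [ev_C, h2]
    exact hasDerivAt_const _ _
  | add f g hf hg =>
    simp only [ev_add, map_add]
    exact hf.add hg
  | mul_X f s hf =>
    rw [Derivation.leibniz, ev_add, smul_eq_mul, smul_eq_mul, ev_mul, ev_mul]
    simp only [ev_mul]
    have h := hf.mul (hasDerivAt_heatJet ν hτ s x)
    simp only [ev_X] at h ⊢
    convert! h using 1
    ring

theorem integral_heatMeasure {τ : ℝ} (hτ : 0 < τ) (f : Euc d → ℝ) :
    ∫ x, f x ∂heatMeasure ν τ = ∫ x, heatConv ν 1 τ x * f x :=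
  (hasSmoothDensity_heatMeasure ν hτ).integral_eq f

variable {ν}

/-- The derivative of the mean of a symbol along the heat flow. -/
theorem hasDerivAt_integral_ev (hν : Integrable (fun y => ‖y‖ ^ 2) ν) {τ : ℝ} (hτ : 0 < τ)
    (f : JetRing d) :
    HasDerivAt (fun τ => ∫ x, ev (heatJet ν τ) f x ∂heatMeasure ν τ)
      (∫ x, ev (heatJet ν τ) (mat f) x ∂heatMeasure ν τ) τ := by
  have hJ := isJet_heatMeasure ν hν hτ
  have := isProbabilityMeasure_heatMeasure ν hτ
  have ha : 0 < τ / 2 := by positivity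
  -- Since ∂_t (ρ f) = ρ (∂_t f + f Δρ/ρ), the first absolute moment of this symbol dominates the
  -- derivative under the integral.
  obtain ⟨D, hD, hb⟩ := dominatedMoments_ev_heatJet ν hν (delT f + lapX * f) ha
    (by linarith : τ / 2 ≤ 2 * τ) 1
  have hmem : Icc (τ / 2) (2 * τ) ∈ nhds τ := Icc_mem_nhds (by linarith) (by linarith)
  have hc : ∀ {t : ℝ}, 0 < t → ∀ g : JetRing d,
      Continuous fun x => heatConv ν 1 t x * ev (heatJet ν t) g x := fun ht g =>
    (contDiff_heatConv ν 1 ht).continuous.mul (contDiff_ev (contDiff_heatJet ν ht) g).continuous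
  have key := (hasDerivAt_integral_of_dominated_loc_of_deriv_le (μ := volume) (x₀ := τ)
    (F := fun t x => heatConv ν 1 t x * ev (heatJet ν t) f x)
    (F' := fun t x => heatConv ν 1 t x * ev (heatJet ν t) (delT f + lapX * f) x) hmem
    (by
      filter_upwards [hmem] with t ht
      exact (hc (ha.trans_le ht.1) f).aestronglyMeasurable)
    ((hasSmoothDensity_heatMeasure ν hτ).integrable_iff.1 (hJ.integrable_ev f))
    (hc hτ _).aestronglyMeasurable
    (Filter.Eventually.of_forall fun x t ht => ?_) hD
    (Filter.Eventually.of_forall fun x t ht => ?_)).2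
  · rw [← integral_heatMeasure ν hτ, hJ.integral_lapX_mul] at key
    refine key.congr_of_eventuallyEq ?_
    filter_upwards [hmem] with t ht
    exact integral_heatMeasure ν (ha.trans_le ht.1) _
  · have hpos := heatConv_one_pos ν (ha.trans_le ht.1) x
    refine le_trans ?_ (hb t ht x)
    rw [Real.norm_eq_abs, abs_mul, abs_of_pos hpos, pow_one]
    refine mul_le_mul_of_nonneg_right ?_ (abs_nonneg _)
    exact le_mul_of_one_le_left hpos.le (by nlinarith [sq_nonneg ‖x‖])
  · have h := (hasDerivAt_heatConv_one ν (ha.trans_le ht.1) x).mul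
      (hasDerivAt_ev_heatJet ν (ha.trans_le ht.1) f x)
    convert! h using 1
    rw [ev_add, ev_mul]
    ring

end TimeDerivative

/-! ### The entropy along the heat flow -/

section Entropy

variable {d : ℕ}

theorem HasSmoothDensity.log_rnDeriv {μ : Measure (Euc d)} {ρ : Euc d → ℝ}
    (h : HasSmoothDensity μ ρ) :
    (fun x => Real.log (μ.rnDeriv volume x).toReal) =ᵐ[μ] fun x => Real.log (ρ x) := by
  have hac : μ ≪ volume := by
    rw [h.eq]; exact withDensity_absolutelyContinuous _ _
  have h1 : μ.rnDeriv volume =ᵐ[volume] fun x => ENNReal.ofReal (ρ x) := by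
    conv_lhs => rw [h.eq]
    exact Measure.rnDeriv_withDensity volume h.smooth.continuous.measurable.ennreal_ofReal
  filter_upwards [hac.ae_eq h1] with x hx
  rw [hx, ENNReal.toReal_ofReal (h.pos x).le]

variable (ν : Measure (Euc d)) [IsProbabilityMeasure ν]

/-- Above, the kernel is bounded. Below, |x - y|² ≤ 2|x|² + 2|y|² lets a Gaussian factor in x leave
the integral, and a positive constant `c₀` remains. The quadratic growth is the reason for the
weight 1 + |x|² in the moment bounds. -/
theorem exists_abs_log_heatConv_le {a b : ℝ} (ha : 0 < a) (hab : a ≤ b) :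
    ∃ K, 0 ≤ K ∧ ∀ τ ∈ Icc a b, ∀ x, |Real.log (heatConv ν 1 τ x)| ≤ K * (1 + ‖x‖ ^ 2) := by
  obtain ⟨C, hC⟩ := kernel_bounded (d := d) 1 ha hab
  have hb0 : 0 < b := ha.trans_le hab
  set A : ℝ := (d / 2 : ℝ) * Real.log (4 * Real.pi * b) with hA
  set B : ℝ := 1 / (4 * a) with hB
  have hB0 : 0 < B := by positivity
  have hgint : Integrable (fun y => Real.exp (-(2 * B) * ‖y‖ ^ 2)) ν := by
    refine Integrable.of_bound (by fun_prop) 1 (Filter.Eventually.of_forall fun y => ?_)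
    rw [Real.norm_of_nonneg (Real.exp_pos _).le, Real.exp_le_one_iff]
    nlinarith [sq_nonneg ‖y‖]
  set c₀ : ℝ := ∫ y, Real.exp (-(2 * B) * ‖y‖ ^ 2) ∂ν with hc₀
  have hc0 : 0 < c₀ := integral_exp_pos hgint
  refine ⟨|A| + 2 * B + |Real.log c₀| + |Real.log C|, by positivity, fun τ hτ x => ?_⟩
  have hτ0 : 0 < τ := ha.trans_le hτ.1
  have hpi := Real.pi_pos
  have hpos := heatConv_one_pos ν hτ0 x
  have hx : 0 ≤ ‖x‖ ^ 2 := sq_nonneg _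
  have hup : Real.log (heatConv ν 1 τ x) ≤ |Real.log C| := by
    refine (Real.log_le_log hpos ?_).trans (le_abs_self _)
    have h1 : heatConv ν 1 τ x ≤ ∫ _, C ∂ν :=
      integral_mono (integrable_kernel ν 1 hτ0 x) (integrable_const _) fun y =>
        (le_abs_self _).trans (hC τ hτ _)
    simpa using h1
  have hlow : -A - 2 * B * ‖x‖ ^ 2 + Real.log c₀ ≤ Real.log (heatConv ν 1 τ x) := by
    rw [← Real.log_exp (-A - 2 * B * ‖x‖ ^ 2), ← Real.log_mul (Real.exp_pos _).ne' hc0.ne']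
    refine Real.log_le_log (mul_pos (Real.exp_pos _) hc0) ?_
    rw [hc₀, ← integral_const_mul]
    refine integral_mono (hgint.const_mul _) (integrable_kernel ν 1 hτ0 x) fun y => ?_
    change Real.exp _ * Real.exp _ ≤ kernel 1 τ (x - y)
    rw [kernel_one_eq, heatKernel, ← Real.exp_add, Real.exp_le_exp]
    have h1 : (d / 2 : ℝ) * Real.log (4 * Real.pi * τ) ≤ A := by
      rw [hA]
      have := hτ.2
      gcongr
    have h2 : ‖x - y‖ ^ 2 / (4 * τ) ≤ B * (2 * ‖x‖ ^ 2 + 2 * ‖y‖ ^ 2) := by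
      have h3 : ‖x - y‖ ^ 2 ≤ 2 * ‖x‖ ^ 2 + 2 * ‖y‖ ^ 2 := by
        have := pow_le_pow_left₀ (norm_nonneg _) (norm_sub_le x y) 2
        nlinarith [sq_nonneg (‖x‖ - ‖y‖)]
      have h4 : (4 * τ)⁻¹ ≤ B := by
        rw [hB, one_div]
        exact inv_anti₀ (by positivity) (by linarith [hτ.1])
      rw [div_eq_inv_mul]
      exact mul_le_mul h4 h3 (sq_nonneg _) hB0.le
    nlinarith
  have e1 := abs_nonneg A
  have e2 := abs_nonneg (Real.log c₀)
  have e3 := abs_nonneg (Real.log C)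
  have hK : |A| + 2 * B * ‖x‖ ^ 2 + |Real.log c₀| + |Real.log C| ≤
      (|A| + 2 * B + |Real.log c₀| + |Real.log C|) * (1 + ‖x‖ ^ 2) := by
    nlinarith [mul_nonneg e1 hx, mul_nonneg e2 hx, mul_nonneg e3 hx]
  refine le_trans (abs_le.2 ⟨?_, ?_⟩) hK
  · have := le_abs_self A
    have := neg_abs_le (Real.log c₀)
    linarith
  · have := mul_nonneg hB0.le hx
    linarith

theorem contDiff_log_heatConv {τ : ℝ} (hτ : 0 < τ) :
    ContDiff ℝ ∞ fun x => Real.log (heatConv ν 1 τ x) :=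
  (contDiff_heatConv ν 1 hτ).log fun x => (heatConv_one_pos ν hτ x).ne'

variable {ν}

theorem integrable_log_heatConv_mul (hν : Integrable (fun y => ‖y‖ ^ 2) ν) {τ : ℝ} (hτ : 0 < τ)
    (f : JetRing d) : Integrable (fun x => Real.log (heatConv ν 1 τ x) * ev (heatJet ν τ) f x)
      (heatMeasure ν τ) := by
  obtain ⟨K, hK, hlog⟩ := exists_abs_log_heatConv_le ν hτ le_rfl
  obtain ⟨D, hD, hb⟩ := dominatedMoments_ev_heatJet ν hν f hτ le_rfl 1
  rw [(hasSmoothDensity_heatMeasure ν hτ).integrable_iff]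
  refine (hD.const_mul K).mono' ((contDiff_heatConv ν 1 hτ).continuous.mul
    ((contDiff_log_heatConv ν hτ).continuous.mul
      (contDiff_ev (contDiff_heatJet ν hτ) f).continuous)).aestronglyMeasurable
    (Filter.Eventually.of_forall fun x => ?_)
  have hpos := heatConv_one_pos ν hτ x
  have h1 := hlog τ ⟨le_rfl, le_rfl⟩ x
  have h2 := hb τ ⟨le_rfl, le_rfl⟩ x
  rw [Real.norm_eq_abs, abs_mul, abs_mul, abs_of_pos hpos]
  rw [pow_one] at h2
  calc heatConv ν 1 τ x * (|Real.log (heatConv ν 1 τ x)| * |ev (heatJet ν τ) f x|)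
      ≤ heatConv ν 1 τ x * ((K * (1 + ‖x‖ ^ 2)) * |ev (heatJet ν τ) f x|) := by gcongr
    _ = K * ((1 + ‖x‖ ^ 2) * heatConv ν 1 τ x * |ev (heatJet ν τ) f x|) := by ring
    _ ≤ K * D x := mul_le_mul_of_nonneg_left h2 hK

theorem integrable_log_heatConv (hν : Integrable (fun y => ‖y‖ ^ 2) ν) {τ : ℝ} (hτ : 0 < τ) :
    Integrable (fun x => Real.log (heatConv ν 1 τ x)) (heatMeasure ν τ) := by
  have h := integrable_log_heatConv_mul hν hτ (MvPolynomial.C 1)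
  simpa only [ev_C, mul_one] using h

theorem pd_log_heatConv {τ : ℝ} (hτ : 0 < τ) (i : Fin d) (x : Euc d) :
    pd i (fun x => Real.log (heatConv ν 1 τ x)) x = heatJet ν τ {i} x := by
  have hpos := (heatConv_one_pos ν hτ x).ne'
  rw [pd_comp ((contDiff_heatConv ν 1 hτ).differentiable (by simp) x) (Real.hasDerivAt_log hpos),
    pd_heatConv ν i 1 hτ, heatJet, heatRatio, hermite_singleton, div_eq_inv_mul]

/-- Integration by parts for the derivative of the entropy. -/
theorem integral_lapX_mul_log (hν : Integrable (fun y => ‖y‖ ^ 2) ν) {τ : ℝ} (hτ : 0 < τ) :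
    ∫ x, ev (heatJet ν τ) lapX x * (1 + Real.log (heatConv ν 1 τ x)) ∂heatMeasure ν τ =
      - ∫ x, ev (heatJet ν τ) (∑ k, score k * score k) x ∂heatMeasure ν τ := by
  have hJ := isJet_heatMeasure ν hν hτ
  have := isProbabilityMeasure_heatMeasure ν hτ
  have hρ := hasSmoothDensity_heatMeasure ν hτ
  have hl := contDiff_log_heatConv ν hτ
  have hint : ∀ f : JetRing d, Integrable (fun x => ev (heatJet ν τ) f x *
      (1 + Real.log (heatConv ν 1 τ x))) (heatMeasure ν τ) := by
    intro f
    refine ((hJ.integrable_ev f).add (integrable_log_heatConv_mul hν hτ f)).congr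
      (Filter.Eventually.of_forall fun x => ?_)
    simp only [Pi.add_apply]
    ring
  -- The divergence of (1 + log ρ) ∇ log ρ with respect to μ: the derivative of the scalar factor
  -- contributes |∇ log ρ|².
  have hs : ∀ x, ∑ i, (pd i (fun x => ev (heatJet ν τ) (score i) x *
        (1 + Real.log (heatConv ν 1 τ x))) x +
      ev (heatJet ν τ) (score i) x * (1 + Real.log (heatConv ν 1 τ x)) * heatJet ν τ {i} x) =
      ev (heatJet ν τ) lapX x * (1 + Real.log (heatConv ν 1 τ x)) +
        ev (heatJet ν τ) (∑ k, score k * score k) x := by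
    intro x
    have hld : DifferentiableAt ℝ (fun x => Real.log (heatConv ν 1 τ x)) x :=
      hl.differentiable (by simp) x
    have hld' : DifferentiableAt ℝ (fun x => 1 + Real.log (heatConv ν 1 τ x)) x :=
      (differentiableAt_const _).add hld
    have h1 : ∀ i, pd i (fun x => ev (heatJet ν τ) (score i) x *
        (1 + Real.log (heatConv ν 1 τ x))) x +
      ev (heatJet ν τ) (score i) x * (1 + Real.log (heatConv ν 1 τ x)) * heatJet ν τ {i} x =
        ev (heatJet ν τ) (hess i i + score i * score i) x * (1 + Real.log (heatConv ν 1 τ x)) +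
          ev (heatJet ν τ) (score i * score i) x := by
      intro i
      rw [pd_mul ((contDiff_ev hJ.smooth _).differentiable (by simp) x)
        hld', pd_add (differentiableAt_const _) hld, pd_const,
        pd_log_heatConv hτ, pd_ev hJ.smooth hJ.pd_eq, ev_add, ev_mul, hess]
      simp only [score, ev_X]
      ring
    simp only [h1]
    rw [Finset.sum_add_distrib, ← Finset.sum_mul, ← ev_sum, ← ev_sum, lapX_eq]
  have h := hρ.integral_divergence_eq_zero (L := fun i => heatJet ν τ {i})
    (fun i x => by
      rw [pd_heatConv ν i 1 hτ, heatJet, heatRatio,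
        div_mul_cancel₀ _ (heatConv_one_pos ν hτ x).ne', hermite_singleton])
    (V := fun i x => ev (heatJet ν τ) (score i) x * (1 + Real.log (heatConv ν 1 τ x)))
    (fun i => ((contDiff_ev hJ.smooth _).mul (contDiff_const.add hl)).of_le (by simp))
    (fun i => hint _)
    (by simp only [hs]; exact (hint _).add (hJ.integrable_ev _))
  simp only [hs] at h
  rw [integral_add (hint _) (hJ.integrable_ev _)] at h
  linarith

theorem entropy_heatMeasure {τ : ℝ} (hτ : 0 < τ) :
    entropy (heatMeasure ν τ) = ∫ x, heatConv ν 1 τ x * Real.log (heatConv ν 1 τ x) := by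
  rw [entropy, integral_congr_ae (hasSmoothDensity_heatMeasure ν hτ).log_rnDeriv,
    integral_heatMeasure ν hτ]

/-- De Bruijn's identity. -/
theorem hasDerivAt_entropy (hν : Integrable (fun y => ‖y‖ ^ 2) ν) {τ : ℝ} (hτ : 0 < τ) :
    HasDerivAt (fun τ => entropy (heatMeasure ν τ))
      (- ∫ x, ev (heatJet ν τ) (∑ k, score k * score k) x ∂heatMeasure ν τ) τ := by
  have ha : 0 < τ / 2 := by positivity
  have hab : τ / 2 ≤ 2 * τ := by linarith
  obtain ⟨K, hK, hlog⟩ := exists_abs_log_heatConv_le ν ha hab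
  obtain ⟨D, hD, hb⟩ := dominatedMoments_ev_heatJet ν hν lapX ha hab 1
  have hmem : Icc (τ / 2) (2 * τ) ∈ nhds τ := Icc_mem_nhds (by linarith) (by linarith)
  have hc : ∀ {t : ℝ}, 0 < t → Continuous fun x => heatConv ν 1 t x * Real.log (heatConv ν 1 t x) :=
    fun ht => (contDiff_heatConv ν 1 ht).continuous.mul (contDiff_log_heatConv ν ht).continuous
  have key := (hasDerivAt_integral_of_dominated_loc_of_deriv_le (μ := volume) (x₀ := τ)
    (F := fun t x => heatConv ν 1 t x * Real.log (heatConv ν 1 t x))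
    (F' := fun t x => heatConv ν 1 t x * (ev (heatJet ν t) lapX x *
      (1 + Real.log (heatConv ν 1 t x)))) (bound := fun x => (1 + K) * D x) hmem
    (by
      filter_upwards [hmem] with t ht
      exact (hc (ha.trans_le ht.1)).aestronglyMeasurable)
    ((hasSmoothDensity_heatMeasure ν hτ).integrable_iff.1 (integrable_log_heatConv hν hτ))
    ((contDiff_heatConv ν 1 hτ).continuous.mul ((contDiff_ev (contDiff_heatJet ν hτ) lapX).continuous.mul
      (continuous_const.add (contDiff_log_heatConv ν hτ).continuous))).aestronglyMeasurable
    (Filter.Eventually.of_forall fun x t ht => ?_) (hD.const_mul _)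
    (Filter.Eventually.of_forall fun x t ht => ?_)).2
  · rw [← integral_heatMeasure ν hτ, integral_lapX_mul_log hν hτ] at key
    refine key.congr_of_eventuallyEq ?_
    filter_upwards [hmem] with t ht
    exact entropy_heatMeasure (ha.trans_le ht.1)
  · have hpos := heatConv_one_pos ν (ha.trans_le ht.1) x
    have h1 := hlog t ht x
    have h2 := hb t ht x
    rw [pow_one] at h2
    have h3 : |1 + Real.log (heatConv ν 1 t x)| ≤ (1 + K) * (1 + ‖x‖ ^ 2) := by
      refine (abs_add_le _ _).trans ?_
      rw [abs_one]
      nlinarith [sq_nonneg ‖x‖]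
    rw [Real.norm_eq_abs, abs_mul, abs_mul, abs_of_pos hpos]
    calc heatConv ν 1 t x * (|ev (heatJet ν t) lapX x| * |1 + Real.log (heatConv ν 1 t x)|)
        ≤ heatConv ν 1 t x * (|ev (heatJet ν t) lapX x| * ((1 + K) * (1 + ‖x‖ ^ 2))) := by gcongr
      _ = (1 + K) * ((1 + ‖x‖ ^ 2) * heatConv ν 1 t x * |ev (heatJet ν t) lapX x|) := by ring
      _ ≤ (1 + K) * D x := mul_le_mul_of_nonneg_left h2 (by positivity)
  · have hpos := heatConv_one_pos ν (ha.trans_le ht.1) x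
    have h0 := hasDerivAt_heatConv_one ν (ha.trans_le ht.1) x
    have h := h0.mul (h0.log hpos.ne')
    convert! h using 1
    field_simp
    ring

end Entropy

/-! ### Values of the forests along the heat flow -/

section Forests

variable {d : ℕ} {ν : Measure (Euc d)} [IsProbabilityMeasure ν]

theorem isTree_of_mem_gradForest (n : ℕ) : ∀ T ∈ gradForest n, T.1 = n + 1 ∧ T.2.IsTree := by
  induction n with
  | zero =>
    intro T hT
    rw [gradForest, Multiset.mem_singleton] at hT
    subst hT
    exact ⟨rfl, SimpleGraph.IsTree.of_subsingleton⟩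
  | succ n ih =>
    intro T hT
    rw [gradForest, Multiset.mem_bind] at hT
    obtain ⟨S, hS, hT⟩ := hT
    obtain ⟨x, -, rfl⟩ := Multiset.mem_map.1 hT
    exact ⟨by simp [(ih S hS).1], addLeaf_isTree (ih S hS).2 x⟩

/-- Any edge of T remains an edge of every `addLeaf T x`, so one edge computes the values of T and
of all its extensions, and `mat_edgeSymbol` applies. The condition 2 ≤ m provides that edge. -/
theorem hasDerivAt_treeVal (hν : Integrable (fun y => ‖y‖ ^ 2) ν) {τ : ℝ} (hτ : 0 < τ) {m : ℕ}
    (hm : 2 ≤ m) {T : SimpleGraph (Fin m)} (hT : T.IsTree) :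
    HasDerivAt (fun τ => treeVal (heatMeasure ν τ) T)
      (- ∑ x, treeVal (heatMeasure ν τ) (addLeaf T x)) τ := by
  have : Nontrivial (Fin m) := Fin.nontrivial_iff_two_le.2 hm
  have : Nontrivial (Fin (m + 1)) := Fin.nontrivial_iff_two_le.2 (by omega)
  obtain ⟨v, huv⟩ := exists_adj hT ⟨0, by omega⟩
  have hval : ∀ {t : ℝ}, 0 < t → ∀ {k : ℕ} [Nontrivial (Fin k)] {G : SimpleGraph (Fin k)},
      G.IsTree → ∀ {a b}, G.Adj a b → treeVal (heatMeasure ν t) G =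
        ∫ x, ev (heatJet ν t) (edgeSymbol d G a b) x ∂heatMeasure ν t := by
    intro t ht k _ G hG a b hab
    have := isProbabilityMeasure_heatMeasure ν ht
    exact (isJet_heatMeasure ν hν ht).treeVal_eq hG hab
  have h := hasDerivAt_integral_ev hν hτ (edgeSymbol d T ⟨0, by omega⟩ v)
  have hP := isProbabilityMeasure_heatMeasure ν hτ
  rw [mat_edgeSymbol hT huv] at h
  simp only [ev_neg, ev_sum] at h
  rw [integral_neg, integral_finsetSum _ fun x _ => (isJet_heatMeasure ν hν hτ).integrable_ev _] at h
  have heq : ∀ x, ∫ y, ev (heatJet ν τ) (edgeSymbol d (addLeaf T x) (Fin.castSucc ⟨0, by omega⟩)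
      v.castSucc) y ∂heatMeasure ν τ = treeVal (heatMeasure ν τ) (addLeaf T x) :=
    fun x => (hval hτ (addLeaf_isTree hT x) (addLeaf_adj.2 huv)).symm
  simp only [heq] at h
  refine h.congr_of_eventuallyEq ?_
  filter_upwards [Ioi_mem_nhds hτ] with t ht
  exact hval ht hT huv

theorem forestVal_bind (μ : Measure (Euc d)) (F : Forest)
    (g : (Σ m : ℕ, SimpleGraph (Fin m)) → Forest) :
    forestVal μ (F.bind g) = (F.map fun T => forestVal μ (g T)).sum := by
  simp only [forestVal, Multiset.map_bind, Multiset.sum_bind]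

theorem HasDerivAt.multiset_sum {α : Type*} (F : Multiset α) {f : α → ℝ → ℝ} {f' : α → ℝ} {t : ℝ}
    (h : ∀ a ∈ F, HasDerivAt (f a) (f' a) t) :
    HasDerivAt (fun s => (F.map fun a => f a s).sum) (F.map f').sum t := by
  induction F using Multiset.induction_on with
  | empty => simpa using hasDerivAt_const t (0 : ℝ)
  | cons a F ih =>
    simp only [Multiset.map_cons, Multiset.sum_cons]
    exact (h a (Multiset.mem_cons_self a F)).add
      (ih fun b hb => h b (Multiset.mem_cons_of_mem hb))

theorem hasDerivAt_forestVal (hν : Integrable (fun y => ‖y‖ ^ 2) ν) {τ : ℝ} (hτ : 0 < τ) {n : ℕ}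
    (hn : 1 ≤ n) : HasDerivAt (fun τ => forestVal (heatMeasure ν τ) (gradForest n))
      (- forestVal (heatMeasure ν τ) (gradForest (n + 1))) τ := by
  have h := HasDerivAt.multiset_sum (gradForest n)
    (f := fun T t => treeVal (heatMeasure ν t) T.2)
    (f' := fun T => - ∑ x, treeVal (heatMeasure ν τ) (addLeaf T.2 x)) (t := τ) fun T hT => by
      obtain ⟨h1, h2⟩ := isTree_of_mem_gradForest n T hT
      exact hasDerivAt_treeVal hν hτ (by omega) h2
  convert! h using 1
  rw [gradForest, forestVal_bind, Multiset.sum_map_neg]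
  congr 2
  refine Multiset.map_congr rfl fun T _ => ?_
  simp only [forestVal, Multiset.map_map]
  rfl

theorem branch_addLeaf_bot : branch d (addLeaf (⊥ : SimpleGraph (Fin 1)) 0) (Fin.castSucc 0)
    (Fin.last 1) = score := by
  classical
  have hT : (⊥ : SimpleGraph (Fin 1)).IsTree := SimpleGraph.IsTree.of_subsingleton
  rw [branch_eq (addLeaf_isTree hT 0) (addLeaf_adj_last.2 rfl)]
  have : IsEmpty {w // (addLeaf (⊥ : SimpleGraph (Fin 1)) 0).Adj (Fin.castSucc 0) w ∧
      w ≠ Fin.last 1} := by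
    refine ⟨fun ⟨w, hw, hwl⟩ => ?_⟩
    induction w using Fin.lastCases with
    | last => exact hwl rfl
    | cast w => exact (addLeaf_adj.1 hw)
  exact contr_isEmpty _

/-- The tree is a single edge and both of its branches are leaves, so its value is the Fisher
information. -/
theorem forestVal_gradForest_one (hν : Integrable (fun y => ‖y‖ ^ 2) ν) {τ : ℝ} (hτ : 0 < τ) :
    forestVal (heatMeasure ν τ) (gradForest 1) =
      ∫ x, ev (heatJet ν τ) (∑ k, score k * score k) x ∂heatMeasure ν τ := by
  have hT : (⊥ : SimpleGraph (Fin 1)).IsTree := SimpleGraph.IsTree.of_subsingleton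
  have := isProbabilityMeasure_heatMeasure ν hτ
  have h := (isJet_heatMeasure ν hν hτ).treeVal_eq (addLeaf_isTree hT 0)
    (addLeaf_adj_last.2 rfl : (addLeaf (⊥ : SimpleGraph (Fin 1)) 0).Adj (Fin.castSucc 0) (Fin.last 1))
  rw [edgeVal, edgeSymbol, branch_addLeaf_bot, branch_addLeaf_last hT] at h
  rw [← h]
  simp [forestVal, gradForest]

end Forests

/-! ### Uniqueness of the heat flow -/

section Uniqueness

variable {d : ℕ}

theorem laplacian_eq_sum_pd {f : Euc d → ℝ} (hf : ContDiff ℝ ∞ f) (x : Euc d) :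
    Laplacian.laplacian f x = ∑ i, pd i (pd i f) x := by
  rw [InnerProductSpace.laplacian_eq_iteratedFDeriv_orthonormalBasis f
    (EuclideanSpace.basisFun (Fin d) ℝ)]
  refine Finset.sum_congr rfl fun i _ => ?_
  rw [iteratedFDeriv_two_apply, pd_pd_eq hf]
  simp

variable {I : Set ℝ} {μ : ℝ → Measure (Euc d)}

/-- Along a heat flow, the means of bounded eigenfunctions of the Laplacian decay exponentially. -/
theorem IsHeatFlow.exp_mul_integral_eq (h : IsHeatFlow I μ) (hI : I.OrdConnected)
    {g : Euc d → ℝ} (hg : ContDiff ℝ ∞ g) (hg1 : ∀ x, |g x| ≤ 1) {M : ℝ}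
    (hgM : ∀ i x, |pd i g x| ≤ M) {l : ℝ} (hl : 0 ≤ l)
    (hgl : ∀ x, ∑ i, pd i (pd i g) x = -l * g x) {s t : ℝ} (hs : s ∈ I) (ht : t ∈ I)
    (hst : s ≤ t) :
    Real.exp (l * t) * ∫ x, g x ∂μ t = Real.exp (l * s) * ∫ x, g x ∂μ s := by
  obtain ⟨χ, C, hC0, hχs, hχc, hχ1, hχe, hχd, hχd2⟩ := exists_cutoff d
  set φ : ℕ → Euc d → ℝ := fun n x => χ n x * g x with hφ
  have hφs : ∀ n, ContDiff ℝ ∞ (φ n) := fun n => (hχs n).mul hg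
  have hφc : ∀ n, HasCompactSupport (φ n) := fun n => (hχc n).mul_right
  have hφ1 : ∀ n x, |φ n x| ≤ 1 := fun n x => by
    rw [abs_mul]; exact mul_le_one₀ (hχ1 n x) (abs_nonneg _) (hg1 x)
  set M' : ℝ := ∑ _i : Fin d, (2 * (C * M) + C) with hM'
  -- The function χ_n g fails the eigenvalue equation only through terms with a derivative of χ_n,
  -- which are O(1/(n + 1)) uniformly in x.
  have herr : ∀ n x, |Laplacian.laplacian (φ n) x + l * φ n x| ≤ M' / (n + 1) := by
    intro n x
    have hd : ∀ {f : Euc d → ℝ}, ContDiff ℝ ∞ f → ∀ y, DifferentiableAt ℝ f y := fun hf y =>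
      hf.differentiable (by simp) y
    have h1 : ∀ i, pd i (pd i (φ n)) x = χ n x * pd i (pd i g) x +
        (2 * (pd i (χ n) x * pd i g x) + pd i (pd i (χ n)) x * g x) := by
      intro i
      have h2 : pd i (φ n) = fun y => pd i (χ n) y * g y + χ n y * pd i g y :=
        funext fun y => pd_mul (hd (hχs n) y) (hd hg y) i
      have e1 : DifferentiableAt ℝ (fun y => pd i (χ n) y * g y) x :=
        (hd (contDiff_pd (hχs n) i) x).mul (hd hg x)
      have e2 : DifferentiableAt ℝ (fun y => χ n y * pd i g y) x :=
        (hd (hχs n) x).mul (hd (contDiff_pd hg i) x)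
      rw [h2, pd_add e1 e2, pd_mul (hd (contDiff_pd (hχs n) i) x) (hd hg x),
        pd_mul (hd (hχs n) x) (hd (contDiff_pd hg i) x)]
      ring
    rw [laplacian_eq_sum_pd (hφs n)]
    simp only [h1]
    rw [Finset.sum_add_distrib, ← Finset.mul_sum, hgl]
    have h3 : χ n x * (-l * g x) + ∑ i, (2 * (pd i (χ n) x * pd i g x) +
        pd i (pd i (χ n)) x * g x) + l * φ n x = ∑ i, (2 * (pd i (χ n) x * pd i g x) +
        pd i (pd i (χ n)) x * g x) := by
      simp only [hφ]; ring
    rw [h3, hM', Finset.sum_div]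
    refine (Finset.abs_sum_le_sum_abs _ _).trans (Finset.sum_le_sum fun i _ => ?_)
    have hn : (0 : ℝ) < n + 1 := by positivity
    have h4 : |pd i (χ n) x * pd i g x| ≤ C / (n + 1) * M := by
      rw [abs_mul]
      exact mul_le_mul (hχd n i x) (hgM i x) (abs_nonneg _) (by positivity)
    have h5 : |pd i (pd i (χ n)) x * g x| ≤ C / (n + 1) * 1 := by
      rw [abs_mul]
      exact mul_le_mul (hχd2 n i x) (hg1 x) (abs_nonneg _) (by positivity)
    have h6 : (2 * (C * M) + C) / ((n : ℝ) + 1) = 2 * (C / (n + 1) * M) + C / (n + 1) * 1 := by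
      field_simp
    rw [h6]
    refine (abs_add_le _ _).trans (add_le_add ?_ h5)
    rw [abs_mul, abs_two]
    linarith
  have hsub : Icc s t ⊆ I := hI.out hs ht
  have hφint : ∀ n, ∀ r ∈ I, Integrable (φ n) (μ r) := fun n r hr => by
    have := h.prob r hr
    exact (hφs n).continuous.integrable_of_hasCompactSupport (hφc n)
  have hlapc : ∀ n, Continuous fun x => Laplacian.laplacian (φ n) x := fun n => by
    simp only [laplacian_eq_sum_pd (hφs n)]
    exact continuous_finsetSum _ fun i _ => (contDiff_pd (contDiff_pd (hφs n) i) i).continuous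
  have hlapint : ∀ n, ∀ r ∈ I, Integrable (fun x => Laplacian.laplacian (φ n) x) (μ r) := by
    intro n r hr
    have := h.prob r hr
    refine Integrable.of_bound (hlapc n).aestronglyMeasurable (M' / (n + 1) + l)
      (Filter.Eventually.of_forall fun x => ?_)
    have h1 := abs_le.1 (herr n x)
    have h2 : |l * φ n x| ≤ l := by
      rw [abs_mul, abs_of_nonneg hl]
      exact mul_le_of_le_one_right hl (hφ1 n x)
    have h3 := abs_le.1 h2
    rw [Real.norm_eq_abs, abs_le]
    constructor <;> linarith [h1.1, h1.2, h3.1, h3.2]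
  have hder : ∀ n, ∀ r ∈ I, HasDerivAt (fun r => Real.exp (l * r) * ∫ x, φ n x ∂μ r)
      (Real.exp (l * r) * ∫ x, (Laplacian.laplacian (φ n) x + l * φ n x) ∂μ r) r := by
    intro n r hr
    have h1 : HasDerivAt (fun r : ℝ => Real.exp (l * r)) (Real.exp (l * r) * (l * 1)) r :=
      ((hasDerivAt_id r).const_mul l).exp
    have h2 := h1.mul (h.pde (φ n) (hφs n) (hφc n) r hr)
    convert! h2 using 1
    rw [integral_add (hlapint n r hr) ((hφint n r hr).const_mul l), integral_const_mul]
    ring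
  -- By the mean value inequality, e^(lr) ∫ φ_n dμ_r varies on [s, t] by O(1/(n + 1)); in the limit
  -- it is constant.
  have hmv : ∀ n : ℕ, ‖Real.exp (l * t) * ∫ x, φ n x ∂μ t - Real.exp (l * s) * ∫ x, φ n x ∂μ s‖ ≤
      Real.exp (l * t) * (M' / (n + 1)) * ‖t - s‖ := by
    intro n
    refine (convex_Icc s t).norm_image_sub_le_of_norm_hasDerivWithin_le
      (f := fun r => Real.exp (l * r) * ∫ x, φ n x ∂μ r)
      (fun r hr => (hder n r (hsub hr)).hasDerivWithinAt) (fun r hr => ?_)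
      (left_mem_Icc.2 hst) (right_mem_Icc.2 hst)
    have := h.prob r (hsub hr)
    rw [norm_mul, Real.norm_of_nonneg (Real.exp_pos _).le]
    refine mul_le_mul (Real.exp_le_exp.2 (mul_le_mul_of_nonneg_left hr.2 hl)) ?_ (norm_nonneg _)
      (Real.exp_pos _).le
    have := norm_integral_le_of_norm_le_const (μ := μ r)
      (f := fun x => Laplacian.laplacian (φ n) x + l * φ n x) (Filter.Eventually.of_forall (herr n))
    simpa using this
  have hlim : ∀ r ∈ I, Filter.Tendsto (fun n => Real.exp (l * r) * ∫ x, φ n x ∂μ r) Filter.atTop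
      (nhds (Real.exp (l * r) * ∫ x, g x ∂μ r)) := by
    intro r hr
    have := h.prob r hr
    refine Filter.Tendsto.const_mul _ (tendsto_integral_of_dominated_convergence (fun _ => 1)
      (fun n => (hφs n).continuous.aestronglyMeasurable) (integrable_const _)
      (fun n => Filter.Eventually.of_forall (hφ1 n)) (Filter.Eventually.of_forall fun x => ?_))
    refine tendsto_const_nhds.congr' ?_
    filter_upwards [hχe x] with n hn
    rw [hφ]
    simp [hn]
  have h0 : Filter.Tendsto (fun n : ℕ => Real.exp (l * t) * (M' / (n + 1)) * ‖t - s‖) Filter.atTop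
      (nhds 0) := by
    have h1 := (tendsto_const_div_atTop_nhds_zero_nat M').comp (Filter.tendsto_add_atTop_nat 1)
    have h2 := (h1.const_mul (Real.exp (l * t))).mul_const ‖t - s‖
    simpa using h2
  have h2 := squeeze_zero_norm hmv h0
  have h3 := (hlim t ht).sub (hlim s hs)
  exact sub_eq_zero.1 (tendsto_nhds_unique h3 h2)

theorem pd_inner (ξ : Euc d) (i : Fin d) (x : Euc d) : pd i (fun x => inner ℝ ξ x) x = ξ i := by
  rw [pd]
  change fderiv ℝ (innerSL ℝ ξ) x _ = _
  rw [ContinuousLinearMap.fderiv, innerSL_apply_apply, EuclideanSpace.inner_single_right]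
  simp

theorem differentiableAt_inner (ξ x : Euc d) : DifferentiableAt ℝ (fun x => inner ℝ ξ x) x :=
  (innerSL ℝ ξ).differentiableAt

theorem sum_sq_mul (ξ : Euc d) (c : ℝ) : ∑ i, -(ξ i * ξ i) * c = -‖ξ‖ ^ 2 * c := by
  rw [EuclideanSpace.real_norm_sq_eq, ← Finset.sum_mul, Finset.sum_neg_distrib]
  simp only [pow_two]

theorem pd_cos_inner (ξ : Euc d) (i : Fin d) :
    pd i (fun x => Real.cos (inner ℝ ξ x)) = fun x => -ξ i * Real.sin (inner ℝ ξ x) := by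
  ext x
  rw [pd_comp (differentiableAt_inner ξ x) (Real.hasDerivAt_cos _), pd_inner]
  ring

theorem pd_sin_inner (ξ : Euc d) (i : Fin d) :
    pd i (fun x => Real.sin (inner ℝ ξ x)) = fun x => ξ i * Real.cos (inner ℝ ξ x) := by
  ext x
  rw [pd_comp (differentiableAt_inner ξ x) (Real.hasDerivAt_sin _), pd_inner]
  ring

theorem contDiff_cos_inner (ξ : Euc d) : ContDiff ℝ ∞ fun x => Real.cos (inner ℝ ξ x) :=
  Real.contDiff_cos.comp (innerSL ℝ ξ).contDiff

theorem contDiff_sin_inner (ξ : Euc d) : ContDiff ℝ ∞ fun x => Real.sin (inner ℝ ξ x) :=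
  Real.contDiff_sin.comp (innerSL ℝ ξ).contDiff

theorem pd_const_mul {f : Euc d → ℝ} (hf : ContDiff ℝ ∞ f) (c : ℝ) (i : Fin d) (x : Euc d) :
    pd i (fun y => c * f y) x = c * pd i f x := by
  rw [pd_mul (differentiableAt_const c) (hf.differentiable (by simp) x), pd_const]
  ring

theorem IsHeatFlow.exp_mul_integral_cos (h : IsHeatFlow I μ) (hI : I.OrdConnected) (ξ : Euc d)
    {s t : ℝ} (hs : s ∈ I) (ht : t ∈ I) (hst : s ≤ t) :
    Real.exp (‖ξ‖ ^ 2 * t) * ∫ x, Real.cos (inner ℝ ξ x) ∂μ t =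
      Real.exp (‖ξ‖ ^ 2 * s) * ∫ x, Real.cos (inner ℝ ξ x) ∂μ s := by
  refine h.exp_mul_integral_eq hI (contDiff_cos_inner ξ) (fun x => Real.abs_cos_le_one _) (M := ‖ξ‖)
    (fun i x => ?_) (sq_nonneg _) (fun x => ?_) hs ht hst
  · rw [pd_cos_inner, abs_mul, abs_neg]
    exact (mul_le_of_le_one_right (abs_nonneg _) (Real.abs_sin_le_one _)).trans
      (PiLp.norm_apply_le ξ i)
  · rw [← sum_sq_mul]
    refine Finset.sum_congr rfl fun i _ => ?_
    rw [pd_cos_inner, pd_const_mul (contDiff_sin_inner ξ), pd_sin_inner]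
    ring

theorem IsHeatFlow.exp_mul_integral_sin (h : IsHeatFlow I μ) (hI : I.OrdConnected) (ξ : Euc d)
    {s t : ℝ} (hs : s ∈ I) (ht : t ∈ I) (hst : s ≤ t) :
    Real.exp (‖ξ‖ ^ 2 * t) * ∫ x, Real.sin (inner ℝ ξ x) ∂μ t =
      Real.exp (‖ξ‖ ^ 2 * s) * ∫ x, Real.sin (inner ℝ ξ x) ∂μ s := by
  refine h.exp_mul_integral_eq hI (contDiff_sin_inner ξ) (fun x => Real.abs_sin_le_one _) (M := ‖ξ‖)
    (fun i x => ?_) (sq_nonneg _) (fun x => ?_) hs ht hst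
  · rw [pd_sin_inner, abs_mul]
    exact (mul_le_of_le_one_right (abs_nonneg _) (Real.abs_cos_le_one _)).trans
      (PiLp.norm_apply_le ξ i)
  · rw [← sum_sq_mul]
    refine Finset.sum_congr rfl fun i _ => ?_
    rw [pd_sin_inner, pd_const_mul (contDiff_cos_inner ξ), pd_cos_inner]
    ring

theorem charFun_eq_cos_add_sin (m : Measure (Euc d)) [IsProbabilityMeasure m] (ξ : Euc d) :
    charFun m ξ = (∫ x, Real.cos (inner ℝ ξ x) ∂m : ℝ) +
      (∫ x, Real.sin (inner ℝ ξ x) ∂m : ℝ) * Complex.I := by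
  have hc : Integrable (fun x => Real.cos (inner ℝ ξ x)) m :=
    Integrable.of_bound (contDiff_cos_inner ξ).continuous.aestronglyMeasurable 1
      (Filter.Eventually.of_forall fun x => Real.abs_cos_le_one _)
  have hs : Integrable (fun x => Real.sin (inner ℝ ξ x)) m :=
    Integrable.of_bound (contDiff_sin_inner ξ).continuous.aestronglyMeasurable 1
      (Filter.Eventually.of_forall fun x => Real.abs_sin_le_one _)
  rw [charFun_apply, ← integral_complex_ofReal, ← integral_complex_ofReal, ← integral_mul_const,
    ← integral_add hc.ofReal (hs.ofReal.mul_const _)]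
  refine integral_congr_ae (Filter.Eventually.of_forall fun x => ?_)
  simp only
  rw [Complex.exp_mul_I, real_inner_comm, Complex.ofReal_cos, Complex.ofReal_sin]

theorem IsHeatFlow.charFun_eq (h : IsHeatFlow I μ) (hI : I.OrdConnected) (ξ : Euc d)
    {s t : ℝ} (hs : s ∈ I) (ht : t ∈ I) (hst : s ≤ t) :
    charFun (μ t) ξ = Real.exp (-(t - s) * ‖ξ‖ ^ 2) * charFun (μ s) ξ := by
  have := h.prob t ht
  have := h.prob s hs
  have key : ∀ {a b : ℝ}, Real.exp (‖ξ‖ ^ 2 * t) * a = Real.exp (‖ξ‖ ^ 2 * s) * b →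
      a = Real.exp (-(t - s) * ‖ξ‖ ^ 2) * b := by
    intro a b hab
    have h1 : Real.exp (-(t - s) * ‖ξ‖ ^ 2) =
        Real.exp (-(‖ξ‖ ^ 2 * t)) * Real.exp (‖ξ‖ ^ 2 * s) := by
      rw [← Real.exp_add]; congr 1; ring
    rw [h1, mul_assoc, ← hab, ← mul_assoc, ← Real.exp_add, neg_add_cancel, Real.exp_zero, one_mul]
  rw [charFun_eq_cos_add_sin, charFun_eq_cos_add_sin, key (h.exp_mul_integral_cos hI ξ hs ht hst),
    key (h.exp_mul_integral_sin hI ξ hs ht hst)]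
  push_cast
  ring

theorem charFun_heatMeasure (ν : Measure (Euc d)) [IsProbabilityMeasure ν] {τ : ℝ} (hτ : 0 < τ)
    (ξ : Euc d) : charFun (heatMeasure ν τ) ξ = Real.exp (-τ * ‖ξ‖ ^ 2) * charFun ν ξ := by
  have h := integral_heatMeasure_cexp ν hτ ξ
  have e : ∀ x, Complex.exp (Complex.I * (inner ℝ ξ x : ℝ)) =
      Complex.exp ((inner ℝ x ξ : ℝ) * Complex.I) := fun x => by
    rw [mul_comm, real_inner_comm]
  simp only [e] at h
  rw [charFun_apply, charFun_apply, ← h, heatMeasure, integral_withDensity_eq_integral_toReal_smul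
    (contDiff_heatConv ν 1 hτ).continuous.measurable.ennreal_ofReal (by simp)]
  refine integral_congr_ae (Filter.Eventually.of_forall fun x => ?_)
  simp only
  rw [ENNReal.toReal_ofReal (heatConv_one_pos ν hτ x).le, Complex.real_smul]

/-- A heat flow is given by convolution with the heat kernel. -/
theorem IsHeatFlow.eq_heatMeasure (h : IsHeatFlow I μ) (hI : I.OrdConnected) {s t : ℝ}
    (hs : s ∈ I) (ht : t ∈ I) (hst : s < t) : μ t = heatMeasure (μ s) (t - s) := by
  have := h.prob t ht
  have := h.prob s hs
  have := isProbabilityMeasure_heatMeasure (μ s) (sub_pos.2 hst)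
  refine Measure.ext_of_charFun (funext fun ξ => ?_)
  rw [h.charFun_eq hI ξ hs ht hst.le, charFun_heatMeasure (μ s) (sub_pos.2 hst)]

end Uniqueness

/-! ### Derivatives of the entropy of a heat flow -/

section HigherDerivatives

/-- Iterated derivatives from a hierarchy of first derivatives. -/
theorem iteratedDeriv_eq_of_hierarchy {I : Set ℝ} (hI : IsOpen I) {g : ℕ → ℝ → ℝ}
    (h : ∀ n, ∀ t ∈ I, HasDerivAt (g n) (- g (n + 1) t) t) :
    ContDiffOn ℝ ∞ (g 0) I ∧
      ∀ n, ∀ t ∈ I, (-1 : ℝ) ^ n * iteratedDeriv n (g 0) t = g n t := by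
  have hd : ∀ n, ∀ t ∈ I, iteratedDeriv n (g 0) t = (-1) ^ n * g n t := by
    intro n
    induction n with
    | zero => intro t _; simp
    | succ n ih =>
      intro t ht
      have he : iteratedDeriv n (g 0) =ᶠ[nhds t] fun t => (-1) ^ n * g n t := by
        filter_upwards [hI.mem_nhds ht] with r hr using ih r hr
      rw [iteratedDeriv_succ, he.deriv_eq, ((h n t ht).const_mul _).deriv]
      ring
  have hc : ∀ (k n : ℕ), ContDiffOn ℝ k (g n) I := by
    intro k
    induction k with
    | zero =>
      intro n
      exact contDiffOn_zero.2 fun t ht => (h n t ht).continuousAt.continuousWithinAt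
    | succ k ih =>
      intro n
      have : ContDiffOn ℝ ((k : WithTop ℕ∞) + 1) (g n) I := by
        rw [contDiffOn_succ_iff_deriv_of_isOpen hI]
        refine ⟨fun t ht => (h n t ht).differentiableAt.differentiableWithinAt, by simp, ?_⟩
        exact (ih (n + 1)).neg.congr fun t ht => (h n t ht).deriv
      exact_mod_cast this
  refine ⟨contDiffOn_infty.2 fun k => hc k 0, fun n t ht => ?_⟩
  rw [hd n t ht, ← mul_assoc, ← mul_pow]
  simp

variable {d : ℕ} {I : Set ℝ} {μ : ℝ → Measure (Euc d)}

theorem exists_mem_lt {I : Set ℝ} (hI : IsOpen I) {t : ℝ} (ht : t ∈ I) : ∃ s ∈ I, s < t := by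
  obtain ⟨ε, hε, hb⟩ := Metric.isOpen_iff.1 hI t ht
  refine ⟨t - ε / 2, hb ?_, by linarith⟩
  rw [Metric.mem_ball, Real.dist_eq, abs_lt]
  constructor <;> linarith

theorem IsHeatFlow.isRegular (h : IsHeatFlow I μ) (hIo : IsOpen I) (hI : I.OrdConnected) {t : ℝ}
    (ht : t ∈ I) : IsRegular (μ t) := by
  obtain ⟨s, hs, hst⟩ := exists_mem_lt hIo ht
  have := h.prob s hs
  have := isProbabilityMeasure_heatMeasure (μ s) (sub_pos.2 hst)
  rw [h.eq_heatMeasure hI hs ht hst]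
  exact (isJet_heatMeasure (μ s) (h.moment s hs) (sub_pos.2 hst)).isRegular

theorem IsHeatFlow.integrable_log (h : IsHeatFlow I μ) (hIo : IsOpen I) (hI : I.OrdConnected)
    {t : ℝ} (ht : t ∈ I) :
    Integrable (fun x => Real.log ((μ t).rnDeriv volume x).toReal) (μ t) := by
  obtain ⟨s, hs, hst⟩ := exists_mem_lt hIo ht
  have := h.prob s hs
  rw [h.eq_heatMeasure hI hs ht hst]
  exact (integrable_log_heatConv (h.moment s hs) (sub_pos.2 hst)).congr
    (hasSmoothDensity_heatMeasure (μ s) (sub_pos.2 hst)).log_rnDeriv.symm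

/-- Near t the flow is the heat semigroup started from an earlier measure `μ s`, so derivatives
along the semigroup carry over. -/
theorem IsHeatFlow.hasDerivAt_of_heatMeasure (h : IsHeatFlow I μ) (hIo : IsOpen I)
    (hI : I.OrdConnected) {Φ Ψ : Measure (Euc d) → ℝ}
    (hΦ : ∀ ν : Measure (Euc d), IsProbabilityMeasure ν → Integrable (fun y => ‖y‖ ^ 2) ν →
      ∀ τ, 0 < τ → HasDerivAt (fun τ => Φ (heatMeasure ν τ)) (Ψ (heatMeasure ν τ)) τ)
    {t : ℝ} (ht : t ∈ I) : HasDerivAt (fun t => Φ (μ t)) (Ψ (μ t)) t := by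
  obtain ⟨s, hs, hst⟩ := exists_mem_lt hIo ht
  have h1 := hΦ (μ s) (h.prob s hs) (h.moment s hs) (t - s) (sub_pos.2 hst)
  rw [← h.eq_heatMeasure hI hs ht hst] at h1
  refine (h1.comp_sub_const t s).congr_of_eventuallyEq ?_
  filter_upwards [hIo.mem_nhds ht, Ioi_mem_nhds hst] with r hr hsr
  rw [h.eq_heatMeasure hI hs hr hsr]

theorem IsHeatFlow.entropy_derivatives (h : IsHeatFlow I μ) (hIo : IsOpen I)
    (hI : I.OrdConnected) :
    ContDiffOn ℝ ∞ (fun t => entropy (μ t)) I ∧ ∀ n : ℕ, 1 ≤ n → ∀ t ∈ I,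
      (-1 : ℝ) ^ n * iteratedDeriv n (fun s => entropy (μ s)) t =
        forestVal (μ t) (gradForest n) := by
  -- The hierarchy starts with the entropy at level 0; the forests enter from level 1 on, because
  -- the value of a single node is not the entropy.
  let Φ : ℕ → Measure (Euc d) → ℝ := fun n m =>
    if n = 0 then entropy m else forestVal m (gradForest n)
  have key := iteratedDeriv_eq_of_hierarchy hIo (g := fun n t => Φ n (μ t)) fun n t ht => by
    refine h.hasDerivAt_of_heatMeasure hIo hI (Φ := Φ n) (Ψ := fun m => - Φ (n + 1) m)
      (fun ν hP hν τ hτ => ?_) ht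
    rcases Nat.eq_zero_or_pos n with rfl | hn
    · simp only [Φ, if_pos, zero_add, one_ne_zero, if_false]
      rw [forestVal_gradForest_one hν hτ]
      exact hasDerivAt_entropy hν hτ
    · simp only [Φ, hn.ne', Nat.succ_ne_zero, if_false]
      exact hasDerivAt_forestVal hν hτ hn
  refine ⟨key.1, fun n hn t ht => (key.2 n t ht).trans ?_⟩
  simp only [Φ, if_neg (by omega : n ≠ 0)]

end HigherDerivatives

end EntropyFlow

theorem mainTheorem3 (d : ℕ) :
    (∀ μ : Measure (EntropyFlow.Euc d), IsProbabilityMeasure μ → EntropyFlow.IsRegular μ →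
      ∀ (V : Type) [Fintype V] [Nontrivial V] (G : SimpleGraph V), G.IsTree →
        (∀ u v : V, G.Adj u v → ∃! Ψ : EntropyFlow.Euc d → EntropyFlow.Euc d,
          EntropyFlow.IsBranchVal μ G u v Ψ) ∧
        ∃ c : ℝ, ∀ (p : EntropyFlow.Parenthesization G) (c' : ℝ),
          EntropyFlow.HasVal μ G p c' ↔ c' = c) ∧
    (∀ (I : Set ℝ) (μ : ℝ → Measure (EntropyFlow.Euc d)), IsOpen I → I.OrdConnected →
      EntropyFlow.IsHeatFlow I μ →
        (∀ t ∈ I, EntropyFlow.IsRegular (μ t) ∧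
          Integrable (fun x => Real.log ((μ t).rnDeriv volume x).toReal) (μ t)) ∧
        ContDiffOn ℝ ∞ (fun t => EntropyFlow.entropy (μ t)) I ∧
        ∀ n : ℕ, 1 ≤ n → ∀ t ∈ I,
          (-1 : ℝ) ^ n * iteratedDeriv n (fun s => EntropyFlow.entropy (μ s)) t =
            EntropyFlow.forestVal (μ t) (EntropyFlow.gradForest n)) := by
  refine ⟨fun μ hμ hreg V _ _ G hG => EntropyFlow.parenthesizations_agree hμ hreg hG,
    fun I μ hIo hI h => ⟨fun t ht => ⟨h.isRegular hIo hI ht, h.integrable_log hIo hI ht⟩,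
      h.entropy_derivatives hIo hI⟩⟩
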